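/- **Setting.** Let $N\cong\mathbb{Z}^n$, $M=\mathrm{Hom}(N,\mathbb{Z})$, $N_{\mathbb{R}}=N\otimes\mathbb{R}$, and let $\Sigma$ be a complete fan in $N_{\mathbb{R}}$ (a finite set of rational strictly convex polyhedral cones, closed under taking faces, any two meeting in a common face, with union $N_{\mathbb{R}}$). Put $U(\sigma)=\mathrm{Spec}\,\mathbb{C}[\sigma^\vee\cap M]$ and $X_\Sigma=\varinjlim U(\sigma)$, with the torus $T=(\mathbb{C}^\times)^n$ acting on functions by $\lambda\cdot z^m=\lambda^m z^m$, i.e. $z^m(\lambda\cdot p)=\lambda^{-m}z^m(p)$ on points. A toric vector bundle on $X_\Sigma$ is an algebraic vector bundle with an algebraic lift of the $T$-action that is linear on fibres; isomorphisms of toric vector bundles are $T$-equivariant and cover the identity of $X_\Sigma$. For $m\in M$ let $\mathcal{L}_m$ be the trivial line bundle on $U(\sigma)$ with frame $1$ and action $\lambda\cdot(p,1)=(\lambda\cdot p,\lambda^m 1)$. A cone complex is a topological space $X$ with a finite set of closed subsets $\sigma$ and, for each of them, a finitely generated group $M(\sigma)$ of continuous real functions on $\sigma$, such that (1) the map $\sigma\to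 (M(\sigma)\otimes\mathbb{R})^\vee$, $x\mapsto(u\mapsto u(x))$, is a homeomorphism onto a convex rational polyhedral cone; (2) the preimages $\tau$ of the faces of that cone belong to the complex, with $M(\tau)=M(\sigma)|_\tau$; (3) $X$ is the disjoint union of the relative interiors $\mathrm{Int}(\sigma)$. A morphism is a continuous map $f$ such that each cone $\sigma'$ is mapped into some cone $\sigma$ with $f^*M(\sigma)\subset M(\sigma')$. A weight is a function $\mu:X\to\mathbb{Z}_{>0}$ that is constant on each $\mathrm{Int}(\sigma)$, and $Tr_f(\mu)(x)=\sum_{x'\in f^{-1}(x)}\mu(x')$. The fan $\Sigma$ makes $N_{\mathbb{R}}$ a cone complex with $M(\sigma)=M|_\sigma$. A tropical Lagrangian multi-section of rank $r$ over $\Sigma$ is a tuple $\mathbb{L}=(L,\Sigma_L,\mu,\pi,\varphi)$, where $(L,\Sigma_L)$ is a cone complex with weight $\mu$; $\pi:L\to N_{\mathbb{R}}$ is a branched covering map of degree $r$, that is, a surjective morphism mapping each $\sigma'\in\Sigma_L$ isomorphically (homeomorphically, with $M(\sigma')=\pi^*M(\pi(\sigma'))$) onto a cone of $\Sigma$, such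 that $Tr_{\pi|_V}(\mu)$ is constant on $U$ for every connected open $U\subset N_{\mathbb{R}}$ and every connected component $V$ of $\pi^{-1}(U)$, and $Tr_\pi(\mu)=r$; and $\varphi:L\to\mathbb{R}$ satisfies $\varphi|_{\sigma'}\in M(\sigma')$ for all $\sigma'\in\Sigma_L$. Write $\mathbb{L}_1\le\mathbb{L}_2$ if there is a surjective morphism $f:L_2\to L_1$ with $\pi_1\circ f=\pi_2$, $Tr_f(\mu_2)=\mu_1$ and $f^*\varphi_1=\varphi_2$. For $\sigma\in\Sigma(n)$ (the $n$-dimensional cones) let $\sigma^{(1)},\dots,\sigma^{(r)}$ be an enumeration of the lifts of $\sigma$ to $\Sigma_L$, a lift $\sigma'$ being listed $\mu(\sigma')$ times (the value of $\mu$ on $\mathrm{Int}(\sigma')$), and let $m(\sigma^{(\alpha)})\in M$ be the slope of $\varphi$ on $\sigma^{(\alpha)}$. Kaneyama data on $\mathbb{L}$ are a family $\mathbf{g}=\{g_{\sigma_1\sigma_2}\}_{\sigma_1,\sigma_2\in\Sigma(n)}\subset GL(r,\mathbb{C})$ such that - (G1) $g_{\sigma\sigma}=\mathrm{Id}$; -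 (G2) the $(\alpha,\beta)$-entry $g_{\sigma_1^{(\alpha)}\sigma_2^{(\beta)}}$ of $g_{\sigma_1\sigma_2}$ is non-zero only if $\sigma_1^{(\alpha)}\cap\sigma_2^{(\beta)}\ne\emptyset$ and $m(\sigma_1^{(\alpha)})-m(\sigma_2^{(\beta)})\in(\sigma_1\cap\sigma_2)^\vee\cap M$; - (G3) $g_{\sigma_1\sigma_2}g_{\sigma_2\sigma_3}=g_{\sigma_1\sigma_3}$. Kaneyama data $\mathbf{g},\mathbf{g}'$ on $\mathbb{L}$ are equivalent if there are $h_\sigma\in GL(r,\mathbb{C})$, $\sigma\in\Sigma(n)$, such that (H1) the $(\alpha,\beta)$-entry of $h_\sigma$ is non-zero only if $m(\sigma^{(\alpha)})-m(\sigma^{(\beta)})\in\sigma^\vee\cap M$, and (H2) $h_{\sigma_1}g_{\sigma_1\sigma_2}=g'_{\sigma_1\sigma_2}h_{\sigma_2}$ for all $\sigma_1,\sigma_2\in\Sigma(n)$. Denote by $\mathcal{E}(\mathbb{L},\mathbf{g})$ a toric vector bundle obtained by gluing the equivariant bundles $\bigoplus_{\alpha=1}^r\mathcal{L}_{m(\sigma^{(\alpha)})}$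 on $U(\sigma)$, $\sigma\in\Sigma(n)$, with frames $1(\sigma^{(\alpha)})$, by $$1(\sigma_1^{(\alpha)})=\sum_{\beta=1}^r g_{\sigma_1^{(\alpha)}\sigma_2^{(\beta)}}\,z^{m(\sigma_1^{(\alpha)})-m(\sigma_2^{(\beta)})}\,1(\sigma_2^{(\beta)})\quad\text{on }U(\sigma_1\cap\sigma_2).$$ For a toric vector bundle $\mathcal{E}$ of rank $r$ with equivariant splittings $\mathcal{E}|_{U(\sigma)}\cong\bigoplus_{\alpha=1}^r\mathcal{L}_{m_\alpha(\sigma)}$ for all $\sigma\in\Sigma$, let $\mathbf{m}(\sigma)$ be the multi-set of the classes of the $m_\alpha(\sigma)$ in $M/(\sigma^\perp\cap M)$, and let $\mathbb{L}_{\mathcal{E}}$ be given as follows. Let $\Sigma_{\mathcal{E}}=\{(\sigma,m):\sigma\in\Sigma,\ m\in\mathbf{m}(\sigma)\}$, ordered by $(\sigma_1,m_1)\le(\sigma_2,m_2)$ iff $\sigma_1\subset\sigma_2$ and $m_2|_{\sigma_1}=m_1$, with the topology whose closed sets are the downward closed ones. The domain is $L_{\mathcal{E}}=\{(x,(\sigma,m)):x\in\mathrm{Int}(\sigma),\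 (\sigma,m)\in\Sigma_{\mathcal{E}}\}$, a subspace of $N_{\mathbb{R}}\times\Sigma_{\mathcal{E}}$; its cones are the sets of points lying over $\{c\in\Sigma_{\mathcal{E}}:c\le(\sigma,m)\}$, with $M$ pulled back from $N_{\mathbb{R}}$ as their functions; $\pi_{\mathcal{E}}$ is the projection to $N_{\mathbb{R}}$; $\mu_{\mathcal{E}}(x,(\sigma,m))$ is the multiplicity of $m$ in $\mathbf{m}(\sigma)$; and $\varphi_{\mathcal{E}}(x,(\sigma,m))=\langle m,x\rangle$. **Theorem 4.3.** Let $\mathbb{L}$ be a tropical Lagrangian multi-section of rank $r$ over $\Sigma$. 1. If $\mathbf{g}$ are Kaneyama data on $\mathbb{L}$, then a toric vector bundle $\mathcal{E}(\mathbb{L},\mathbf{g})$ on $X_\Sigma$ exists. It has equivariant splittings on all $U(\sigma)$, $\sigma\in\Sigma$, and for every choice of these $\mathbb{L}_{\mathcal{E}(\mathbb{L},\mathbf{g})}$ is a tropical Lagrangian multi-section of rank $r$ over $\Sigma$ with $\mathbb{L}_{\mathcal{E}(\mathbb{L},\mathbf{g})}\le\mathbb{L}$. 2. Two Kaneyama data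 $\mathbf{g},\mathbf{g}'$ on $\mathbb{L}$ are equivalent if and only if $\mathcal{E}(\mathbb{L},\mathbf{g})\cong\mathcal{E}(\mathbb{L},\mathbf{g}')$ as toric vector bundles. -/

import Mathlib

open scoped TensorProduct

universe u v

noncomputable section

namespace TropToric

/-! # Lattices, cones and fans

`N = ℤⁿ`, `M = Hom(N, ℤ) = ℤⁿ`, `N_ℝ = ℝⁿ`. -/

/-- The real vector space `N_ℝ`. -/
abbrev NR (n : ℕ) : Type := Fin n → ℝ

/-- The dual lattice `M`. -/
abbrev MLat (n : ℕ) : Type := Fin n → ℤ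

/-- The pairing `⟨m, x⟩` as a homomorphism from `M` to the functions on `N_ℝ`. -/
def pairing {n : ℕ} : MLat n →+ (NR n → ℝ) where
  toFun m x := ∑ i, (m i : ℝ) * x i
  map_zero' := by ext x; simp
  map_add' a b := by ext x; simp [add_mul, Finset.sum_add_distrib]

/-- The monoid `σ^∨ ∩ M`. -/
def dualMonoid {n : ℕ} (σ : PointedCone ℝ (NR n)) : AddSubmonoid (MLat n) where
  carrier := {m | ∀ x ∈ σ, 0 ≤ pairing m x}
  zero_mem' := fun x _ => by simp
  add_mem' := fun ha hb x hx => by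
    simpa [map_add] using add_nonneg (ha x hx) (hb x hx)

/-- The group `σ^⊥ ∩ M`. -/
def perp {n : ℕ} (σ : PointedCone ℝ (NR n)) : AddSubgroup (MLat n) where
  carrier := {m | ∀ x ∈ σ, pairing m x = 0}
  zero_mem' := fun x _ => by simp
  add_mem' := fun ha hb x hx => by simp [map_add, ha x hx, hb x hx]
  neg_mem' := fun ha x hx => by simp [map_neg, ha x hx]

theorem dualMonoid_anti {n : ℕ} {τ σ : PointedCone ℝ (NR n)} (h : τ ≤ σ) :
    dualMonoid σ ≤ dualMonoid τ := fun _ hm x hx => hm x (h hx)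

/-- A (finite) fan of rational strictly convex polyhedral cones in `N_ℝ`. -/
structure Fan (n : ℕ) where
  cones : Set (PointedCone ℝ (NR n))
  finite : cones.Finite
  rational : ∀ σ ∈ cones, ∃ S : Finset (Fin n → ℤ),
    σ = PointedCone.hull ℝ ((fun (v : Fin n → ℤ) (i : Fin n) => (v i : ℝ)) '' (S : Set (Fin n → ℤ)))
  strictlyConvex : ∀ σ ∈ cones, ∀ x ∈ σ, -x ∈ σ → x = 0
  face_mem : ∀ σ ∈ cones, ∀ τ : PointedCone ℝ (NR n), τ.IsFaceOf σ → τ ∈ cones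
  inter_isFaceOf : ∀ σ ∈ cones, ∀ τ ∈ cones, (σ ⊓ τ).IsFaceOf σ

namespace Fan

variable {n : ℕ} (F : Fan n)

/-- The fan is complete: its cones cover `N_ℝ`. -/
def IsComplete : Prop := ∀ x : NR n, ∃ σ ∈ F.cones, x ∈ σ

/-- The cones of the fan, as a type. -/
abbrev Cone : Type := {σ : PointedCone ℝ (NR n) // σ ∈ F.cones}

/-- The maximal cones, that is, the elements of `Σ(n)`. -/
abbrev MaxCone : Type :=
  {σ : F.Cone // Module.finrank ℝ (Submodule.span ℝ (σ.1 : Set (NR n))) = n}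

variable {F}

/-- The intersection of two cones of the fan. -/
def Cone.inter (σ τ : F.Cone) : F.Cone :=
  ⟨σ.1 ⊓ τ.1, F.face_mem _ σ.2 _ (F.inter_isFaceOf _ σ.2 _ τ.2)⟩

end Fan

/-! # Cone complexes -/

/-- The data of a cone complex: a collection of subsets of `X` and for each of them a group of
real functions on it. (`M` is only used on members of `cones`.) -/
structure ConeData (X : Type u) where
  cones : Set (Set X)
  M : ∀ σ : Set X, AddSubgroup (σ → ℝ)

namespace ConeData

/-- The relative interior of a cone: the points that do not lie on any proper face.
The faces of `σ` are the zero loci in `σ` of those `u ∈ M(σ)` which are nonnegative on `σ`. -/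
def interior {X : Type u} (C : ConeData X) (σ : Set X) : Set X :=
  {x | ∃ h : x ∈ σ, ∀ u ∈ C.M σ, (∀ y, 0 ≤ u y) → u ⟨x, h⟩ = 0 → u = 0}

/-- The natural map `φ_σ : σ → (M(σ) ⊗ ℝ)^∨ = Hom(M(σ), ℝ) ⊆ ℝ^{M(σ)}`, `x ↦ (u ↦ u x)`.
The topology on the target is that of pointwise convergence. -/
def evalMap {X : Type u} (C : ConeData X) (σ : Set X) (x : σ) : C.M σ → ℝ := fun u => u.1 x

/-- The axioms of a cone complex. -/
structure IsConeComplex {X : Type u} [TopologicalSpace X] (C : ConeData X) : Prop where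
  finite : C.cones.Finite
  closed : ∀ σ ∈ C.cones, IsClosed σ
  continuous : ∀ σ ∈ C.cones, ∀ u ∈ C.M σ, Continuous u
  fg : ∀ σ ∈ C.cones, (C.M σ).FG
  /-- `φ_σ` is a homeomorphism onto its image. -/
  embedding : ∀ σ ∈ C.cones, Topology.IsEmbedding (C.evalMap σ)
  /-- The image of `φ_σ` is a convex polyhedral cone generated by finitely many elements of
  `Hom(M(σ), ℤ)`. -/
  rational : ∀ σ ∈ C.cones, ∃ S : Finset (C.M σ →+ ℤ),
    Set.range (C.evalMap σ) =
      {f | ∃ c : (C.M σ →+ ℤ) → ℝ, (∀ s, 0 ≤ c s) ∧ f = fun u => ∑ s ∈ S, c s * (s u : ℝ)}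
  /-- The preimage of a face of `φ_σ(σ)` is a cone `τ` of the complex, and `M(τ)` consists of the
  restrictions of the elements of `M(σ)`. -/
  face : ∀ σ ∈ C.cones, ∀ u ∈ C.M σ, (∀ y, 0 ≤ u y) →
    ∃ τ ∈ C.cones, ∃ hτ : τ ⊆ σ, τ = {x | ∃ h : x ∈ σ, u ⟨x, h⟩ = 0} ∧
      ∀ w : τ → ℝ, w ∈ C.M τ ↔ ∃ w' ∈ C.M σ, w = fun x => w' ⟨x.1, hτ x.2⟩
  /-- `X` is the disjoint union of the relative interiors. -/
  partition : ∀ x : X, ∃! σ, σ ∈ C.cones ∧ x ∈ C.interior σ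

/-- Morphisms of cone complexes. -/
def IsMorphism {X : Type u} {Y : Type v} [TopologicalSpace X] [TopologicalSpace Y]
    (C : ConeData X) (D : ConeData Y) (f : X → Y) : Prop :=
  Continuous f ∧ ∀ σ' ∈ C.cones, ∃ σ ∈ D.cones, ∃ h : Set.MapsTo f σ' σ,
    ∀ u ∈ D.M σ, (fun x : σ' => u ⟨f x.1, h x.2⟩) ∈ C.M σ'

/-- Piecewise linear functions on a cone complex. -/
def IsPL {X : Type u} (C : ConeData X) (φ : X → ℝ) : Prop :=
  ∀ σ ∈ C.cones, (fun x : σ => φ x.1) ∈ C.M σ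

/-- `μ` is a weight function: positive, and constant on the relative interior of each cone. -/
def IsWeight {X : Type u} (C : ConeData X) (μ : X → ℕ) : Prop :=
  (∀ x, 0 < μ x) ∧ ∀ σ ∈ C.cones, ∀ x ∈ C.interior σ, ∀ y ∈ C.interior σ, μ x = μ y

end ConeData

/-- The trace `Tr_{f|_V}(μ)`, `x ↦ ∑_{x' ∈ f⁻¹(x) ∩ V} μ(x')`. (In all uses the fibres of `f` are
finite.) -/
def trace {X : Type u} {Y : Type v} (f : X → Y) (V : Set X) (μ : X → ℕ) (x : Y) : ℕ :=
  ∑ᶠ x' ∈ (f ⁻¹' {x}) ∩ V, μ x'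

/-- The functions on `K` of the form `x ↦ ⟨m, p x⟩` with `m ∈ M`, for a map `p` to `N_ℝ`. -/
def pulledBack {n : ℕ} {X : Type u} (p : X → NR n) (K : Set X) : AddSubgroup (K → ℝ) :=
  AddMonoidHom.range
    ({ toFun := fun m x => pairing m (p x.1)
       map_zero' := by ext x; simp
       map_add' := fun a b => by ext x; simp } : MLat n →+ (K → ℝ))

/-- The cone complex structure on `N_ℝ` given by a fan; `M(σ)` consists of the restrictions to `σ`
of the elements of `M`. -/
def Fan.coneData {n : ℕ} (F : Fan n) : ConeData (NR n) where
  cones := (fun σ : PointedCone ℝ (NR n) => (σ : Set (NR n))) '' F.cones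
  M := pulledBack id

/-- `π : (X, C, μ) → (N_ℝ, Σ)` is a branched covering map: a surjective morphism which maps each
cone of `X` isomorphically (homeomorphically, with `M(σ') = π^* M(π(σ'))`) onto a cone of `Σ`, such
that for every connected open `U` and every connected component `V` of `π⁻¹(U)` the trace of `μ`
along `V → U` is constant. -/
structure IsBranchedCovering {n : ℕ} (F : Fan n) {X : Type u} [TopologicalSpace X]
    (C : ConeData X) (μ : X → ℕ) (π : X → NR n) : Prop where
  surjective : Function.Surjective π
  morphism : C.IsMorphism F.coneData π
  cone_image : ∀ σ' ∈ C.cones, π '' σ' ∈ F.coneData.cones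
  cone_homeo : ∀ σ' ∈ C.cones, Topology.IsEmbedding (fun x : σ' => π x.1)
  cone_iso : ∀ σ' ∈ C.cones, C.M σ' = pulledBack π σ'
  trace_const : ∀ U : Set (NR n), IsOpen U → IsConnected U → ∀ p ∈ π ⁻¹' U,
    ∃ c : ℕ, 0 < c ∧ ∀ x ∈ U, trace π (connectedComponentIn (π ⁻¹' U) p) μ x = c

/-! # Tropical Lagrangian multi-sections -/

/-- The data `(L, Σ_L, μ, π, φ)` of a tropical Lagrangian multi-section. -/
structure MultiSection (n : ℕ) where
  L : Type u
  [top : TopologicalSpace L]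
  complex : ConeData L
  μ : L → ℕ
  π : L → NR n
  φ : L → ℝ

attribute [instance] MultiSection.top

namespace MultiSection

variable {n : ℕ}

/-- The axioms of a tropical Lagrangian multi-section of rank `r` over the fan `F`. -/
structure IsTropicalLagrangian (F : Fan n) (r : ℕ) (A : MultiSection.{u} n) : Prop where
  isConeComplex : A.complex.IsConeComplex
  isWeight : A.complex.IsWeight A.μ
  isBranchedCovering : IsBranchedCovering F A.complex A.μ A.π
  rank : ∀ x : NR n, trace A.π Set.univ A.μ x = r
  isPL : A.complex.IsPL A.φ

/-- The relation `𝕃₁ ≤ 𝕃₂`: there is a surjective morphism of cone complexes `f : L₂ → L₁` with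
`π₁ ∘ f = π₂`, `Tr_f(μ₂) = μ₁` and `f^* φ₁ = φ₂`. -/
def Le (A₁ : MultiSection.{u} n) (A₂ : MultiSection.{v} n) : Prop :=
  ∃ f : A₂.L → A₁.L, Function.Surjective f ∧ A₂.complex.IsMorphism A₁.complex f ∧
    A₁.π ∘ f = A₂.π ∧ trace f Set.univ A₂.μ = A₁.μ ∧ A₁.φ ∘ f = A₂.φ

/-- The slope of `φ` on `σ'`: the element `m ∈ M` with `φ = ⟨m, π ·⟩` on `σ'`. It exists and is
unique if `σ'` is an `n`-dimensional cone of a tropical Lagrangian multi-section. -/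
def slope (A : MultiSection.{u} n) (σ' : Set A.L) : MLat n :=
  Classical.epsilon fun m => ∀ x ∈ σ', A.φ x = pairing m (A.π x)

/-- An enumeration `σ^{(1)}, …, σ^{(r)}` of the lifts of each maximal cone `σ`, counted with
multiplicity: each lift `σ'` occurs `μ(σ')` times. -/
structure Labelling (A : MultiSection.{u} n) (F : Fan n) (r : ℕ) where
  lift : F.MaxCone → Fin r → Set A.L
  mem : ∀ σ α, lift σ α ∈ A.complex.cones
  isLift : ∀ σ α, A.π '' lift σ α = (σ.1.1 : Set (NR n))
  count : ∀ σ : F.MaxCone, ∀ σ' ∈ A.complex.cones, A.π '' σ' = (σ.1.1 : Set (NR n)) →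
    ∀ x ∈ A.complex.interior σ', Nat.card {α : Fin r // lift σ α = σ'} = A.μ x

namespace Labelling

variable {F : Fan n} {r : ℕ} {A : MultiSection.{u} n} (ℓ : A.Labelling F r)

/-- The slope `m(σ^{(α)})`. -/
def m (σ : F.MaxCone) (α : Fin r) : MLat n := A.slope (ℓ.lift σ α)

/-- Kaneyama data on a tropical Lagrangian multi-section. -/
structure IsKaneyama (g : F.MaxCone → F.MaxCone → GL (Fin r) ℂ) : Prop where
  g1 : ∀ σ, g σ σ = 1
  g2 : ∀ σ₁ σ₂ α β, (g σ₁ σ₂ : Matrix (Fin r) (Fin r) ℂ) α β ≠ 0 →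
    (ℓ.lift σ₁ α ∩ ℓ.lift σ₂ β).Nonempty ∧
      ℓ.m σ₁ α - ℓ.m σ₂ β ∈ dualMonoid (σ₁.1.1 ⊓ σ₂.1.1)
  g3 : ∀ σ₁ σ₂ σ₃, g σ₁ σ₂ * g σ₂ σ₃ = g σ₁ σ₃

/-- Equivalence of Kaneyama data. The rows of `g σ₁ σ₂` are indexed by the lifts of `σ₁` and its
columns by the lifts of `σ₂`. -/
def Equivalent (g g' : F.MaxCone → F.MaxCone → GL (Fin r) ℂ) : Prop :=
  ∃ h : F.MaxCone → GL (Fin r) ℂ,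
    (∀ σ α β, (h σ : Matrix (Fin r) (Fin r) ℂ) α β ≠ 0 →
      ℓ.m σ α - ℓ.m σ β ∈ dualMonoid σ.1.1) ∧
    ∀ σ₁ σ₂, h σ₁ * g σ₁ σ₂ = g' σ₁ σ₂ * h σ₂

end Labelling

end MultiSection

/-! # The toric variety `X_Σ`

`X_Σ` is described by its closed points with the Zariski topology and its regular functions. -/

/-- The torus `(ℂ^×)ⁿ`. -/
abbrev Torus (n : ℕ) : Type := Fin n → ℂˣ

/-- The character `m ↦ λ^m`. -/
def character {n : ℕ} (t : Torus n) : Multiplicative (MLat n) →* ℂˣ where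
  toFun m := ∏ i, t i ^ (m.toAdd i)
  map_one' := by simp
  map_mul' a b := by simp [zpow_add, Finset.prod_mul_distrib]

/-- The ring `ℂ[σ^∨ ∩ M]`. -/
abbrev ChartRing {n : ℕ} (σ : PointedCone ℝ (NR n)) : Type :=
  AddMonoidAlgebra ℂ (dualMonoid σ)

/-- The (closed points of the) affine toric variety `U(σ) = Spec ℂ[σ^∨ ∩ M]`; the value of
`f ∈ ℂ[σ^∨ ∩ M]` at the point `p` is `p.eval f`. -/
@[ext]
structure Chart {n : ℕ} (σ : PointedCone ℝ (NR n)) where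
  eval : ChartRing σ →ₐ[ℂ] ℂ

namespace Chart

variable {n : ℕ} {σ τ : PointedCone ℝ (NR n)}

theorem ext_single {p q : Chart σ} (h : ∀ m : dualMonoid σ,
    p.eval (AddMonoidAlgebra.single m 1) = q.eval (AddMonoidAlgebra.single m 1)) : p = q :=
  Chart.ext (AddMonoidAlgebra.algHom_ext h (by ext))

/-- The Zariski topology on `U(σ)`. -/
instance : TopologicalSpace (Chart σ) :=
  TopologicalSpace.generateFrom (Set.range fun f : ChartRing σ => {p : Chart σ | p.eval f ≠ 0})

/-- The value of `z^m` at a point of `U(σ)` if `m ∈ σ^∨ ∩ M` (and `0` otherwise). -/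
def monomial (p : Chart σ) (m : MLat n) : ℂ :=
  open Classical in
  if h : m ∈ dualMonoid σ then p.eval (AddMonoidAlgebra.single ⟨m, h⟩ 1) else 0

/-- The action of the torus on functions, `λ · z^m = λ^m z^m`. -/
def torusOnFunctions (σ : PointedCone ℝ (NR n)) (t : Torus n) : ChartRing σ →ₐ[ℂ] ChartRing σ :=
  AddMonoidAlgebra.lift ℂ (ChartRing σ) (dualMonoid σ)
    { toFun := fun m =>
        AddMonoidAlgebra.single m.toAdd ((character t (Multiplicative.ofAdd m.toAdd.1) : ℂˣ) : ℂ)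
      map_one' := by
        simp [AddMonoidAlgebra.one_def]
      map_mul' := fun a b => by
        simp [AddMonoidAlgebra.single_mul_single] }

theorem torusOnFunctions_single (t : Torus n) (m : dualMonoid σ) (c : ℂ) :
    torusOnFunctions σ t (AddMonoidAlgebra.single m c) =
      AddMonoidAlgebra.single m (c * ((character t (Multiplicative.ofAdd m.1) : ℂˣ) : ℂ)) := by
  simp [torusOnFunctions]

theorem character_mul (s t : Torus n) (m : Multiplicative (MLat n)) :
    character (s * t) m = character s m * character t m := by
  simp [character, mul_zpow, Finset.prod_mul_distrib]

theorem character_one (m : Multiplicative (MLat n)) : character (1 : Torus n) m = 1 := by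
  simp [character]

/-- The action of the torus on the points of `U(σ)`, determined by `f (λ • p) = (λ⁻¹ · f) (p)`. -/
instance : MulAction (Torus n) (Chart σ) where
  smul t p := ⟨p.eval.comp (torusOnFunctions σ t⁻¹)⟩
  one_smul p := by
    refine ext_single fun m => ?_
    change p.eval (torusOnFunctions σ (1 : Torus n)⁻¹ (AddMonoidAlgebra.single m 1)) = _
    rw [torusOnFunctions_single]
    simp [character_one]
  mul_smul s t p := by
    refine ext_single fun m => ?_
    change p.eval (torusOnFunctions σ (s * t)⁻¹ (AddMonoidAlgebra.single m 1)) =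
      p.eval (torusOnFunctions σ t⁻¹ (torusOnFunctions σ s⁻¹ (AddMonoidAlgebra.single m 1)))
    rw [torusOnFunctions_single, torusOnFunctions_single, torusOnFunctions_single, mul_inv,
      character_mul]
    simp

theorem smul_eval (t : Torus n) (p : Chart σ) (f : ChartRing σ) :
    (t • p).eval f = p.eval (torusOnFunctions σ t⁻¹ f) := rfl

/-- The open embedding `U(τ) → U(σ)` for `τ ⊆ σ`, given by restriction of functions. -/
def incl (h : τ ≤ σ) (p : Chart τ) : Chart σ :=
  ⟨p.eval.comp (AddMonoidAlgebra.mapDomainAlgHom ℂ ℂ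
    (AddSubmonoid.inclusion (dualMonoid_anti h)))⟩

theorem incl_smul (h : τ ≤ σ) (t : Torus n) (p : Chart τ) : incl h (t • p) = t • incl h p := by
  refine ext_single fun m => ?_
  rw [smul_eval, torusOnFunctions_single]
  simp only [incl, AlgHom.comp_apply, smul_eval, AddMonoidAlgebra.mapDomainAlgHom_apply,
    AddMonoidAlgebra.mapDomain_single, torusOnFunctions_single]
  rfl

end Chart

/-- One point of the disjoint union of the charts is the image of another one under one of the
open embeddings `U(τ) → U(σ)`. -/
def GlueRel {n : ℕ} (F : Fan n) (p q : Σ σ : F.Cone, Chart σ.1) : Prop :=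
  ∃ h : p.1.1 ≤ q.1.1, q.2 = Chart.incl h p.2

/-- The toric variety `X_Σ`, the direct limit of the `U(σ)`. -/
def ToricVariety {n : ℕ} (F : Fan n) : Type := Quot (GlueRel F)

namespace ToricVariety

variable {n : ℕ} {F : Fan n}

/-- The canonical map `U(σ) → X_Σ`. -/
def mk (σ : F.Cone) (p : Chart σ.1) : ToricVariety F := Quot.mk _ ⟨σ, p⟩

/-- The Zariski topology: a set is open iff its preimage in each `U(σ)` is open. -/
instance : TopologicalSpace (ToricVariety F) :=
  inferInstanceAs (TopologicalSpace (Quot (GlueRel F)))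

/-- The open subset `U(σ)` of `X_Σ`. -/
def chart (σ : F.Cone) : Set (ToricVariety F) := Set.range (mk σ)

/-- The torus action on `X_Σ`. -/
instance : MulAction (Torus n) (ToricVariety F) where
  smul t := Quot.map (fun p => ⟨p.1, t • p.2⟩) (fun p q ⟨h, e⟩ => ⟨h, by
    simp only [e, Chart.incl_smul]⟩)
  one_smul := by
    rintro ⟨σ, p⟩
    exact congrArg (mk σ) (one_smul _ p)
  mul_smul s t := by
    rintro ⟨σ, p⟩
    exact congrArg (mk σ) (mul_smul s t p)

/-- A function on a subset `W` of `X_Σ` is regular: near every point it is a quotient of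
elements of the coordinate ring of an affine chart. -/
def IsRegular (W : Set (ToricVariety F)) (f : W → ℂ) : Prop :=
  ∀ (σ : F.Cone) (p : Chart σ.1), mk σ p ∈ W →
    ∃ a b : ChartRing σ.1, p.eval b ≠ 0 ∧
      ∀ (q : Chart σ.1) (hq : mk σ q ∈ W), q.eval b ≠ 0 →
        f ⟨mk σ q, hq⟩ = q.eval a / q.eval b

/-- The value of an element of `ℂ[M] ⊗ ℂ[σ^∨ ∩ M]` at a point of `(ℂ^×)ⁿ × U(σ)`. -/
def prodEval {σ : F.Cone} (t : Torus n) (p : Chart σ.1) :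
    AddMonoidAlgebra ℂ (MLat n) ⊗[ℂ] ChartRing σ.1 →ₐ[ℂ] ℂ :=
  Algebra.TensorProduct.productMap
    (AddMonoidAlgebra.lift ℂ ℂ (MLat n) ((Units.coeHom ℂ).comp (character t))) p.eval

/-- A function on a subset `W` of `(ℂ^×)ⁿ × X_Σ` is regular. -/
def IsRegularProd (W : Set (Torus n × ToricVariety F)) (f : W → ℂ) : Prop :=
  ∀ (t : Torus n) (σ : F.Cone) (p : Chart σ.1), (t, mk σ p) ∈ W →
    ∃ a b : AddMonoidAlgebra ℂ (MLat n) ⊗[ℂ] ChartRing σ.1, prodEval t p b ≠ 0 ∧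
      ∀ (s : Torus n) (q : Chart σ.1) (hq : (s, mk σ q) ∈ W), prodEval s q b ≠ 0 →
        f ⟨(s, mk σ q), hq⟩ = prodEval s q a / prodEval s q b

end ToricVariety

/-! # Toric vector bundles -/

/-- A toric vector bundle of rank `r` on `X_Σ`: an algebraic vector bundle, given by its fibres and
an atlas of local trivializations with regular transition functions, together with a lift of the
torus action to an algebraic action which is linear on the fibres. -/
structure ToricVectorBundle {n : ℕ} (F : Fan n) (r : ℕ) where
  fiber : ToricVariety F → Type
  [addCommGroup : ∀ x, AddCommGroup (fiber x)]
  [module : ∀ x, Module ℂ (fiber x)]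
  /-- the index set of the atlas -/
  ι : Type
  base : ι → Set (ToricVariety F)
  isOpen_base : ∀ i, IsOpen (base i)
  cover : ∀ x, ∃ i, x ∈ base i
  triv : ∀ i, ∀ x ∈ base i, fiber x ≃ₗ[ℂ] (Fin r → ℂ)
  /-- The matrix entries of the transition functions are regular. -/
  transition_regular : ∀ i j a b, ToricVariety.IsRegular (base i ∩ base j)
    (fun x => triv j x.1 x.2.2 ((triv i x.1 x.2.1).symm (Pi.single a 1)) b)
  /-- The action of `t` maps the fibre at `x` linearly to the fibre at `t • x`. -/
  act : ∀ (t : Torus n) (x : ToricVariety F), fiber x →ₗ[ℂ] fiber (t • x)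
  act_one : ∀ x (v : fiber x),
    (⟨(1 : Torus n) • x, act 1 x v⟩ : Σ y, fiber y) = ⟨x, v⟩
  act_mul : ∀ (s t : Torus n) x (v : fiber x),
    (⟨(s * t) • x, act (s * t) x v⟩ : Σ y, fiber y) = ⟨s • t • x, act s (t • x) (act t x v)⟩
  /-- The action is algebraic: in local trivializations its matrix entries are regular functions
  of `(t, x)`. -/
  act_regular : ∀ i j a b, ToricVariety.IsRegularProd
    {p : Torus n × ToricVariety F | p.2 ∈ base i ∧ p.1 • p.2 ∈ base j}
    (fun p => triv j (p.1.1 • p.1.2) p.2.2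
      (act p.1.1 p.1.2 ((triv i p.1.2 p.2.1).symm (Pi.single a 1))) b)

attribute [instance] ToricVectorBundle.addCommGroup ToricVectorBundle.module

namespace ToricVectorBundle

variable {n : ℕ} {F : Fan n} {r : ℕ}

/-- Isomorphism of toric vector bundles: a torus-equivariant isomorphism of algebraic vector
bundles over the identity of `X_Σ`. -/
def Iso (E E' : ToricVectorBundle F r) : Prop :=
  ∃ Φ : ∀ x, E.fiber x ≃ₗ[ℂ] E'.fiber x,
    (∀ i j a b, ToricVariety.IsRegular (E.base i ∩ E'.base j)
      (fun x => E'.triv j x.1 x.2.2 (Φ x.1 ((E.triv i x.1 x.2.1).symm (Pi.single a 1))) b)) ∧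
    ∀ (t : Torus n) x (v : E.fiber x), Φ (t • x) (E.act t x v) = E'.act t x (Φ x v)

/-- An equivariant splitting `E|_{U(σ)} ≅ ⨁_α 𝓛_{m^{(α)}}`. Here `𝓛_m` is the trivial line bundle
on `U(σ)` with the action `λ · (p, c) = (λ · p, λ^m c)`, so that the fibres of the right-hand side
are `ℂ^r`. -/
structure EquivariantSplitting (E : ToricVectorBundle F r) (σ : F.Cone) where
  /-- the weights `m^{(1)}, …, m^{(r)}`; only their classes modulo `σ^⊥ ∩ M` matter -/
  weight : Fin r → MLat n
  triv : ∀ x ∈ ToricVariety.chart σ, E.fiber x ≃ₗ[ℂ] (Fin r → ℂ)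
  regular : ∀ i a b, ToricVariety.IsRegular (E.base i ∩ ToricVariety.chart σ)
    (fun x => triv x.1 x.2.2 ((E.triv i x.1 x.2.1).symm (Pi.single a 1)) b)
  equivariant : ∀ (t : Torus n) x (hx : x ∈ ToricVariety.chart σ)
    (htx : t • x ∈ ToricVariety.chart σ) (v : E.fiber x) (α : Fin r),
    triv (t • x) htx (E.act t x v) α =
      ((character t (Multiplicative.ofAdd (weight α)) : ℂˣ) : ℂ) * triv x hx v α

/-- The frame element `1(σ^{(α)})` at `x`. -/
def EquivariantSplitting.frame {E : ToricVectorBundle F r} {σ : F.Cone}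
    (s : E.EquivariantSplitting σ) (x : ToricVariety F) (hx : x ∈ ToricVariety.chart σ)
    (α : Fin r) : E.fiber x := (s.triv x hx).symm (Pi.single α 1)

/-- `E` is the toric vector bundle `𝓔(𝕃, g)` obtained by gluing the equivariant bundles
`⨁_α 𝓛_{m(σ^{(α)})}` on `U(σ)`, `σ ∈ Σ(n)`, along `U(σ₁ ∩ σ₂)` by
`1(σ₁^{(α)}) = ∑_β g_{σ₁^{(α)} σ₂^{(β)}} z^{m(σ₁^{(α)}) - m(σ₂^{(β)})} 1(σ₂^{(β)})`. -/
def IsGluedFrom (E : ToricVectorBundle F r) {A : MultiSection.{u} n} (ℓ : A.Labelling F r)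
    (g : F.MaxCone → F.MaxCone → GL (Fin r) ℂ) : Prop :=
  ∃ s : ∀ σ : F.MaxCone, E.EquivariantSplitting σ.1,
    (∀ σ, (s σ).weight = ℓ.m σ) ∧
    ∀ (σ₁ σ₂ : F.MaxCone) (p : Chart (σ₁.1.inter σ₂.1).1) (x : ToricVariety F)
      (_ : x = ToricVariety.mk (σ₁.1.inter σ₂.1) p)
      (h₁ : x ∈ ToricVariety.chart σ₁.1) (h₂ : x ∈ ToricVariety.chart σ₂.1) (α : Fin r),
      (s σ₁).frame x h₁ α =
        ∑ β, ((g σ₁ σ₂ : Matrix (Fin r) (Fin r) ℂ) α β * p.monomial (ℓ.m σ₁ α - ℓ.m σ₂ β)) •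
          (s σ₂).frame x h₂ β

end ToricVectorBundle

/-! # The tropical Lagrangian multi-section of a toric vector bundle -/

section Associated

variable {n : ℕ} {F : Fan n} {r : ℕ}

/-- `Σ_𝓔`: the pairs `(σ, m(σ))` with `σ ∈ Σ` and `m(σ) ∈ M / (σ^⊥ ∩ M)` an element of the
multi-set of weights on `σ`. -/
def WeightPoset (w : F.Cone → Fin r → MLat n) : Type :=
  {c : Σ σ : F.Cone, MLat n ⧸ perp σ.1 // ∃ α, QuotientAddGroup.mk (w c.1 α) = c.2}

namespace WeightPoset

variable {w : F.Cone → Fin r → MLat n}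

/-- `(σ₁, m(σ₁)) ≤ (σ₂, m(σ₂))`: `σ₁ ⊆ σ₂` and `m(σ₂)` restricts to `m(σ₁)`, that is, they are
represented by the same `m ∈ M`. -/
def le (c d : WeightPoset w) : Prop :=
  c.1.1.1 ≤ d.1.1.1 ∧ ∃ m : MLat n, QuotientAddGroup.mk m = d.1.2 ∧ QuotientAddGroup.mk m = c.1.2

/-- The poset topology: closed sets are the downward closed ones, open sets the upward closed
ones. -/
instance : TopologicalSpace (WeightPoset w) where
  IsOpen U := ∀ c ∈ U, ∀ d, le c d → d ∈ U
  isOpen_univ := fun _ _ _ _ => trivial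
  isOpen_inter := fun _ _ hU hV c hc d hcd => ⟨hU c hc.1 d hcd, hV c hc.2 d hcd⟩
  isOpen_sUnion := fun _ h c ⟨U, hU, hc⟩ d hcd => ⟨U, hU, h U hU c hc d hcd⟩

end WeightPoset

/-- `L_𝓔 = |Σ| ×_Σ Σ_𝓔`, the set of pairs of a point `x` and some `(σ, m(σ)) ∈ Σ_𝓔` with
`x ∈ Int(σ)`, as a subspace of `N_ℝ × Σ_𝓔`. -/
def AssocSpace (w : F.Cone → Fin r → MLat n) : Type :=
  {p : NR n × WeightPoset w // p.1 ∈ F.coneData.interior (p.2.1.1.1 : Set (NR n))}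

instance (w : F.Cone → Fin r → MLat n) : TopologicalSpace (AssocSpace w) :=
  inferInstanceAs (TopologicalSpace
    {p : NR n × WeightPoset w // p.1 ∈ F.coneData.interior (p.2.1.1.1 : Set (NR n))})

/-- The multi-section constructed from the weights `w σ 1, …, w σ r` of a bundle on the charts
`U(σ)`, `σ ∈ Σ`. -/
def assocMultiSection (w : F.Cone → Fin r → MLat n) : MultiSection.{0} n where
  L := AssocSpace w
  complex :=
    { cones := Set.range fun c : WeightPoset w => {p : AssocSpace w | WeightPoset.le p.1.2 c}
      M := pulledBack fun p : AssocSpace w => p.1.1 }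
  -- the number of times that `m(σ)` occurs among the weights on `σ`
  μ p := Nat.card {α : Fin r // (QuotientAddGroup.mk (w p.1.2.1.1 α) :
    MLat n ⧸ perp p.1.2.1.1.1) = p.1.2.1.2}
  π p := p.1.1
  -- the value of `m(σ)` at `x`, computed with any representative of `m(σ)`
  φ p := pairing (Quotient.out p.1.2.1.2) p.1.1

/-- The tropical Lagrangian multi-section `𝕃_𝓔` of a toric vector bundle, constructed from
equivariant splittings on all the charts `U(σ)`. -/
def ToricVectorBundle.tropicalMultiSection (E : ToricVectorBundle F r)
    (s : ∀ σ : F.Cone, E.EquivariantSplitting σ) : MultiSection.{0} n :=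
  assocMultiSection fun σ => (s σ).weight

end Associated

end TropToric

end

open TropToric

/-!
The theorem rests on four facts.

*Convexity.* By Farkas' lemma over `ℚ` (`farkas_int`) every face of a rational cone `σ` is the zero
locus of some `k ∈ σ^∨ ∩ M` (`exists_exposing_latticeCone`). Hence `U(τ) ⊆ U(σ)` is the open set
`z^k ≠ 0`, points of different charts are identified only along a common face
(`ToricVariety.mk_eq_mk`), and `U(σ₁) ∩ U(σ₂) = U(σ₁ ∩ σ₂)`. In a complete fan every cone lies in an
`n`-dimensional one (`Fan.IsComplete.exists_maxCone`), so that the charts of `Σ(n)` cover `X_Σ`.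

*Gluing.* The matrices with entries `g_{ab} z^{m(σ₁^{(a)}) - m(σ₂^{(b)})}` are regular on
`U(σ₁ ∩ σ₂)` by (G2) and form a cocycle by (G3). Taking `ℂ^r` with the frame of a chosen chart as
the fibre at each point gives the bundle (`IsMonomialCocycle.gluedBundle`).

*Kaneyama's classification.* With respect to equivariant frames with weights `w`, `w'` an
equivariant map has entries that are semi-invariant of weight `w(a) - w'(b)`. Following a
one-parameter subgroup towards its limit in `U(σ)` shows that such an entry, if it is regular and
non-zero at the unit of the torus, has `w(a) - w'(b) ∈ σ^∨` (`mem_dualMonoid_of_regular`). So the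
values at the unit of an isomorphism of glued bundles are constant matrices as in (H1), and they
satisfy (H2) (`exists_intertwining`). Conversely, constant matrices with (H1) and (H2) become
regular equivariant isomorphisms of the local models which agree on overlaps
(`iso_of_intertwining`); that `h_σ` may be replaced by its inverse is `SupportedOn.inv`.

*Comparison of multi-sections.* The stabilizer of the distinguished point of `U(τ)` acts on the
fibre there with the weights of any splitting, restricted to the span of `τ`. Therefore the classes
modulo `τ^⊥` of the weights over `τ` do not depend on the splitting and are those of the slopes of
`φ` over any `σ ∈ Σ(n)` containing `τ` (`EquivariantSplitting.exists_perm_weight`, abstracted to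
`IsWeightSystem`). On the side of `L`, constancy of the trace near a point `x'` shows that
`μ(x')` lifts of any `σ ∈ Σ(n)` containing `π(x')` pass through `x'`, counted with multiplicity
(`IsTropicalLagrangian.card_lift`). Sending `x'` to its position and the class of the slope of `φ`
there defines a continuous surjection `L → L_𝓔` (`toAssoc`) under which `μ` pushes forward to the
multiplicity of the weights. The cones of `L_𝓔` are homeomorphic images of cones of `L`, which
yields the axioms of a cone complex, and the trace over a component of `L_𝓔` is a sum of traces over
components of `L`, which yields constancy (`assoc_trace_const`).
-/

noncomputable section

namespace TropToric

/-! ### Farkas' lemma and exposed faces of rational cones -/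

/-- Farkas' lemma over an ordered field: a vector is either a conical combination of a finite
family or separated from it by a linear functional. The induction step projects along the new
vector onto the kernel of a functional that is negative on it. -/
theorem farkas {K V ι : Type*} [Field K] [LinearOrder K] [IsStrictOrderedRing K]
    [AddCommGroup V] [Module K V] (s : Finset ι) (v : ι → V) (b : V) :
    (∃ c : ι → K, (∀ i, 0 ≤ c i) ∧ b = ∑ i ∈ s, c i • v i) ∨
      ∃ f : V →ₗ[K] K, (∀ i ∈ s, 0 ≤ f (v i)) ∧ f b < 0 := by
  classical
  induction s using Finset.induction_on generalizing v b with
  | empty =>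
    by_cases hb : b = 0
    · exact Or.inl ⟨0, by simp, by simp [hb]⟩
    · have h := (Module.forall_dual_apply_eq_zero_iff K b).not.2 hb
      push Not at h
      obtain ⟨f, hf⟩ := h
      rcases lt_or_gt_of_ne hf with h | h
      · exact Or.inr ⟨f, by simp, h⟩
      · exact Or.inr ⟨-f, by simp, by simpa using h⟩
  | insert a s has ih =>
    rcases ih v b with ⟨c, hc, hb⟩ | ⟨f, hf, hfb⟩
    · refine Or.inl ⟨fun i => if i = a then 0 else c i, fun i => ?_, ?_⟩
      · dsimp only
        split_ifs
        · exact le_rfl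
        · exact hc i
      · rw [Finset.sum_insert has, hb]
        simp only [if_true, zero_smul, zero_add]
        refine Finset.sum_congr rfl fun i hi => ?_
        rw [if_neg (ne_of_mem_of_not_mem hi has)]
    · by_cases hfa : 0 ≤ f (v a)
      · refine Or.inr ⟨f, fun i hi => ?_, hfb⟩
        rcases Finset.mem_insert.1 hi with rfl | hi
        · exact hfa
        · exact hf i hi
      · push Not at hfa
        let P : V →ₗ[K] V := LinearMap.id - (f (v a))⁻¹ • f.smulRight (v a)
        have hP : ∀ x, P x = x - ((f (v a))⁻¹ * f x) • v a := fun x => by simp [P, mul_smul]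
        have hPa : P (v a) = 0 := by rw [hP, inv_mul_cancel₀ hfa.ne, one_smul, sub_self]
        rcases ih (fun i => P (v i)) (P b) with ⟨c, hc, hb⟩ | ⟨g, hg, hgb⟩
        · left
          refine ⟨fun i => if i = a then (f (v a))⁻¹ * f b -
            ∑ j ∈ s, c j * ((f (v a))⁻¹ * f (v j)) else c i, fun i => ?_, ?_⟩
          · dsimp only
            split_ifs
            · have h1 : 0 ≤ (f (v a))⁻¹ * f b :=
                mul_nonneg_of_nonpos_of_nonpos (inv_nonpos.2 hfa.le) hfb.le
              have h2 : ∑ j ∈ s, c j * ((f (v a))⁻¹ * f (v j)) ≤ 0 :=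
                Finset.sum_nonpos fun j hj => mul_nonpos_of_nonneg_of_nonpos (hc j)
                  (mul_nonpos_of_nonpos_of_nonneg (inv_nonpos.2 hfa.le) (hf j hj))
              linarith
            · exact hc i
          · rw [Finset.sum_insert has]
            have h3 : ∑ i ∈ s, (if i = a then (f (v a))⁻¹ * f b -
                ∑ j ∈ s, c j * ((f (v a))⁻¹ * f (v j)) else c i) • v i = ∑ i ∈ s, c i • v i :=
              Finset.sum_congr rfl fun i hi => by rw [if_neg (ne_of_mem_of_not_mem hi has)]
            rw [h3]
            simp only [hP, if_true, smul_sub, Finset.sum_sub_distrib, smul_smul, sub_smul,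
              Finset.sum_smul] at hb ⊢
            rw [sub_eq_iff_eq_add] at hb
            nth_rewrite 1 [hb]
            abel
        · refine Or.inr ⟨g.comp P, fun i hi => ?_, hgb⟩
          rcases Finset.mem_insert.1 hi with rfl | hi
          · simp [hPa]
          · exact hg i hi

section Pairing

variable {n : ℕ}

/-- The point of `N_ℝ` given by a lattice point of `N`. -/
def latticePoint (v : Fin n → ℤ) : NR n := fun i => (v i : ℝ)

theorem pairing_apply (m : MLat n) (x : NR n) : pairing m x = ∑ i, (m i : ℝ) * x i := rfl

theorem pairing_add_right (m : MLat n) (x y : NR n) :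
    pairing m (x + y) = pairing m x + pairing m y := by
  simp [pairing_apply, mul_add, Finset.sum_add_distrib]

theorem pairing_smul_right (m : MLat n) (c : ℝ) (x : NR n) :
    pairing m (c • x) = c * pairing m x := by
  simp only [pairing_apply, Finset.mul_sum, Pi.smul_apply, smul_eq_mul]
  exact Finset.sum_congr rfl fun i _ => by ring

/-- The pairing with a fixed `m` as a linear functional. -/
def pairingLin (m : MLat n) : NR n →ₗ[ℝ] ℝ where
  toFun := pairing m
  map_add' := pairing_add_right m
  map_smul' c x := pairing_smul_right m c x

theorem pairing_sum_right {ι : Type*} (m : MLat n) (s : Finset ι) (f : ι → NR n) :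
    pairing m (∑ i ∈ s, f i) = ∑ i ∈ s, pairing m (f i) :=
  map_sum (pairingLin m) f s

theorem continuous_pairing (m : MLat n) : Continuous (pairing m) := by
  change Continuous fun x : NR n => ∑ i, (m i : ℝ) * x i
  fun_prop

theorem pairing_add_left (a b : MLat n) (x : NR n) :
    pairing (a + b) x = pairing a x + pairing b x := by rw [map_add]; rfl

theorem pairing_sub_left (a b : MLat n) (x : NR n) :
    pairing (a - b) x = pairing a x - pairing b x := by rw [map_sub]; rfl

theorem pairing_latticePoint (m : MLat n) (v : Fin n → ℤ) :
    pairing m (latticePoint v) = ((m ⬝ᵥ v : ℤ) : ℝ) := by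
  simp [pairing_apply, latticePoint, dotProduct]

theorem perp_anti {τ σ : PointedCone ℝ (NR n)} (h : τ ≤ σ) : perp σ ≤ perp τ :=
  fun _ hm x hx => hm x (h hx)

/-- The cone generated by a finite set of lattice points. -/
def latticeCone (S : Finset (Fin n → ℤ)) : PointedCone ℝ (NR n) :=
  PointedCone.hull ℝ (latticePoint '' (S : Set (Fin n → ℤ)))

theorem latticePoint_mem {S : Finset (Fin n → ℤ)} {v : Fin n → ℤ} (hv : v ∈ S) :
    latticePoint v ∈ latticeCone S :=
  PointedCone.subset_hull ⟨v, hv, rfl⟩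

theorem mem_latticeCone {S : Finset (Fin n → ℤ)} {x : NR n} :
    x ∈ latticeCone S ↔
      ∃ c : (Fin n → ℤ) → ℝ, (∀ v, 0 ≤ c v) ∧ x = ∑ v ∈ S, c v • latticePoint v := by
  classical
  constructor
  · intro hx
    refine Submodule.span_induction (p := fun x _ => ∃ c : (Fin n → ℤ) → ℝ, (∀ v, 0 ≤ c v) ∧
      x = ∑ v ∈ S, c v • latticePoint v) ?_ ?_ ?_ ?_ hx
    · rintro _ ⟨v, hv, rfl⟩
      refine ⟨fun w => if w = v then 1 else 0, fun w => by dsimp only; split_ifs <;> norm_num, ?_⟩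
      simp [ite_smul, Finset.mem_coe.1 hv]
    · exact ⟨0, by simp, by simp⟩
    · rintro _ _ _ _ ⟨c, hc, rfl⟩ ⟨d, hd, rfl⟩
      exact ⟨c + d, fun v => add_nonneg (hc v) (hd v), by
        simp [add_smul, Finset.sum_add_distrib]⟩
    · rintro a _ _ ⟨c, hc, rfl⟩
      refine ⟨fun v => (a : ℝ) * c v, fun v => mul_nonneg a.2 (hc v), ?_⟩
      simp only [Finset.smul_sum, mul_smul]
      rfl
  · rintro ⟨c, hc, rfl⟩
    exact sum_mem fun v hv => PointedCone.smul_mem _ (hc v) (latticePoint_mem hv)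

theorem mem_dualMonoid_latticeCone {S : Finset (Fin n → ℤ)} {m : MLat n} :
    m ∈ dualMonoid (latticeCone S) ↔ ∀ v ∈ S, 0 ≤ m ⬝ᵥ v := by
  constructor
  · intro h v hv
    have := h _ (latticePoint_mem hv)
    rw [pairing_latticePoint] at this
    exact_mod_cast this
  · intro h x hx
    obtain ⟨c, hc, rfl⟩ := mem_latticeCone.1 hx
    rw [pairing_sum_right]
    refine Finset.sum_nonneg fun v hv => ?_
    rw [pairing_smul_right, pairing_latticePoint]
    exact mul_nonneg (hc v) (by exact_mod_cast h v hv)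

theorem mem_perp_latticeCone {S : Finset (Fin n → ℤ)} {m : MLat n} :
    m ∈ perp (latticeCone S) ↔ ∀ v ∈ S, m ⬝ᵥ v = 0 := by
  constructor
  · intro h v hv
    have := h _ (latticePoint_mem hv)
    rw [pairing_latticePoint] at this
    exact_mod_cast this
  · intro h x hx
    obtain ⟨c, hc, rfl⟩ := mem_latticeCone.1 hx
    rw [pairing_sum_right]
    refine Finset.sum_eq_zero fun v hv => ?_
    rw [pairing_smul_right, pairing_latticePoint, h v hv]
    simp

theorem isClosed_latticeCone (S : Finset (Fin n → ℤ)) :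
    IsClosed (latticeCone S : Set (NR n)) := by
  -- by Farkas' lemma the cone is an intersection of closed half-spaces
  have h : (latticeCone S : Set (NR n)) =
      ⋂ f ∈ {f : NR n →ₗ[ℝ] ℝ | ∀ v ∈ S, 0 ≤ f (latticePoint v)}, {x | 0 ≤ f x} := by
    ext x
    simp only [SetLike.mem_coe, Set.mem_iInter, Set.mem_ofPred_eq]
    constructor
    · intro hx f hf
      obtain ⟨c, hc, rfl⟩ := mem_latticeCone.1 hx
      rw [map_sum]
      refine Finset.sum_nonneg fun v hv => ?_
      rw [map_smul]
      exact mul_nonneg (hc v) (hf v hv)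
    · intro hx
      rcases farkas (K := ℝ) S latticePoint x with h | ⟨f, hf, hfx⟩
      · exact mem_latticeCone.2 h
      · exact absurd (hx f hf) (not_le.2 hfx)
  rw [h]
  exact isClosed_biInter fun f _ =>
    isClosed_le continuous_const f.continuous_of_finiteDimensional

/-- Farkas' lemma over `ℚ` with integral data: the certificates can be taken integral. -/
theorem farkas_int (S T : Finset (Fin n → ℤ)) (w : Fin n → ℤ) :
    (∃ c d : (Fin n → ℤ) → ℝ, (∀ v, 0 ≤ c v) ∧ (∀ v, 0 ≤ d v) ∧
      latticePoint w + ∑ v ∈ S, c v • latticePoint v = ∑ v ∈ T, d v • latticePoint v) ∨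
    ∃ m : MLat n, (∀ v ∈ S, 0 ≤ m ⬝ᵥ v) ∧ (∀ v ∈ T, m ⬝ᵥ v ≤ 0) ∧ 0 < m ⬝ᵥ w := by
  let q : (Fin n → ℤ) → (Fin n → ℚ) := fun v i => (v i : ℚ)
  rcases farkas (K := ℚ) (S.disjSum T) (Sum.elim q fun v => -q v) (-q w) with
    ⟨c, hc, h⟩ | ⟨f, hf, hfw⟩
  · left
    refine ⟨fun v => (c (Sum.inl v) : ℝ), fun v => (c (Sum.inr v) : ℝ),
      fun v => Rat.cast_nonneg.2 (hc _), fun v => Rat.cast_nonneg.2 (hc _), ?_⟩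
    ext i
    have hi := congrFun h i
    simp only [Finset.sum_disjSum, Sum.elim_inl, Sum.elim_inr, Pi.neg_apply,
      Finset.sum_apply, Pi.smul_apply, smul_eq_mul, mul_neg, Finset.sum_neg_distrib, q] at hi
    simp only [Pi.add_apply, Finset.sum_apply, Pi.smul_apply, smul_eq_mul, latticePoint]
    have hi' : (w i : ℚ) + ∑ v ∈ S, c (Sum.inl v) * (v i : ℚ) =
      ∑ v ∈ T, c (Sum.inr v) * (v i : ℚ) := by linarith
    exact_mod_cast congrArg (fun z : ℚ => (z : ℝ)) hi'
  · right
    -- clear the denominators of the functional; the factor `b ^ 2` avoids a choice of sign for `b`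
    obtain ⟨b, hb⟩ := IsLocalization.exist_integer_multiples_of_finite (nonZeroDivisors ℤ)
      (fun i : Fin n => f (Pi.single i 1))
    choose z hz using hb
    have hb0 : ((b : ℤ) : ℚ) ≠ 0 := by
      exact_mod_cast nonZeroDivisors.coe_ne_zero b
    have key : ∀ v : Fin n → ℤ,
        (((fun i => (b : ℤ) * z i) ⬝ᵥ v : ℤ) : ℚ) = ((b : ℤ) : ℚ) ^ 2 * f (q v) := by
      intro v
      have : q v = ∑ i, (v i : ℚ) • (Pi.single i 1 : Fin n → ℚ) := by
        ext j
        simp [q, Finset.sum_apply, Pi.single_apply]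
      rw [this, map_sum, dotProduct, Finset.mul_sum]
      push_cast
      refine Finset.sum_congr rfl fun i _ => ?_
      have := hz i
      simp only [eq_intCast, Algebra.smul_def] at this
      rw [this, map_smul, smul_eq_mul]
      ring
    have hb2 : 0 < ((b : ℤ) : ℚ) ^ 2 := by positivity
    refine ⟨fun i => (b : ℤ) * z i, fun v hv => ?_, fun v hv => ?_, ?_⟩
    · have : 0 ≤ ((b : ℤ) : ℚ) ^ 2 * f (q v) :=
        mul_nonneg hb2.le (hf (Sum.inl v) (by simpa using hv))
      rw [← key] at this
      exact_mod_cast this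
    · have h1 := hf (Sum.inr v) (by simpa using hv)
      simp only [Sum.elim_inr, map_neg] at h1
      have : ((b : ℤ) : ℚ) ^ 2 * f (q v) ≤ 0 :=
        mul_nonpos_of_nonneg_of_nonpos hb2.le (by linarith)
      rw [← key] at this
      exact_mod_cast this
    · rw [map_neg] at hfw
      have : 0 < ((b : ℤ) : ℚ) ^ 2 * f (q w) := mul_pos hb2 (by linarith)
      rw [← key] at this
      exact_mod_cast this

/-- Every face of a rational polyhedral cone is cut out by an element of `σ^∨ ∩ M`. -/
theorem exists_exposing_latticeCone (S : Finset (Fin n → ℤ)) {τ : PointedCone ℝ (NR n)}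
    (hτ : τ.IsFaceOf (latticeCone S)) :
    ∃ m ∈ dualMonoid (latticeCone S), ∀ x ∈ latticeCone S, pairing m x = 0 ↔ x ∈ τ := by
  classical
  set T := S.filter fun v => latticePoint v ∈ τ with hT
  have h1 : ∀ w : {w // w ∈ S \ T}, ∃ m : MLat n, (∀ v ∈ S, 0 ≤ m ⬝ᵥ v) ∧
      (∀ v ∈ T, m ⬝ᵥ v ≤ 0) ∧ 0 < m ⬝ᵥ w.1 := by
    rintro ⟨w, hw⟩
    rcases farkas_int S T w with ⟨c, d, hc, hd, h⟩ | h
    · exfalso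
      have hwS := (Finset.mem_sdiff.1 hw).1
      refine (Finset.mem_sdiff.1 hw).2 (Finset.mem_filter.2 ⟨hwS, ?_⟩)
      refine hτ.mem_of_add_mem_left (latticePoint_mem hwS)
        (mem_latticeCone.2 ⟨c, hc, rfl⟩) ?_
      rw [h]
      exact sum_mem fun v hv => PointedCone.smul_mem _ (hd v) (Finset.mem_filter.1 hv).2
    · exact h
  -- the sum of these functionals is positive on all generators outside `τ` at once
  choose k hk1 hk2 hk3 using h1
  have hpos : ∀ v ∈ S, 0 ≤ (∑ w, k w) ⬝ᵥ v := fun v hv => by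
    rw [sum_dotProduct]
    exact Finset.sum_nonneg fun w _ => hk1 w v hv
  have hiff : ∀ v ∈ S, (∑ w, k w) ⬝ᵥ v = 0 ↔ latticePoint v ∈ τ := by
    intro v hv
    rw [sum_dotProduct, Finset.sum_eq_zero_iff_of_nonneg fun w _ => hk1 w v hv]
    constructor
    · intro h
      by_contra hvτ
      have hv' : v ∈ S \ T := by simp [hT, hv, hvτ]
      exact (hk3 ⟨v, hv'⟩).ne' (h ⟨v, hv'⟩ (Finset.mem_univ _))
    · intro h w _
      exact le_antisymm (hk2 w v (Finset.mem_filter.2 ⟨hv, h⟩)) (hk1 w v hv)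
  refine ⟨∑ w, k w, mem_dualMonoid_latticeCone.2 hpos, fun x hx => ?_⟩
  obtain ⟨c, hc, rfl⟩ := mem_latticeCone.1 hx
  rw [pairing_sum_right, Finset.sum_eq_zero_iff_of_nonneg fun v hv => by
    rw [pairing_smul_right, pairing_latticePoint]
    exact mul_nonneg (hc v) (by exact_mod_cast hpos v hv)]
  constructor
  · intro h
    refine sum_mem fun v hv => ?_
    have h2 := h v hv
    rw [pairing_smul_right, pairing_latticePoint, mul_eq_zero] at h2
    rcases h2 with h2 | h2
    · rw [h2, zero_smul]
      exact zero_mem _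
    · exact PointedCone.smul_mem _ (hc v) ((hiff v hv).1 (by exact_mod_cast h2))
  · intro h v hv
    rw [pairing_smul_right, pairing_latticePoint]
    rcases (hc v).eq_or_lt with h0 | h0
    · rw [← h0, zero_mul]
    · have hsplit := Finset.add_sum_erase S (fun v => c v • latticePoint v) hv
      rw [← hsplit] at h
      have := hτ.mem_of_smul_add_mem (latticePoint_mem hv) (sum_mem fun u hu =>
        PointedCone.smul_mem _ (hc u) (latticePoint_mem (Finset.mem_of_mem_erase hu))) h0 h
      rw [(hiff v hv).2 this]
      simp

end Pairing

/-! ### Relative interiors and maximal cones of a complete fan -/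

section FanGeometry

variable {n : ℕ}

/-- The relative interior of a rational cone: the points on no proper face. -/
def relInt (σ : PointedCone ℝ (NR n)) : Set (NR n) :=
  {x | x ∈ σ ∧ ∀ m ∈ dualMonoid σ, pairing m x = 0 → m ∈ perp σ}

/-- The face of `σ` on which an element of `σ^∨` vanishes. -/
def zeroFace (σ : PointedCone ℝ (NR n)) (m : MLat n) : PointedCone ℝ (NR n) :=
  σ ⊓ (PointedCone.ofSubmodule (LinearMap.ker (pairingLin m)))

theorem mem_zeroFace {σ : PointedCone ℝ (NR n)} {m : MLat n} {x : NR n} :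
    x ∈ zeroFace σ m ↔ x ∈ σ ∧ pairing m x = 0 := Iff.rfl

theorem zeroFace_isFaceOf {σ : PointedCone ℝ (NR n)} {m : MLat n} (hm : m ∈ dualMonoid σ) :
    (zeroFace σ m).IsFaceOf σ where
  le := inf_le_left
  mem_of_smul_add_mem := fun {x y a} hx hy ha h => by
    refine mem_zeroFace.2 ⟨hx, ?_⟩
    have h1 := (mem_zeroFace.1 h).2
    rw [pairing_add_right, pairing_smul_right] at h1
    have hx' := hm x hx
    have hy' := hm y hy
    nlinarith [mul_nonneg ha.le hx']

/-- Moving from a point of a cone towards a relatively interior one leads into the relative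
interior at once. -/
theorem relInt_segment {σ : PointedCone ℝ (NR n)} {x y : NR n} (hx : x ∈ σ)
    (hy : y ∈ relInt σ) {a b : ℝ} (ha : 0 ≤ a) (hb : 0 < b) : a • x + b • y ∈ relInt σ := by
  refine ⟨add_mem (PointedCone.smul_mem _ ha hx) (PointedCone.smul_mem _ hb.le hy.1), ?_⟩
  intro m hm h
  refine hy.2 m hm ?_
  rw [pairing_add_right, pairing_smul_right, pairing_smul_right] at h
  have h1 := mul_nonneg ha (hm x hx)
  have h2 := hm y hy.1
  nlinarith [mul_nonneg hb.le h2]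

namespace Fan

variable {F : Fan n}

theorem Cone.exists_generators (σ : F.Cone) : ∃ S : Finset (Fin n → ℤ), σ.1 = latticeCone S :=
  F.rational σ.1 σ.2

instance : Finite F.Cone := F.finite

theorem Cone.isClosed (σ : F.Cone) : IsClosed (σ.1 : Set (NR n)) := by
  obtain ⟨S, hS⟩ := σ.exists_generators
  rw [hS]
  exact isClosed_latticeCone S

theorem Cone.inter_le_left (σ τ : F.Cone) : (σ.inter τ).1 ≤ σ.1 :=
  (inf_le_left : σ.1 ⊓ τ.1 ≤ σ.1)

theorem Cone.inter_le_right (σ τ : F.Cone) : (σ.inter τ).1 ≤ τ.1 :=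
  (inf_le_right : σ.1 ⊓ τ.1 ≤ τ.1)

theorem Cone.isFaceOf {τ σ : F.Cone} (h : τ.1 ≤ σ.1) : τ.1.IsFaceOf σ.1 := by
  have := F.inter_isFaceOf _ σ.2 _ τ.2
  rwa [inf_eq_right.2 h] at this

theorem Cone.exists_exposing {τ σ : F.Cone} (h : τ.1 ≤ σ.1) :
    ∃ m ∈ dualMonoid σ.1, ∀ x ∈ σ.1, pairing m x = 0 ↔ x ∈ τ.1 := by
  obtain ⟨S, hS⟩ := σ.exists_generators
  have hf := Cone.isFaceOf h
  rw [hS] at hf ⊢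
  exact exists_exposing_latticeCone S hf

theorem Cone.relInt_nonempty (σ : F.Cone) : (relInt σ.1).Nonempty := by
  obtain ⟨S, hS⟩ := σ.exists_generators
  refine ⟨∑ v ∈ S, latticePoint v, ?_⟩
  rw [hS]
  refine ⟨sum_mem fun v hv => latticePoint_mem hv, fun m hm h => ?_⟩
  rw [pairing_sum_right,
    Finset.sum_eq_zero_iff_of_nonneg fun v hv => hm _ (latticePoint_mem hv)] at h
  refine mem_perp_latticeCone.2 fun v hv => ?_
  have := h v hv
  rw [pairing_latticePoint] at this
  exact_mod_cast this

/-- A cone that contains a relatively interior point of `σ` contains `σ`. -/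
theorem Cone.le_of_mem_relInt {σ τ : F.Cone} {x : NR n} (hx : x ∈ relInt σ.1) (hxτ : x ∈ τ.1) :
    σ.1 ≤ τ.1 := by
  obtain ⟨m, hm, h⟩ := Cone.exists_exposing (Cone.inter_le_left σ τ)
  have h1 : m ∈ perp σ.1 := hx.2 m hm ((h x hx.1).2 ⟨hx.1, hxτ⟩)
  exact fun y hy => ((h y hy).1 (h1 y hy)).2

theorem Cone.eq_of_mem_relInt {σ τ : F.Cone} {x : NR n} (hx : x ∈ relInt σ.1)
    (hxτ : x ∈ relInt τ.1) : σ = τ :=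
  Subtype.ext (le_antisymm (Cone.le_of_mem_relInt hx hxτ.1) (Cone.le_of_mem_relInt hxτ hx.1))

theorem Cone.exists_relInt (σ : F.Cone) {x : NR n} (hx : x ∈ σ.1) :
    ∃ τ : F.Cone, τ.1 ≤ σ.1 ∧ x ∈ relInt τ.1 := by
  obtain ⟨τ, hτ⟩ := exists_minimal_of_wellFoundedLT
    (fun τ : F.Cone => τ ≤ σ ∧ x ∈ τ.1) ⟨σ, le_rfl, hx⟩
  refine ⟨τ, hτ.prop.1, hτ.prop.2, fun m hm h y hy => ?_⟩
  let ρ : F.Cone := ⟨zeroFace τ.1 m, F.face_mem _ τ.2 _ (zeroFace_isFaceOf hm)⟩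
  have hρτ : ρ ≤ τ := (zeroFace_isFaceOf hm).le
  have : τ ≤ ρ := hτ.le_of_le ⟨hρτ.trans hτ.prop.1, mem_zeroFace.2 ⟨hτ.prop.2, h⟩⟩ hρτ
  exact (mem_zeroFace.1 (this hy)).2

/-- The cones that meet a small ball around `x` contain `x`. -/
theorem exists_ball (F : Fan n) (x : NR n) :
    ∃ ε > 0, ∀ y ∈ Metric.ball x ε, ∀ ρ : F.Cone, y ∈ ρ.1 → x ∈ ρ.1 := by
  have h : ∀ᶠ y in nhds x, ∀ ρ : F.Cone, y ∈ ρ.1 → x ∈ ρ.1 := by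
    rw [Filter.eventually_all]
    intro ρ
    by_cases hx : x ∈ ρ.1
    · exact Filter.Eventually.of_forall fun _ _ => hx
    · filter_upwards [ρ.isClosed.isOpen_compl.mem_nhds hx] with y hy hy'
      exact absurd hy' hy
  obtain ⟨ε, hε, h⟩ := Metric.eventually_nhds_iff_ball.1 h
  exact ⟨ε, hε, h⟩

theorem IsComplete.exists_cone (hF : F.IsComplete) (x : NR n) : ∃ σ : F.Cone, x ∈ relInt σ.1 := by
  obtain ⟨σ, hσ, hx⟩ := hF x
  obtain ⟨τ, -, h⟩ := Cone.exists_relInt ⟨σ, hσ⟩ hx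
  exact ⟨τ, h⟩

/-- In a complete fan every cone is contained in an `n`-dimensional one: near a relatively
interior point the cones through that point cover `N_ℝ`, so their spans are not all proper. -/
theorem IsComplete.exists_maxCone (hF : F.IsComplete) (σ : F.Cone) :
    ∃ σ' : F.MaxCone, σ.1 ≤ σ'.1.1 := by
  obtain ⟨x, hx⟩ := σ.relInt_nonempty
  by_contra! hcon
  have hproper : ∀ ρ : F.Cone, x ∈ ρ.1 → Submodule.span ℝ (ρ.1 : Set (NR n)) ≠ ⊤ := by
    intro ρ hρ htop
    refine hcon ⟨ρ, ?_⟩ (Cone.le_of_mem_relInt hx hρ)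
    rw [htop, finrank_top, Module.finrank_fin_fun]
  obtain ⟨y, hy⟩ : ∃ y : NR n, ∀ ρ : F.Cone, x ∈ ρ.1 →
      y ∉ Submodule.span ℝ (ρ.1 : Set (NR n)) := by
    let 𝒞 : Set F.Cone := {ρ | x ∈ ρ.1}
    have h𝒞 : 𝒞.Finite := Set.toFinite _
    by_contra! hy
    have := Subspace.biUnion_ne_univ_of_top_notMem
      (s := (h𝒞.toFinset.image fun ρ => Submodule.span ℝ (ρ.1 : Set (NR n))))
    refine this ?_ ?_
    · simp only [Finset.mem_image, Set.Finite.mem_toFinset, not_exists, not_and]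
      exact fun ρ hρ => hproper ρ hρ
    · rw [Set.eq_univ_iff_forall]
      intro y
      obtain ⟨ρ, hρ, h⟩ := hy y
      simp only [Finset.mem_image, Set.Finite.mem_toFinset, Set.mem_iUnion]
      exact ⟨_, ⟨ρ, hρ, rfl⟩, h⟩
  obtain ⟨ε, hε, hball⟩ := F.exists_ball x
  obtain ⟨δ, hδ, hδε⟩ : ∃ δ : ℝ, 0 < δ ∧ δ * ‖y‖ < ε := by
    refine ⟨ε / (2 * (‖y‖ + 1)), by positivity, ?_⟩
    rw [div_mul_eq_mul_div, div_lt_iff₀ (by positivity)]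
    nlinarith [norm_nonneg y]
  obtain ⟨ρ, hρ, hxρ⟩ := hF (x + δ • y)
  have hxρ' : x ∈ ρ := hball (x + δ • y) (by
    rw [mem_ball_iff_norm, add_sub_cancel_left, norm_smul, Real.norm_of_nonneg hδ.le]
    exact hδε) ⟨ρ, hρ⟩ hxρ
  refine hy ⟨ρ, hρ⟩ hxρ' ?_
  have h1 : y = δ⁻¹ • ((x + δ • y) - x) := by
    rw [add_sub_cancel_left, smul_smul, inv_mul_cancel₀ hδ.ne', one_smul]
  rw [h1]
  exact Submodule.smul_mem _ _ (Submodule.sub_mem _ (Submodule.subset_span hxρ)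
    (Submodule.subset_span hxρ'))

end Fan

end FanGeometry

/-! ### Local structure of a tropical Lagrangian multi-section -/

section Interior

variable {n : ℕ}

theorem mem_pulledBack {X : Type u} {p : X → NR n} {K : Set X} {w : K → ℝ} :
    w ∈ pulledBack p K ↔ ∃ m : MLat n, w = fun x => pairing m (p x.1) :=
  ⟨fun ⟨m, h⟩ => ⟨m, h.symm⟩, fun ⟨m, h⟩ => ⟨m, h.symm⟩⟩

/-- If the functions on `K` are pulled back from a cone `σ` onto which `K` is mapped, then the
relative interior of `K` is the preimage of that of `σ`. -/
theorem ConeData.mem_interior_iff {X : Type u} (C : ConeData X) {p : X → NR n} {K : Set X}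
    {σ : PointedCone ℝ (NR n)} (hM : C.M K = pulledBack p K) (hσ : p '' K = (σ : Set (NR n)))
    {x : X} : x ∈ C.interior K ↔ x ∈ K ∧ p x ∈ relInt σ := by
  have hmem : ∀ {z}, z ∈ K → p z ∈ σ := fun {z} hz => by
    have : p z ∈ p '' K := ⟨z, hz, rfl⟩
    rwa [hσ] at this
  have hex : ∀ y ∈ σ, ∃ z ∈ K, p z = y := fun y hy => by
    have : y ∈ p '' K := by rw [hσ]; exact hy
    exact this
  constructor
  · rintro ⟨hx, h⟩
    refine ⟨hx, hmem hx, fun m hm h0 y hy => ?_⟩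
    obtain ⟨z, hz, rfl⟩ := hex y hy
    have := h (fun x => pairing m (p x.1)) (by rw [hM]; exact mem_pulledBack.2 ⟨m, rfl⟩)
      (fun w => hm _ (hmem w.2)) h0
    exact congrFun this ⟨z, hz⟩
  · rintro ⟨hx, h⟩
    refine ⟨hx, fun w hw hpos h0 => ?_⟩
    rw [hM] at hw
    obtain ⟨m, rfl⟩ := mem_pulledBack.1 hw
    have hm : m ∈ perp σ := h.2 m (fun y hy => by
      obtain ⟨z, hz, rfl⟩ := hex y hy
      exact hpos ⟨z, hz⟩) h0
    ext z
    exact hm _ (hmem z.2)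

theorem Fan.mem_interior_iff {F : Fan n} {σ : PointedCone ℝ (NR n)} {x : NR n} :
    x ∈ F.coneData.interior (σ : Set (NR n)) ↔ x ∈ relInt σ := by
  rw [F.coneData.mem_interior_iff (p := id) (K := (σ : Set (NR n))) (σ := σ) rfl (by simp)]
  exact ⟨fun h => h.2, fun h => ⟨h.1, h⟩⟩

/-- A trace can be computed as the number of labels of points, if every point carries as many
labels as its weight. -/
theorem finsum_mem_eq_card {ι X : Type*} [Fintype ι] (P : ι → X) (T : Set X) (μ : X → ℕ)
    (h : ∀ x ∈ T, Nat.card {i // P i = x} = μ x) :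
    ∑ᶠ x ∈ T, μ x = Nat.card {i // P i ∈ T} := by
  classical
  rw [← finsum_mem_congr rfl h, finsum_mem_eq_sum_of_inter_support_eq
    (t := (Finset.univ.image P).filter (· ∈ T))]
  · rw [Nat.card_eq_fintype_card, Fintype.card_subtype,
      Finset.card_eq_sum_card_fiberwise (f := P) (t := (Finset.univ.image P).filter (· ∈ T))]
    · refine Finset.sum_congr rfl fun x hx => ?_
      rw [Nat.card_eq_fintype_card, Fintype.card_subtype]
      congr 1
      ext i
      have := (Finset.mem_filter.1 hx).2
      simp only [Finset.mem_filter, Finset.mem_univ, true_and]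
      exact ⟨fun h => ⟨h ▸ this, h⟩, fun h => h.2⟩
    · intro i hi
      simpa using hi
  · ext x
    simp only [Set.mem_inter_iff, Function.mem_support, Finset.coe_filter, Finset.mem_image,
      Finset.mem_univ, true_and, Set.mem_ofPred_eq, and_congr_left_iff]
    intro hx
    refine ⟨fun hT => ⟨?_, hT⟩, fun hT => hT.2⟩
    by_contra hne
    refine hx ?_
    rw [Nat.card_eq_zero]
    exact Or.inl ⟨fun i => hne ⟨i.1, i.2⟩⟩

end Interior

namespace MultiSection

variable {n r : ℕ} {F : Fan n} {A : MultiSection.{u} n}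

namespace IsTropicalLagrangian

variable (hA : A.IsTropicalLagrangian F r)
include hA

theorem exists_image {σ' : Set A.L} (hσ' : σ' ∈ A.complex.cones) :
    ∃ σ : F.Cone, A.π '' σ' = (σ.1 : Set (NR n)) := by
  obtain ⟨σ, hσ, h⟩ := hA.isBranchedCovering.cone_image σ' hσ'
  exact ⟨⟨σ, hσ⟩, h.symm⟩

theorem injOn {σ' : Set A.L} (hσ' : σ' ∈ A.complex.cones) : Set.InjOn A.π σ' := by
  intro x hx y hy h
  have := (hA.isBranchedCovering.cone_homeo σ' hσ').injective (a₁ := ⟨x, hx⟩) (a₂ := ⟨y, hy⟩) h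
  exact congrArg Subtype.val this

theorem continuous_π : Continuous A.π := hA.isBranchedCovering.morphism.1

theorem mem_interior_iff {σ' : Set A.L} (hσ' : σ' ∈ A.complex.cones) {σ : F.Cone}
    (hσ : A.π '' σ' = (σ.1 : Set (NR n))) {x : A.L} :
    x ∈ A.complex.interior σ' ↔ x ∈ σ' ∧ A.π x ∈ relInt σ.1 :=
  A.complex.mem_interior_iff (hA.isBranchedCovering.cone_iso σ' hσ') hσ

omit hA in
/-- The smallest cone containing a point, that is, the one with this point in its relative
interior. -/
def minCone (hA : A.IsTropicalLagrangian F r) (x : A.L) : Set A.L :=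
  Classical.choose (hA.isConeComplex.partition x).exists

theorem minCone_mem (x : A.L) : hA.minCone x ∈ A.complex.cones :=
  (Classical.choose_spec (hA.isConeComplex.partition x).exists).1

omit hA in
/-- The cone of the fan onto which the smallest cone containing a point is mapped. -/
def base (hA : A.IsTropicalLagrangian F r) (x : A.L) : F.Cone :=
  Classical.choose (hA.exists_image (hA.minCone_mem x))

theorem image_minCone (x : A.L) : A.π '' hA.minCone x = ((hA.base x).1 : Set (NR n)) :=
  Classical.choose_spec (hA.exists_image (hA.minCone_mem x))

theorem mem_minCone_and (x : A.L) : x ∈ hA.minCone x ∧ A.π x ∈ relInt (hA.base x).1 :=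
  (hA.mem_interior_iff (hA.minCone_mem x) (hA.image_minCone x)).1
    (Classical.choose_spec (hA.isConeComplex.partition x).exists).2

theorem mem_minCone (x : A.L) : x ∈ hA.minCone x := (hA.mem_minCone_and x).1

theorem mem_relInt_base (x : A.L) : A.π x ∈ relInt (hA.base x).1 := (hA.mem_minCone_and x).2

theorem eq_minCone {σ' : Set A.L} (hσ' : σ' ∈ A.complex.cones) {σ : F.Cone}
    (hσ : A.π '' σ' = (σ.1 : Set (NR n))) {x : A.L} (hx : x ∈ σ') (hx' : A.π x ∈ relInt σ.1) :
    σ' = hA.minCone x :=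
  (hA.isConeComplex.partition x).unique ⟨hσ', (hA.mem_interior_iff hσ' hσ).2 ⟨hx, hx'⟩⟩
    (Classical.choose_spec (hA.isConeComplex.partition x).exists)

/-- The part of a cone that lies over a face of its image is a cone of the complex. -/
theorem face_mem {σ' : Set A.L} (hσ' : σ' ∈ A.complex.cones) {σ τ : F.Cone}
    (hσ : A.π '' σ' = (σ.1 : Set (NR n))) (hτ : τ.1 ≤ σ.1) :
    σ' ∩ A.π ⁻¹' τ.1 ∈ A.complex.cones ∧ A.π '' (σ' ∩ A.π ⁻¹' τ.1) = (τ.1 : Set (NR n)) := by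
  have hmem : ∀ z ∈ σ', A.π z ∈ σ.1 := fun z hz => by
    have : A.π z ∈ A.π '' σ' := ⟨z, hz, rfl⟩
    rwa [hσ] at this
  constructor
  · obtain ⟨m, hm, h⟩ := Fan.Cone.exists_exposing hτ
    obtain ⟨ρ, hρ, hρσ, heq, -⟩ := hA.isConeComplex.face σ' hσ' (fun x => pairing m (A.π x.1))
      (by rw [hA.isBranchedCovering.cone_iso σ' hσ']; exact mem_pulledBack.2 ⟨m, rfl⟩)
      (fun y => hm _ (hmem _ y.2))
    have : σ' ∩ A.π ⁻¹' τ.1 = ρ := by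
      rw [heq]
      ext x
      exact ⟨fun hx => ⟨hx.1, (h _ (hmem x hx.1)).2 hx.2⟩,
        fun ⟨hx, hx'⟩ => ⟨hx, (h _ (hmem x hx)).1 hx'⟩⟩
    rwa [this]
  · rw [Set.image_inter_preimage, hσ]
    exact Set.inter_eq_right.2 hτ

theorem minCone_subset {σ' : Set A.L} (hσ' : σ' ∈ A.complex.cones) {x : A.L} (hx : x ∈ σ') :
    hA.minCone x ⊆ σ' := by
  obtain ⟨σ, hσ⟩ := hA.exists_image hσ'
  have hxσ : A.π x ∈ σ.1 := by
    have : A.π x ∈ A.π '' σ' := ⟨x, hx, rfl⟩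
    rwa [hσ] at this
  obtain ⟨τ, hτ, hxτ⟩ := Fan.Cone.exists_relInt σ hxσ
  obtain ⟨h1, h2⟩ := hA.face_mem hσ' hσ hτ
  rw [← hA.eq_minCone h1 h2 ⟨hx, hxτ.1⟩ hxτ]
  exact Set.inter_subset_left

theorem base_le {x : A.L} {τ : F.Cone} (h : A.π x ∈ τ.1) : (hA.base x).1 ≤ τ.1 :=
  Fan.Cone.le_of_mem_relInt (hA.mem_relInt_base x) h

theorem φ_eq_slope {σ' : Set A.L} (hσ' : σ' ∈ A.complex.cones) {x : A.L} (hx : x ∈ σ') :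
    A.φ x = pairing (A.slope σ') (A.π x) := by
  have h := hA.isPL σ' hσ'
  rw [hA.isBranchedCovering.cone_iso σ' hσ'] at h
  obtain ⟨m, hm⟩ := mem_pulledBack.1 h
  exact Classical.epsilon_spec (p := fun m => ∀ x ∈ σ', A.φ x = pairing m (A.π x))
    ⟨m, fun x hx => congrFun hm ⟨x, hx⟩⟩ x hx

/-- Slopes on two cones agree on the image of every common face. -/
theorem slope_sub_mem_perp {σ' τ' : Set A.L} (hσ' : σ' ∈ A.complex.cones)
    (hτ' : τ' ∈ A.complex.cones) {ρ' : Set A.L} (h1 : ρ' ⊆ σ') (h2 : ρ' ⊆ τ') {ρ : F.Cone}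
    (hρ : A.π '' ρ' = (ρ.1 : Set (NR n))) : A.slope σ' - A.slope τ' ∈ perp ρ.1 := by
  intro x hx
  have : x ∈ A.π '' ρ' := by rw [hρ]; exact hx
  obtain ⟨z, hz, rfl⟩ := this
  rw [pairing_sub_left, ← hA.φ_eq_slope hσ' (h1 hz), ← hA.φ_eq_slope hτ' (h2 hz), sub_self]

end IsTropicalLagrangian

namespace Labelling

variable (ℓ : A.Labelling F r)

theorem exists_pt (σ : F.MaxCone) (α : Fin r) {x : NR n} (hx : x ∈ σ.1.1) :
    ∃ z ∈ ℓ.lift σ α, A.π z = x := by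
  have : x ∈ A.π '' ℓ.lift σ α := by rw [ℓ.isLift]; exact hx
  exact this

/-- The point over `x` in the lift `σ^{(α)}`. -/
def pt (σ : F.MaxCone) {x : NR n} (hx : x ∈ σ.1.1) (α : Fin r) : A.L :=
  Classical.choose (ℓ.exists_pt σ α hx)

theorem pt_mem (σ : F.MaxCone) {x : NR n} (hx : x ∈ σ.1.1) (α : Fin r) :
    ℓ.pt σ hx α ∈ ℓ.lift σ α := (Classical.choose_spec (ℓ.exists_pt σ α hx)).1

theorem π_pt (σ : F.MaxCone) {x : NR n} (hx : x ∈ σ.1.1) (α : Fin r) :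
    A.π (ℓ.pt σ hx α) = x := (Classical.choose_spec (ℓ.exists_pt σ α hx)).2

end Labelling

namespace IsTropicalLagrangian

variable (hA : A.IsTropicalLagrangian F r) (ℓ : A.Labelling F r)
include hA

theorem pt_eq_iff (σ : F.MaxCone) {x : NR n} (hx : x ∈ σ.1.1) (α : Fin r) {z : A.L}
    (hz : A.π z = x) : ℓ.pt σ hx α = z ↔ z ∈ ℓ.lift σ α := by
  constructor
  · rintro rfl
    exact ℓ.pt_mem σ hx α
  · intro h
    exact hA.injOn (ℓ.mem σ α) (ℓ.pt_mem σ hx α) h ((ℓ.π_pt σ hx α).trans hz.symm)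

theorem card_lift_of_relInt (σ : F.MaxCone) {z : A.L} (hz : A.π z ∈ relInt σ.1.1) :
    Nat.card {α // z ∈ ℓ.lift σ α} = A.μ z := by
  have hb : hA.base z = σ.1 := Fan.Cone.eq_of_mem_relInt (hA.mem_relInt_base z) hz
  have himg : A.π '' hA.minCone z = (σ.1.1 : Set (NR n)) := by rw [hA.image_minCone, hb]
  rw [← ℓ.count σ _ (hA.minCone_mem z) himg z
    ((hA.mem_interior_iff (hA.minCone_mem z) himg).2 ⟨hA.mem_minCone z, hz⟩)]
  refine Nat.card_congr (Equiv.subtypeEquivRight fun α => ?_)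
  exact ⟨fun h => hA.eq_minCone (ℓ.mem σ α) (ℓ.isLift σ α) h hz,
    fun h => h ▸ hA.mem_minCone z⟩

/-- The weight at a point is the number of lifts of any `n`-dimensional cone, counted with
multiplicity, that pass through the point. This is the constancy of the trace on the star of the
point, which is the connected component of the preimage of a small ball. -/
theorem card_lift (σ : F.MaxCone) {z : A.L} (hz : A.π z ∈ σ.1.1) :
    Nat.card {α // z ∈ ℓ.lift σ α} = A.μ z := by
  set x := A.π z with hx
  obtain ⟨ε, hε, hball⟩ := F.exists_ball x
  obtain ⟨y₀, hy₀⟩ := σ.1.relInt_nonempty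
  obtain ⟨δ, hδ, hδ1, hδε⟩ : ∃ δ : ℝ, 0 < δ ∧ δ ≤ 1 ∧ δ * ‖y₀ - x‖ < ε := by
    have h0 : 0 < ‖y₀ - x‖ + ε := by positivity
    refine ⟨ε / (‖y₀ - x‖ + ε), by positivity, ?_, ?_⟩
    · rw [div_le_one h0]
      linarith [norm_nonneg (y₀ - x)]
    · rw [div_mul_eq_mul_div, div_lt_iff₀ h0]
      nlinarith [norm_nonneg (y₀ - x), mul_pos hε hε]
  set y : NR n := (1 - δ) • x + δ • y₀ with hy
  have hyσ : y ∈ relInt σ.1.1 := relInt_segment hz hy₀ (by linarith) hδ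
  set U := Metric.ball x ε with hU
  have hxU : x ∈ U := Metric.mem_ball_self hε
  have hyU : y ∈ U := by
    have : y - x = δ • (y₀ - x) := by rw [hy]; module
    rw [hU, mem_ball_iff_norm, this, norm_smul, Real.norm_of_nonneg hδ.le]
    exact hδε
  have hUc : IsConnected U := ⟨⟨x, hxU⟩, (convex_ball x ε).isPreconnected⟩
  obtain ⟨c, -, hc⟩ := hA.isBranchedCovering.trace_const U Metric.isOpen_ball hUc z hxU
  set V := connectedComponentIn (A.π ⁻¹' U) z with hV
  have hVU : ∀ w ∈ V, A.π w ∈ U := fun w hw => connectedComponentIn_subset (A.π ⁻¹' U) z hw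
  have hzV : z ∈ V := mem_connectedComponentIn hxU
  -- A cone that meets `V` passes through `z`: otherwise, by connectedness, some `t ∈ V` lies on a
  -- cone through `z` and on one that misses `z`. Their common face `minCone t` contains a point
  -- over `x`, which is `z` by injectivity of `π` on the first of these cones.
  have hstar : ∀ w ∈ V, ∀ ρ ∈ A.complex.cones, w ∈ ρ → z ∈ ρ := by
    by_contra! hcon
    obtain ⟨w, hw, ρ, hρ, hwρ, hzρ⟩ := hcon
    have hfin1 : {ρ | ρ ∈ A.complex.cones ∧ z ∈ ρ}.Finite :=
      hA.isConeComplex.finite.subset fun _ h => h.1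
    have hfin2 : {ρ | ρ ∈ A.complex.cones ∧ z ∉ ρ}.Finite :=
      hA.isConeComplex.finite.subset fun _ h => h.1
    have hpre : IsPreconnected V := isPreconnected_connectedComponentIn
    obtain ⟨t, htV, ht1, ht2⟩ := isPreconnected_closed_iff.1 hpre
      (⋃₀ {ρ | ρ ∈ A.complex.cones ∧ z ∈ ρ}) (⋃₀ {ρ | ρ ∈ A.complex.cones ∧ z ∉ ρ})
      (Set.sUnion_eq_biUnion ▸ hfin1.isClosed_biUnion fun ρ h => hA.isConeComplex.closed ρ h.1)
      (Set.sUnion_eq_biUnion ▸ hfin2.isClosed_biUnion fun ρ h => hA.isConeComplex.closed ρ h.1)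
      (fun t _ => by
        by_cases h : z ∈ hA.minCone t
        · exact Or.inl ⟨_, ⟨hA.minCone_mem t, h⟩, hA.mem_minCone t⟩
        · exact Or.inr ⟨_, ⟨hA.minCone_mem t, h⟩, hA.mem_minCone t⟩)
      ⟨z, hzV, hA.minCone z, ⟨hA.minCone_mem z, hA.mem_minCone z⟩, hA.mem_minCone z⟩
      ⟨w, hw, ρ, ⟨hρ, hzρ⟩, hwρ⟩
    obtain ⟨ρ₁, ⟨hρ₁, hzρ₁⟩, htρ₁⟩ := ht1
    obtain ⟨ρ₂, ⟨hρ₂, hzρ₂⟩, htρ₂⟩ := ht2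
    have hxb : x ∈ (hA.base t).1 := hball _ (hVU t htV) _ (hA.mem_relInt_base t).1
    have : x ∈ A.π '' hA.minCone t := by rw [hA.image_minCone]; exact hxb
    obtain ⟨z', hz', hz'x⟩ := this
    have : z' = z := hA.injOn hρ₁ (hA.minCone_subset hρ₁ htρ₁ hz') hzρ₁ hz'x
    exact hzρ₂ (hA.minCone_subset hρ₂ htρ₂ (this ▸ hz'))
  have hfib : A.π ⁻¹' {x} ∩ V = {z} := by
    ext w
    constructor
    · rintro ⟨hwx, hwV⟩
      exact hA.injOn (hA.minCone_mem w) (hA.mem_minCone w)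
        (hstar w hwV _ (hA.minCone_mem w) (hA.mem_minCone w)) hwx
    · rintro rfl
      exact ⟨rfl, hzV⟩
  have h1 : c = A.μ z := by
    rw [← hc x hxU, trace, hfib, finsum_mem_singleton]
  have h2 : c = Nat.card {α // z ∈ ℓ.lift σ α} := by
    rw [← hc y hyU, trace, finsum_mem_eq_card (fun α => ℓ.pt σ hyσ.1 α)]
    · refine Nat.card_congr (Equiv.subtypeEquivRight fun α => ?_)
      constructor
      · rintro ⟨-, h⟩
        exact hstar _ h _ (ℓ.mem σ α) (ℓ.pt_mem σ hyσ.1 α)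
      · intro hzα
        -- the lift of the segment from `x` to `y` joins `z` to the point over `y`
        refine ⟨ℓ.π_pt σ hyσ.1 α, ?_⟩
        have hemb := hA.isBranchedCovering.cone_homeo _ (ℓ.mem σ α)
        have hseg : segment ℝ x y ⊆ σ.1.1 := σ.1.1.convex.segment_subset hz hyσ.1
        have hpre : IsPreconnected {w : ℓ.lift σ α | A.π w.1 ∈ segment ℝ x y} := by
          rw [← hemb.isInducing.isPreconnected_image]
          have : (fun w : ℓ.lift σ α => A.π w.1) ''
              {w : ℓ.lift σ α | A.π w.1 ∈ segment ℝ x y} = segment ℝ x y := by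
            ext t
            constructor
            · rintro ⟨w, hw, rfl⟩
              exact hw
            · intro ht
              obtain ⟨w, hw, rfl⟩ := ℓ.exists_pt σ α (hseg ht)
              exact ⟨⟨w, hw⟩, ht, rfl⟩
          rw [this]
          exact (convex_segment x y).isPreconnected
        refine (hpre.image Subtype.val
          continuous_subtype_val.continuousOn).subset_connectedComponentIn
          (x := z) ⟨⟨z, hzα⟩, left_mem_segment ℝ x y, rfl⟩ ?_
          ⟨⟨_, ℓ.pt_mem σ hyσ.1 α⟩, ?_, rfl⟩
        · rintro _ ⟨w, hw, rfl⟩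
          exact (convex_ball x ε).segment_subset hxU hyU hw
        · change A.π _ ∈ segment ℝ x y
          rw [ℓ.π_pt]
          exact right_mem_segment ℝ x y
    · rintro w ⟨hw, -⟩
      have hw' : A.π w = y := hw
      rw [← hA.card_lift_of_relInt ℓ σ (hw' ▸ hyσ)]
      exact Nat.card_congr (Equiv.subtypeEquivRight fun α => hA.pt_eq_iff ℓ σ hyσ.1 α hw)
  rw [← h2, h1]

theorem card_pt_eq (σ : F.MaxCone) {x : NR n} (hx : x ∈ σ.1.1) {z : A.L} (hz : A.π z = x) :
    Nat.card {α // ℓ.pt σ hx α = z} = A.μ z := by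
  rw [← hA.card_lift ℓ σ (hz ▸ hx)]
  exact Nat.card_congr (Equiv.subtypeEquivRight fun α => hA.pt_eq_iff ℓ σ hx α hz)

/-- A point over an `n`-dimensional cone lies in one of the lifts of this cone. -/
theorem exists_mem_lift (σ : F.MaxCone) {z : A.L} (hz : A.π z ∈ σ.1.1) : ∃ α, z ∈ ℓ.lift σ α := by
  have h := hA.card_lift ℓ σ hz
  have hpos := hA.isWeight.1 z
  rw [← h] at hpos
  obtain ⟨⟨α, hα⟩⟩ := (Nat.card_pos_iff.1 hpos).1
  exact ⟨α, hα⟩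

theorem trace_eq_card (σ : F.MaxCone) {x : NR n} (hx : x ∈ σ.1.1) (V : Set A.L) :
    trace A.π V A.μ x = Nat.card {α // ℓ.pt σ hx α ∈ V} := by
  rw [trace, finsum_mem_eq_card (fun α => ℓ.pt σ hx α) _ _
    fun z hz => hA.card_pt_eq ℓ σ hx hz.1]
  exact Nat.card_congr (Equiv.subtypeEquivRight fun α =>
    ⟨fun h => h.2, fun h => ⟨ℓ.π_pt σ hx α, h⟩⟩)

end IsTropicalLagrangian

end MultiSection

/-! ### Points of toric varieties -/

section Character

variable {n : ℕ}

/-- The value `λ^m` of a character as a complex number. -/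
def chr (t : Torus n) (m : MLat n) : ℂ := ((character t (Multiplicative.ofAdd m) : ℂˣ) : ℂ)

theorem chr_ne_zero (t : Torus n) (m : MLat n) : chr t m ≠ 0 := Units.ne_zero _

theorem chr_add (t : Torus n) (a b : MLat n) : chr t (a + b) = chr t a * chr t b := by
  simp [chr, ofAdd_add]

theorem chr_inv (t : Torus n) (m : MLat n) : chr t⁻¹ m = (chr t m)⁻¹ := by
  rw [chr, chr, ← Units.val_inv_eq_inv_val]
  congr 1
  simp [character]

theorem chr_neg (t : Torus n) (m : MLat n) : chr t (-m) = (chr t m)⁻¹ := by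
  rw [chr, chr, ← Units.val_inv_eq_inv_val]
  congr 1
  simp [character]

theorem chr_mul (s t : Torus n) (m : MLat n) : chr (s * t) m = chr s m * chr t m := by
  simp [chr, Chart.character_mul]

theorem chr_one (m : MLat n) : chr (1 : Torus n) m = 1 := by
  simp [chr, Chart.character_one]

/-- The one-parameter subgroup of the torus given by a lattice point `v` of `N`. -/
def oneParam (v : Fin n → ℤ) (s : ℂˣ) : Torus n := fun i => s ^ v i

theorem chr_oneParam (v : Fin n → ℤ) (s : ℂˣ) (m : MLat n) :
    chr (oneParam v s) m = (s : ℂ) ^ (m ⬝ᵥ v) := by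
  have h : ∀ I : Finset (Fin n), ∏ i ∈ I, (s ^ v i) ^ m i = s ^ ∑ i ∈ I, m i * v i := by
    intro I
    induction I using Finset.induction_on with
    | empty => simp
    | insert a I ha ih => rw [Finset.prod_insert ha, Finset.sum_insert ha, ih, zpow_add, ← zpow_mul,
        mul_comm (v a)]
  rw [← Units.val_zpow_eq_zpow_val]
  exact congrArg Units.val (h Finset.univ)

end Character

namespace Chart

variable {n : ℕ} {σ τ : PointedCone ℝ (NR n)}

theorem monomial_of_mem (p : Chart σ) {m : MLat n} (h : m ∈ dualMonoid σ) :
    p.monomial m = p.eval (AddMonoidAlgebra.single ⟨m, h⟩ 1) := by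
  rw [monomial, dif_pos h]

theorem monomial_of_notMem (p : Chart σ) {m : MLat n} (h : m ∉ dualMonoid σ) :
    p.monomial m = 0 := by
  rw [monomial, dif_neg h]

theorem eval_single (p : Chart σ) (m : dualMonoid σ) (c : ℂ) :
    p.eval (AddMonoidAlgebra.single m c) = c * p.monomial m.1 := by
  rw [p.monomial_of_mem m.2, ← smul_eq_mul, ← map_smul]
  simp

theorem ext_monomial {p q : Chart σ} (h : ∀ m ∈ dualMonoid σ, p.monomial m = q.monomial m) :
    p = q :=
  ext_single fun m => by
    rw [eval_single, eval_single, h _ m.2]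

theorem monomial_zero (p : Chart σ) : p.monomial 0 = 1 := by
  rw [p.monomial_of_mem (zero_mem _)]
  exact map_one p.eval

theorem monomial_add (p : Chart σ) {a b : MLat n} (ha : a ∈ dualMonoid σ)
    (hb : b ∈ dualMonoid σ) : p.monomial (a + b) = p.monomial a * p.monomial b := by
  rw [p.monomial_of_mem ha, p.monomial_of_mem hb, p.monomial_of_mem (add_mem ha hb), ← map_mul,
    AddMonoidAlgebra.single_mul_single, one_mul]
  rfl

theorem monomial_nsmul (p : Chart σ) {a : MLat n} (ha : a ∈ dualMonoid σ) (k : ℕ) :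
    p.monomial (k • a) = p.monomial a ^ k := by
  induction k with
  | zero => simp [monomial_zero]
  | succ k ih => rw [succ_nsmul, monomial_add _ (nsmul_mem ha k) ha, ih, pow_succ]

theorem incl_monomial (h : τ ≤ σ) (p : Chart τ) {m : MLat n} (hm : m ∈ dualMonoid σ) :
    (incl h p).monomial m = p.monomial m := by
  rw [monomial_of_mem _ hm, monomial_of_mem _ (dualMonoid_anti h hm)]
  simp only [incl, AlgHom.comp_apply, AddMonoidAlgebra.mapDomainAlgHom_apply,
    AddMonoidAlgebra.mapDomain_single]
  rfl

theorem incl_incl {ρ : PointedCone ℝ (NR n)} (h : τ ≤ σ) (h' : ρ ≤ τ) (p : Chart ρ) :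
    incl h (incl h' p) = incl (h'.trans h) p :=
  ext_monomial fun m hm => by
    rw [incl_monomial _ _ hm, incl_monomial _ _ (dualMonoid_anti h hm), incl_monomial _ _ hm]

theorem incl_rfl (p : Chart σ) : incl le_rfl p = p :=
  ext_monomial fun _ hm => incl_monomial _ _ hm

theorem smul_monomial (t : Torus n) (p : Chart σ) (m : MLat n) :
    (t • p).monomial m = chr t⁻¹ m * p.monomial m := by
  by_cases hm : m ∈ dualMonoid σ
  · rw [monomial_of_mem _ hm, smul_eval, torusOnFunctions_single, one_mul, eval_single]
    rfl
  · rw [monomial_of_notMem _ hm, monomial_of_notMem _ hm, mul_zero]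

/-- The point of `U(σ)` given by a homomorphism from the monoid `σ^∨ ∩ M` to `ℂ`. -/
def ofFun (χ : MLat n → ℂ) (h0 : χ 0 = 1)
    (hadd : ∀ a ∈ dualMonoid σ, ∀ b ∈ dualMonoid σ, χ (a + b) = χ a * χ b) : Chart σ :=
  ⟨AddMonoidAlgebra.lift ℂ ℂ (dualMonoid σ)
    { toFun := fun m => χ m.toAdd.1
      map_one' := h0
      map_mul' := fun a b => hadd _ a.toAdd.2 _ b.toAdd.2 }⟩

theorem ofFun_monomial {χ : MLat n → ℂ} (h0 : χ 0 = 1)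
    (hadd : ∀ a ∈ dualMonoid σ, ∀ b ∈ dualMonoid σ, χ (a + b) = χ a * χ b) {m : MLat n}
    (hm : m ∈ dualMonoid σ) : (ofFun χ h0 hadd : Chart σ).monomial m = χ m := by
  rw [monomial_of_mem _ hm]
  simp [ofFun]

theorem isOpen_eval_ne_zero (f : ChartRing σ) : IsOpen {p : Chart σ | p.eval f ≠ 0} :=
  TopologicalSpace.isOpen_generateFrom_of_mem ⟨f, rfl⟩

theorem isTopologicalBasis :
    TopologicalSpace.IsTopologicalBasis
      (Set.range fun f : ChartRing σ => {p : Chart σ | p.eval f ≠ 0}) where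
  exists_subset_inter := by
    rintro _ ⟨f, rfl⟩ _ ⟨g, rfl⟩ p ⟨hf, hg⟩
    refine ⟨_, ⟨f * g, rfl⟩, ?_, ?_⟩
    · change p.eval (f * g) ≠ 0
      rw [map_mul]
      exact mul_ne_zero hf hg
    · intro q (hq : q.eval (f * g) ≠ 0)
      rw [map_mul] at hq
      exact ⟨left_ne_zero_of_mul hq, right_ne_zero_of_mul hq⟩
  sUnion_eq := Set.eq_univ_of_forall fun p =>
    ⟨_, ⟨1, rfl⟩, by change p.eval 1 ≠ 0; rw [map_one]; exact one_ne_zero⟩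
  eq_generateFrom := rfl

theorem exists_eval_ne_zero {U : Set (Chart σ)} (hU : IsOpen U) {p : Chart σ} (hp : p ∈ U) :
    ∃ f : ChartRing σ, p.eval f ≠ 0 ∧ ∀ q : Chart σ, q.eval f ≠ 0 → q ∈ U := by
  obtain ⟨_, ⟨f, rfl⟩, hpf, hf⟩ := isTopologicalBasis.exists_subset_of_mem_open hp hU
  exact ⟨f, hpf, fun q hq => hf hq⟩

/-- The unit of the torus as a point of `U(σ)`. -/
def unitPt (σ : PointedCone ℝ (NR n)) : Chart σ := ofFun 1 rfl (by simp)

theorem unitPt_monomial {m : MLat n} (hm : m ∈ dualMonoid σ) : (unitPt σ).monomial m = 1 :=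
  ofFun_monomial _ _ hm

theorem incl_unitPt (h : τ ≤ σ) : incl h (unitPt τ) = unitPt σ :=
  ext_monomial fun m hm => by
    rw [incl_monomial _ _ hm, unitPt_monomial hm, unitPt_monomial (dualMonoid_anti h hm)]

theorem add_mem_perp_iff {a b : MLat n} (ha : a ∈ dualMonoid σ) (hb : b ∈ dualMonoid σ) :
    a + b ∈ perp σ ↔ a ∈ perp σ ∧ b ∈ perp σ := by
  constructor
  · intro h
    have key : ∀ x ∈ σ, pairing a x = 0 ∧ pairing b x = 0 := fun x hx => by
      have h1 := h x hx
      rw [pairing_add_left] at h1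
      have := ha x hx
      have := hb x hx
      constructor <;> linarith
    exact ⟨fun x hx => (key x hx).1, fun x hx => (key x hx).2⟩
  · exact fun h => add_mem h.1 h.2

open Classical in
/-- The distinguished point of `U(σ)`, which lies in the closed torus orbit. -/
def distPt (σ : PointedCone ℝ (NR n)) : Chart σ :=
  ofFun (fun m => if m ∈ perp σ then 1 else 0) (if_pos (zero_mem _)) fun a ha b hb => by
    by_cases h1 : a ∈ perp σ <;> by_cases h2 : b ∈ perp σ <;>
      simp [add_mem_perp_iff ha hb, h1, h2]

open Classical in
theorem distPt_monomial {m : MLat n} (hm : m ∈ dualMonoid σ) :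
    (distPt σ).monomial m = if m ∈ perp σ then 1 else 0 :=
  ofFun_monomial _ _ hm

/-- The distinguished point is fixed by the one-parameter subgroups in the span of `σ`. -/
theorem oneParam_smul_distPt {v : Fin n → ℤ} (hv : latticePoint v ∈ σ) (s : ℂˣ) :
    oneParam v s • distPt σ = distPt σ :=
  ext_monomial fun m hm => by
    rw [smul_monomial, distPt_monomial hm, chr_inv, chr_oneParam]
    split_ifs with h
    · have := h _ hv
      rw [pairing_latticePoint] at this
      have : m ⬝ᵥ v = 0 := by exact_mod_cast this
      simp [this]
    · simp

/-- The curve `s ↦ v(s)⁻¹ · 1` for `v ∈ σ ∩ N`, extended to `s = 0`. -/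
def curvePt {v : Fin n → ℤ} (hv : latticePoint v ∈ σ) (s : ℂ) : Chart σ :=
  ofFun (fun m => s ^ (m ⬝ᵥ v).toNat) (by simp) fun a ha b hb => by
    have h1 := ha _ hv
    have h2 := hb _ hv
    rw [pairing_latticePoint] at h1 h2
    rw [← pow_add, add_dotProduct,
      Int.toNat_add (by exact_mod_cast h1) (by exact_mod_cast h2)]

theorem curvePt_monomial {v : Fin n → ℤ} (hv : latticePoint v ∈ σ) (s : ℂ) {m : MLat n}
    (hm : m ∈ dualMonoid σ) : (curvePt hv s).monomial m = s ^ (m ⬝ᵥ v).toNat :=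
  ofFun_monomial _ _ hm

theorem curvePt_eq_smul {v : Fin n → ℤ} (hv : latticePoint v ∈ σ) (s : ℂˣ) :
    curvePt hv (s : ℂ) = (oneParam v s)⁻¹ • unitPt σ :=
  ext_monomial fun m hm => by
    have h1 := hm _ hv
    rw [pairing_latticePoint] at h1
    have h1 : 0 ≤ m ⬝ᵥ v := by exact_mod_cast h1
    rw [curvePt_monomial hv _ hm, smul_monomial, inv_inv, unitPt_monomial hm, chr_oneParam, mul_one]
    conv_rhs => rw [← Int.toNat_of_nonneg h1]
    rw [zpow_natCast]

theorem continuous_eval_curvePt {v : Fin n → ℤ} (hv : latticePoint v ∈ σ) (f : ChartRing σ) :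
    Continuous fun s : ℂ => (curvePt hv s).eval f := by
  induction f using AddMonoidAlgebra.induction_linear with
  | zero => simpa using continuous_const
  | add f g hf hg => simp only [map_add]; exact hf.add hg
  | single m c =>
    simp only [eval_single]
    have : ∀ s, (curvePt hv s).monomial m.1 = s ^ (m.1 ⬝ᵥ v).toNat :=
      fun s => curvePt_monomial hv s m.2
    simp only [this]
    fun_prop

end Chart

/-! ### Gluing of the charts -/

section Gluing

variable {n : ℕ} {F : Fan n}

/-- If `k` cuts out the face `ρ` of `σ`, then `ρ^∨ ∩ M` is generated by `σ^∨ ∩ M` and `-k`. -/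
theorem exists_add_nsmul_mem {σ ρ : F.Cone} {k : MLat n} (hk : k ∈ dualMonoid σ.1)
    (hρ : ∀ x ∈ σ.1, pairing k x = 0 ↔ x ∈ ρ.1) {m : MLat n} (hm : m ∈ dualMonoid ρ.1) :
    ∃ N : ℕ, m + N • k ∈ dualMonoid σ.1 := by
  obtain ⟨S, hS⟩ := σ.exists_generators
  rw [hS] at hk hρ ⊢
  refine ⟨∑ v ∈ S, (m ⬝ᵥ v).natAbs, mem_dualMonoid_latticeCone.2 fun v hv => ?_⟩
  rw [add_dotProduct, smul_dotProduct, nsmul_eq_mul]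
  have hkv := mem_dualMonoid_latticeCone.1 hk v hv
  rcases hkv.eq_or_lt with h | h
  · have h1 := hm _ ((hρ _ (latticePoint_mem hv)).1 (by rw [pairing_latticePoint, ← h]; simp))
    rw [pairing_latticePoint] at h1
    rw [← h, mul_zero, add_zero]
    exact_mod_cast h1
  · have h1 : (m ⬝ᵥ v).natAbs ≤ ∑ v ∈ S, (m ⬝ᵥ v).natAbs :=
      Finset.single_le_sum (f := fun v => (m ⬝ᵥ v).natAbs) (fun _ _ => Nat.zero_le _) hv
    have h2 : -((∑ v ∈ S, (m ⬝ᵥ v).natAbs : ℕ) : ℤ) ≤ m ⬝ᵥ v := by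
      have : (((m ⬝ᵥ v).natAbs : ℕ) : ℤ) ≤ ((∑ v ∈ S, (m ⬝ᵥ v).natAbs : ℕ) : ℤ) := by
        exact_mod_cast h1
      omega
    nlinarith [Int.natCast_nonneg (∑ v ∈ S, (m ⬝ᵥ v).natAbs)]

theorem neg_exposing_mem {σ ρ : F.Cone} (hρσ : ρ.1 ≤ σ.1) {k : MLat n}
    (hρ : ∀ x ∈ σ.1, pairing k x = 0 ↔ x ∈ ρ.1) : -k ∈ dualMonoid ρ.1 := by
  intro x hx
  rw [map_neg, Pi.neg_apply, (hρ x (hρσ hx)).2 hx, neg_zero]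

theorem exposing_monomial_ne_zero {σ ρ : F.Cone} (hρσ : ρ.1 ≤ σ.1) {k : MLat n}
    (hk : k ∈ dualMonoid σ.1) (hρ : ∀ x ∈ σ.1, pairing k x = 0 ↔ x ∈ ρ.1) (p : Chart ρ.1) :
    p.monomial k ≠ 0 := by
  have h := p.monomial_add (dualMonoid_anti hρσ hk) (neg_exposing_mem hρσ hρ)
  rw [add_neg_cancel, Chart.monomial_zero] at h
  exact left_ne_zero_of_mul (h ▸ one_ne_zero)

theorem Chart.incl_injective {σ ρ : F.Cone} (hρσ : ρ.1 ≤ σ.1) :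
    Function.Injective (Chart.incl hρσ) := by
  obtain ⟨k, hk, hρ⟩ := Fan.Cone.exists_exposing hρσ
  intro p q h
  refine Chart.ext_monomial fun m hm => ?_
  obtain ⟨N, hN⟩ := exists_add_nsmul_mem hk hρ hm
  have hkρ := dualMonoid_anti hρσ hk
  have key : ∀ r : Chart ρ.1, (Chart.incl hρσ r).monomial (m + N • k) =
      r.monomial m * (Chart.incl hρσ r).monomial k ^ N := fun r => by
    rw [Chart.incl_monomial _ _ hN, r.monomial_add hm (nsmul_mem hkρ N), r.monomial_nsmul hkρ,
      Chart.incl_monomial _ _ hk]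
  have h1 := key p
  rw [h, key q] at h1
  refine (mul_right_cancel₀ (pow_ne_zero N ?_) h1).symm
  rw [Chart.incl_monomial _ _ hk]
  exact exposing_monomial_ne_zero hρσ hk hρ q

/-- `U(ρ)` is the locus in `U(σ)` where the monomial cutting out the face `ρ` does not vanish. -/
theorem Chart.exists_incl_eq {σ ρ : F.Cone} (hρσ : ρ.1 ≤ σ.1) {k : MLat n}
    (hk : k ∈ dualMonoid σ.1) (hρ : ∀ x ∈ σ.1, pairing k x = 0 ↔ x ∈ ρ.1) {q : Chart σ.1}
    (hq : q.monomial k ≠ 0) : ∃ p : Chart ρ.1, Chart.incl hρσ p = q := by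
  classical
  have hex : ∀ m : dualMonoid ρ.1, ∃ N : ℕ, m.1 + N • k ∈ dualMonoid σ.1 :=
    fun m => exists_add_nsmul_mem hk hρ m.2
  choose N hN using hex
  let χ : MLat n → ℂ := fun m =>
    if h : m ∈ dualMonoid ρ.1 then q.monomial (m + N ⟨m, h⟩ • k) / q.monomial k ^ N ⟨m, h⟩ else 0
  have hχ : ∀ m ∈ dualMonoid ρ.1, ∀ K : ℕ, m + K • k ∈ dualMonoid σ.1 →
      χ m * q.monomial k ^ K = q.monomial (m + K • k) := by
    intro m hm K hK
    simp only [χ, dif_pos hm]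
    rw [div_mul_eq_mul_div, div_eq_iff (pow_ne_zero _ hq), ← q.monomial_nsmul hk,
      ← q.monomial_nsmul hk, ← q.monomial_add (hN ⟨m, hm⟩) (nsmul_mem hk _),
      ← q.monomial_add hK (nsmul_mem hk _)]
    congr 1
    abel
  have h0 : χ 0 = 1 := by
    have := hχ 0 (zero_mem _) 0 (by simp)
    simpa [Chart.monomial_zero] using this
  refine ⟨Chart.ofFun χ h0 fun a ha b hb => ?_, Chart.ext_monomial fun m hm => ?_⟩
  · have h1 := hχ a ha _ (hN ⟨a, ha⟩)
    have h2 := hχ b hb _ (hN ⟨b, hb⟩)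
    have e : a + b + (N ⟨a, ha⟩ + N ⟨b, hb⟩) • k = (a + N ⟨a, ha⟩ • k) + (b + N ⟨b, hb⟩ • k) := by
      rw [add_nsmul]
      abel
    have h3 := hχ (a + b) (add_mem ha hb) (N ⟨a, ha⟩ + N ⟨b, hb⟩) (by
      rw [e]; exact add_mem (hN ⟨a, ha⟩) (hN ⟨b, hb⟩))
    rw [e, q.monomial_add (hN ⟨a, ha⟩) (hN ⟨b, hb⟩), ← h1, ← h2, pow_add] at h3
    refine mul_right_cancel₀ (mul_ne_zero (pow_ne_zero (N ⟨a, ha⟩) hq)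
      (pow_ne_zero (N ⟨b, hb⟩) hq)) (h3.trans (by ring))
  · rw [Chart.incl_monomial _ _ hm, Chart.ofFun_monomial _ _ (dualMonoid_anti hρσ hm)]
    simpa using hχ m (dualMonoid_anti hρσ hm) 0 (by simpa using hm)

/-- Inside `U(σ)` the charts of two faces meet in the chart of their intersection. -/
theorem Chart.exists_incl_inter {σ ρ₁ ρ₂ : F.Cone} (h₁ : ρ₁.1 ≤ σ.1) (h₂ : ρ₂.1 ≤ σ.1)
    {r₁ : Chart ρ₁.1} {r₂ : Chart ρ₂.1} (h : Chart.incl h₁ r₁ = Chart.incl h₂ r₂) :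
    ∃ r : Chart (ρ₁.inter ρ₂).1,
      Chart.incl (Fan.Cone.inter_le_left ρ₁ ρ₂) r = r₁ ∧
        Chart.incl (Fan.Cone.inter_le_right ρ₁ ρ₂) r = r₂ := by
  obtain ⟨k₁, hk₁, hρ₁⟩ := Fan.Cone.exists_exposing h₁
  obtain ⟨k₂, hk₂, hρ₂⟩ := Fan.Cone.exists_exposing h₂
  have hle : (ρ₁.inter ρ₂).1 ≤ σ.1 := (Fan.Cone.inter_le_left ρ₁ ρ₂).trans h₁
  obtain ⟨r, hr⟩ := Chart.exists_incl_eq (σ := σ) (ρ := ρ₁.inter ρ₂) hle (k := k₁ + k₂)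
    (add_mem hk₁ hk₂) (fun x hx => by
      have e1 := hk₁ x hx
      have e2 := hk₂ x hx
      have : x ∈ (ρ₁.inter ρ₂).1 ↔ x ∈ ρ₁.1 ∧ x ∈ ρ₂.1 := Iff.rfl
      rw [this, ← hρ₁ x hx, ← hρ₂ x hx, pairing_add_left]
      constructor
      · intro h
        constructor <;> linarith
      · rintro ⟨h, h'⟩
        rw [h, h', add_zero]) (q := Chart.incl h₁ r₁) (by
      rw [Chart.monomial_add _ hk₁ hk₂]
      refine mul_ne_zero ?_ ?_
      · rw [Chart.incl_monomial _ _ hk₁]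
        exact exposing_monomial_ne_zero h₁ hk₁ hρ₁ r₁
      · rw [h, Chart.incl_monomial _ _ hk₂]
        exact exposing_monomial_ne_zero h₂ hk₂ hρ₂ r₂)
  refine ⟨r, Chart.incl_injective h₁ ?_, Chart.incl_injective h₂ ?_⟩
  · rw [Chart.incl_incl, hr]
  · rw [Chart.incl_incl, hr, h]

namespace ToricVariety

theorem mk_incl {σ ρ : F.Cone} (h : ρ.1 ≤ σ.1) (p : Chart ρ.1) :
    mk σ (Chart.incl h p) = mk ρ p :=
  (Quot.sound (⟨h, rfl⟩ : GlueRel F ⟨ρ, p⟩ ⟨σ, Chart.incl h p⟩)).symm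

/-- Points of two charts are identified only along a common face. -/
theorem mk_eq_mk {σ τ : F.Cone} {p : Chart σ.1} {q : Chart τ.1} (h : mk σ p = mk τ q) :
    ∃ (ρ : F.Cone) (h₁ : ρ.1 ≤ σ.1) (h₂ : ρ.1 ≤ τ.1) (r : Chart ρ.1),
      Chart.incl h₁ r = p ∧ Chart.incl h₂ r = q := by
  have key : ∀ a b : (Σ σ : F.Cone, Chart σ.1), Relation.EqvGen (GlueRel F) a b →
      ∃ (ρ : F.Cone) (h₁ : ρ.1 ≤ a.1.1) (h₂ : ρ.1 ≤ b.1.1) (r : Chart ρ.1),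
        Chart.incl h₁ r = a.2 ∧ Chart.incl h₂ r = b.2 := by
    intro a b hab
    induction hab with
    | rel a b h =>
      obtain ⟨h, e⟩ := h
      exact ⟨a.1, le_rfl, h, a.2, Chart.incl_rfl _, e.symm⟩
    | refl a => exact ⟨a.1, le_rfl, le_rfl, a.2, Chart.incl_rfl _, Chart.incl_rfl _⟩
    | symm a b _ ih =>
      obtain ⟨ρ, h₁, h₂, r, e₁, e₂⟩ := ih
      exact ⟨ρ, h₂, h₁, r, e₂, e₁⟩
    | trans a b c _ _ ih₁ ih₂ =>
      obtain ⟨ρ, h₁, h₂, r, e₁, e₂⟩ := ih₁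
      obtain ⟨ρ', h₁', h₂', r', e₁', e₂'⟩ := ih₂
      obtain ⟨s, hs₁, hs₂⟩ := Chart.exists_incl_inter h₂ h₁' (e₂.trans e₁'.symm)
      refine ⟨ρ.inter ρ', (Fan.Cone.inter_le_left _ _).trans h₁,
        (Fan.Cone.inter_le_right _ _).trans h₂', s, ?_, ?_⟩
      · rw [← Chart.incl_incl h₁ (Fan.Cone.inter_le_left _ _), hs₁, e₁]
      · rw [← Chart.incl_incl h₂' (Fan.Cone.inter_le_right _ _), hs₂, e₂']
  exact key ⟨σ, p⟩ ⟨τ, q⟩ (Quot.eqvGen_exact h)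

theorem mk_injective (σ : F.Cone) : Function.Injective (mk σ) := by
  intro p q h
  obtain ⟨ρ, h₁, h₂, r, rfl, rfl⟩ := mk_eq_mk h
  rfl

theorem mk_mem_chart (σ : F.Cone) (p : Chart σ.1) : mk σ p ∈ chart σ := ⟨p, rfl⟩

theorem chart_mono {σ τ : F.Cone} (h : τ.1 ≤ σ.1) : chart τ ⊆ chart σ := by
  rintro _ ⟨p, rfl⟩
  exact ⟨_, mk_incl h p⟩

theorem mem_chart_inter {σ τ : F.Cone} {x : ToricVariety F} (hσ : x ∈ chart σ)
    (hτ : x ∈ chart τ) : x ∈ chart (σ.inter τ) := by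
  obtain ⟨p, rfl⟩ := hσ
  obtain ⟨q, hq⟩ := hτ
  obtain ⟨ρ, h₁, h₂, r, rfl, rfl⟩ := mk_eq_mk hq.symm
  rw [mk_incl]
  exact chart_mono (σ := σ.inter τ) (le_inf h₁ h₂) (mk_mem_chart ρ r)

theorem smul_mk (t : Torus n) (σ : F.Cone) (p : Chart σ.1) : t • mk σ p = mk σ (t • p) := rfl

theorem smul_mem_chart (t : Torus n) {σ : F.Cone} {x : ToricVariety F} (h : x ∈ chart σ) :
    t • x ∈ chart σ := by
  obtain ⟨p, rfl⟩ := h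
  exact ⟨t • p, rfl⟩

theorem mem_chart_of_smul (t : Torus n) {σ : F.Cone} {x : ToricVariety F} (h : t • x ∈ chart σ) :
    x ∈ chart σ := by
  simpa using smul_mem_chart t⁻¹ h

theorem mk_mem_chart_iff {σ τ : F.Cone} {k : MLat n} (hk : k ∈ dualMonoid σ.1)
    (h : ∀ x ∈ σ.1, pairing k x = 0 ↔ x ∈ (σ.inter τ).1) (p : Chart σ.1) :
    mk σ p ∈ chart τ ↔ p.monomial k ≠ 0 := by
  have hle : (σ.inter τ).1 ≤ σ.1 := Fan.Cone.inter_le_left σ τ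
  constructor
  · intro hp
    obtain ⟨r, hr⟩ := mem_chart_inter (mk_mem_chart σ p) hp
    rw [← mk_incl hle] at hr
    rw [← mk_injective σ hr, Chart.incl_monomial _ _ hk]
    exact exposing_monomial_ne_zero hle hk h r
  · intro hp
    obtain ⟨r, rfl⟩ := Chart.exists_incl_eq hle hk h hp
    rw [mk_incl]
    exact chart_mono (Fan.Cone.inter_le_right σ τ) (mk_mem_chart _ r)

theorem isOpen_iff {W : Set (ToricVariety F)} :
    IsOpen W ↔ ∀ σ : F.Cone, IsOpen {p : Chart σ.1 | mk σ p ∈ W} := by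
  change IsOpen (Quot.mk (GlueRel F) ⁻¹' W) ↔ _
  rw [isOpen_sigma_iff]
  rfl

theorem isOpen_chart (τ : F.Cone) : IsOpen (chart τ) := by
  rw [isOpen_iff]
  intro σ
  obtain ⟨k, hk, h⟩ := Fan.Cone.exists_exposing (Fan.Cone.inter_le_left σ τ)
  have : {p : Chart σ.1 | mk σ p ∈ chart τ} =
      {p | p.eval (AddMonoidAlgebra.single ⟨k, hk⟩ 1) ≠ 0} := by
    ext p
    rw [Set.mem_ofPred_eq, Set.mem_ofPred_eq, mk_mem_chart_iff hk h, p.monomial_of_mem hk]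
  rw [this]
  exact Chart.isOpen_eval_ne_zero _

theorem exists_mem_chart (hF : F.IsComplete) (x : ToricVariety F) :
    ∃ σ : F.MaxCone, x ∈ chart σ.1 := by
  obtain ⟨⟨σ, p⟩, rfl⟩ := Quot.exists_rep x
  obtain ⟨σ', h⟩ := hF.exists_maxCone σ
  exact ⟨σ', chart_mono h (mk_mem_chart σ p)⟩

open Classical in
/-- The value of `z^m` at a point of `X_Σ` that lies in some `U(σ)` with `m ∈ σ^∨ ∩ M`
(and `0` at all other points). -/
def zval (x : ToricVariety F) (m : MLat n) : ℂ :=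
  if h : ∃ (σ : F.Cone) (p : Chart σ.1), mk σ p = x ∧ m ∈ dualMonoid σ.1 then
    (Classical.choose (Classical.choose_spec h)).monomial m else 0

theorem zval_mk {σ : F.Cone} (p : Chart σ.1) {m : MLat n} (hm : m ∈ dualMonoid σ.1) :
    zval (mk σ p) m = p.monomial m := by
  have h : ∃ (τ : F.Cone) (q : Chart τ.1), mk τ q = mk σ p ∧ m ∈ dualMonoid τ.1 := ⟨σ, p, rfl, hm⟩
  rw [zval, dif_pos h]
  obtain ⟨h1, h2⟩ := Classical.choose_spec (Classical.choose_spec h)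
  obtain ⟨ρ, h₁, h₂, r, e₁, e₂⟩ := mk_eq_mk h1
  rw [← e₁, Chart.incl_monomial _ _ h2, ← Chart.incl_monomial h₂ r hm, e₂]

theorem zval_zero {σ : F.Cone} {x : ToricVariety F} (hx : x ∈ chart σ) : zval x 0 = 1 := by
  obtain ⟨p, rfl⟩ := hx
  rw [zval_mk p (zero_mem _), Chart.monomial_zero]

theorem zval_add {σ : F.Cone} {x : ToricVariety F} (hx : x ∈ chart σ) {a b : MLat n}
    (ha : a ∈ dualMonoid σ.1) (hb : b ∈ dualMonoid σ.1) :
    zval x (a + b) = zval x a * zval x b := by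
  obtain ⟨p, rfl⟩ := hx
  rw [zval_mk p ha, zval_mk p hb, zval_mk p (add_mem ha hb), p.monomial_add ha hb]

theorem zval_smul {σ : F.Cone} {x : ToricVariety F} (hx : x ∈ chart σ) (t : Torus n) {m : MLat n}
    (hm : m ∈ dualMonoid σ.1) : zval (t • x) m = (chr t m)⁻¹ * zval x m := by
  obtain ⟨p, rfl⟩ := hx
  rw [smul_mk, zval_mk _ hm, zval_mk _ hm, Chart.smul_monomial, chr_inv]

/-- On `U(σ)` the function `z^m`, `m ∈ τ^∨ ∩ M`, is a quotient of two monomials whose denominator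
does not vanish on `U(τ)`. -/
theorem exists_zval_mul (σ τ : F.Cone) {m : MLat n} (hm : m ∈ dualMonoid τ.1) :
    ∃ a ∈ dualMonoid σ.1, ∃ b ∈ dualMonoid σ.1, ∀ p : Chart σ.1, mk σ p ∈ chart τ →
      p.monomial b ≠ 0 ∧ zval (mk σ p) m = p.monomial a / p.monomial b := by
  have hle : (σ.inter τ).1 ≤ σ.1 := Fan.Cone.inter_le_left σ τ
  have hle' : (σ.inter τ).1 ≤ τ.1 := Fan.Cone.inter_le_right σ τ
  obtain ⟨k, hk, h⟩ := Fan.Cone.exists_exposing hle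
  obtain ⟨N, hN⟩ := exists_add_nsmul_mem hk h (dualMonoid_anti hle' hm)
  refine ⟨m + N • k, hN, N • k, nsmul_mem hk N, fun p hp => ?_⟩
  have h1 : p.monomial (N • k) ≠ 0 := by
    rw [p.monomial_nsmul hk]
    exact pow_ne_zero _ ((mk_mem_chart_iff hk h p).1 hp)
  refine ⟨h1, ?_⟩
  rw [eq_div_iff h1, ← zval_mk p (nsmul_mem hk N), ← zval_mk p hN]
  exact (zval_add (mem_chart_inter (mk_mem_chart σ p) hp) (dualMonoid_anti hle' hm)
    (dualMonoid_anti hle (nsmul_mem hk N))).symm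

end ToricVariety

end Gluing

/-! ### Regular functions -/

section Regular

variable {n : ℕ} {F : Fan n}

open ToricVariety

theorem IsRegular.mono {W W' : Set (ToricVariety F)} (h : W' ⊆ W) {f : W → ℂ}
    (hf : IsRegular W f) : IsRegular W' fun x => f ⟨x.1, h x.2⟩ := by
  intro σ p hp
  obtain ⟨a, b, hb, hab⟩ := hf σ p (h hp)
  exact ⟨a, b, hb, fun q hq hqb => hab q (h hq) hqb⟩

/-- The algebra of regular functions on a subset of `X_Σ`. -/
def regularSubalgebra (W : Set (ToricVariety F)) : Subalgebra ℂ (W → ℂ) where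
  carrier := {f | IsRegular W f}
  mul_mem' := by
    intro f g hf hg σ p hp
    obtain ⟨a, b, hb, hab⟩ := hf σ p hp
    obtain ⟨a', b', hb', hab'⟩ := hg σ p hp
    refine ⟨a * a', b * b', by rw [map_mul]; exact mul_ne_zero hb hb', fun q hq hqb => ?_⟩
    rw [map_mul] at hqb
    rw [Pi.mul_apply, hab q hq (left_ne_zero_of_mul hqb), hab' q hq (right_ne_zero_of_mul hqb),
      map_mul, map_mul, div_mul_div_comm]
  add_mem' := by
    intro f g hf hg σ p hp
    obtain ⟨a, b, hb, hab⟩ := hf σ p hp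
    obtain ⟨a', b', hb', hab'⟩ := hg σ p hp
    refine ⟨a * b' + b * a', b * b', by rw [map_mul]; exact mul_ne_zero hb hb',
      fun q hq hqb => ?_⟩
    rw [map_mul] at hqb
    rw [Pi.add_apply, hab q hq (left_ne_zero_of_mul hqb), hab' q hq (right_ne_zero_of_mul hqb),
      map_add, map_mul, map_mul, map_mul,
      div_add_div _ _ (left_ne_zero_of_mul hqb) (right_ne_zero_of_mul hqb)]
  algebraMap_mem' := by
    intro c σ p _
    refine ⟨algebraMap ℂ _ c, 1, by rw [map_one]; exact one_ne_zero, fun q _ _ => ?_⟩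
    rw [map_one, div_one, AlgHom.commutes]
    rfl

theorem IsRegular.inv {W : Set (ToricVariety F)} {f : W → ℂ} (hf : IsRegular W f)
    (h0 : ∀ x, f x ≠ 0) : IsRegular W fun x => (f x)⁻¹ := by
  intro σ p hp
  obtain ⟨a, b, hb, hab⟩ := hf σ p hp
  have ha : p.eval a ≠ 0 := fun h => h0 ⟨_, hp⟩ (by rw [hab p hp hb, h, zero_div])
  -- the denominator `a * b` also keeps the representation `f = a / b` valid
  refine ⟨b * b, a * b, by rw [map_mul]; exact mul_ne_zero ha hb, fun q hq hqb => ?_⟩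
  rw [map_mul] at hqb
  have hqa := left_ne_zero_of_mul hqb
  have hqb' := right_ne_zero_of_mul hqb
  dsimp only
  rw [hab q hq hqb', map_mul, map_mul]
  field_simp

theorem isRegular_of_charts (hF : F.IsComplete) {W : Set (ToricVariety F)} {f : W → ℂ}
    (h : ∀ σ : F.MaxCone, IsRegular (W ∩ chart σ.1) fun x => f ⟨x.1, x.2.1⟩) :
    IsRegular W f := by
  intro ρ p hp
  obtain ⟨σ, hσ⟩ := hF.exists_maxCone ρ
  have hc : ∀ q : Chart ρ.1, mk ρ q ∈ chart σ.1 := fun q => chart_mono hσ (mk_mem_chart ρ q)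
  obtain ⟨a, b, hb, hab⟩ := h σ ρ p ⟨hp, hc p⟩
  exact ⟨a, b, hb, fun q hq hqb => hab q ⟨hq, hc q⟩ hqb⟩

/-- A matrix-valued function with regular entries. -/
def IsRegularMat {r : ℕ} (W : Set (ToricVariety F)) (A : W → Matrix (Fin r) (Fin r) ℂ) : Prop :=
  ∀ a b, IsRegular W fun x => A x a b

namespace IsRegularMat

variable {r : ℕ} {W : Set (ToricVariety F)} {A B : W → Matrix (Fin r) (Fin r) ℂ}

theorem mono {W' : Set (ToricVariety F)} (h : W' ⊆ W) (hA : IsRegularMat W A) :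
    IsRegularMat W' fun x => A ⟨x.1, h x.2⟩ := fun a b => IsRegular.mono h (hA a b)

theorem mul (hA : IsRegularMat W A) (hB : IsRegularMat W B) :
    IsRegularMat W fun x => A x * B x := by
  intro a b
  have : (fun x => (A x * B x) a b) = ∑ c, (fun x => A x a c) * fun x => B x c b := by
    ext x
    simp [Matrix.mul_apply, Finset.sum_apply]
  rw [this]
  exact (regularSubalgebra W).sum_mem fun c _ => (regularSubalgebra W).mul_mem (hA a c) (hB c b)

theorem inv (hA : IsRegularMat W A) (h0 : ∀ x, (A x).det ≠ 0) :
    IsRegularMat W fun x => (A x)⁻¹ := by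
  let M : Matrix (Fin r) (Fin r) (regularSubalgebra W) := fun a b => ⟨fun x => A x a b, hA a b⟩
  let ev : W → (regularSubalgebra W →+* ℂ) := fun x =>
    (Pi.evalRingHom (fun _ => ℂ) x).comp (regularSubalgebra W).val.toRingHom
  have hM : ∀ x, A x = (ev x).mapMatrix M := fun x => rfl
  have hdet : ∀ x, (A x).det = M.det.1 x := fun x => by
    rw [hM, ← RingHom.map_det]
    rfl
  have hadj : ∀ x a b, (A x).adjugate a b = (M.adjugate a b).1 x := fun x a b => by
    rw [hM, ← RingHom.map_adjugate]
    rfl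
  intro a b
  have : (fun x => (A x)⁻¹ a b) = (fun x => (M.det.1 x)⁻¹) * (M.adjugate a b).1 := by
    ext x
    rw [Matrix.inv_def, Matrix.smul_apply, Ring.inverse_eq_inv', hdet, hadj]
    rfl
  rw [this]
  refine (regularSubalgebra W).mul_mem ?_ (M.adjugate a b).2
  exact IsRegular.inv M.det.2 fun x => hdet x ▸ h0 x

end IsRegularMat

theorem isRegular_zval {W : Set (ToricVariety F)} {τ : F.Cone} (hW : W ⊆ chart τ) {m : MLat n}
    (hm : m ∈ dualMonoid τ.1) : IsRegular W fun x => zval x.1 m := by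
  intro σ p hp
  obtain ⟨a, ha, b, hb, h⟩ := exists_zval_mul σ τ hm
  refine ⟨AddMonoidAlgebra.single ⟨a, ha⟩ 1, AddMonoidAlgebra.single ⟨b, hb⟩ 1, ?_,
    fun q hq _ => ?_⟩
  · rw [← p.monomial_of_mem hb]
    exact (h p (hW hp)).1
  · rw [← q.monomial_of_mem hb, ← q.monomial_of_mem ha]
    exact (h q (hW hq)).2

theorem isRegularProd_zval {W : Set (Torus n × ToricVariety F)} {τ : F.Cone}
    (hW : ∀ p ∈ W, p.2 ∈ chart τ) (c : ℂ) (k m : MLat n) (hm : c ≠ 0 → m ∈ dualMonoid τ.1) :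
    IsRegularProd W fun p => c * chr p.1.1 k * zval p.1.2 m := by
  intro t σ p hp
  by_cases hc : c = 0
  · refine ⟨0, 1, by rw [map_one]; exact one_ne_zero, fun s q hq _ => ?_⟩
    simp [hc]
  obtain ⟨a, ha, b, hb, h⟩ := exists_zval_mul σ τ (hm hc)
  let e : ℂ → MLat n → dualMonoid σ.1 → AddMonoidAlgebra ℂ (MLat n) ⊗[ℂ] ChartRing σ.1 :=
    fun c k l => AddMonoidAlgebra.single k c ⊗ₜ[ℂ] AddMonoidAlgebra.single l 1
  have hev : ∀ (s : Torus n) (q : Chart σ.1) (c : ℂ) (k : MLat n) (l : dualMonoid σ.1),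
      prodEval s q (e c k l) = c * chr s k * q.monomial l.1 := by
    intro s q c k l
    rw [prodEval, Algebra.TensorProduct.productMap_apply_tmul, Chart.eval_single, one_mul,
      AddMonoidAlgebra.lift_single]
    rfl
  have h0 : ∀ s : Torus n, chr s 0 = 1 := fun s => by simp [chr]
  refine ⟨e c k ⟨a, ha⟩, e 1 0 ⟨b, hb⟩, ?_, fun s q hq _ => ?_⟩
  · rw [hev, h0, one_mul, one_mul]
    exact (h p (hW _ hp)).1
  · rw [hev, hev, h0, one_mul, one_mul, mul_div_assoc]
    exact congrArg _ (h q (hW _ hq)).2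

end Regular

/-! ### Matrices of linear maps with respect to frames -/

section FrameMatrix

variable {r : ℕ} {V₁ V₂ V₃ : Type*} [AddCommGroup V₁] [Module ℂ V₁] [AddCommGroup V₂] [Module ℂ V₂]
  [AddCommGroup V₃] [Module ℂ V₃]

/-- The matrix of a linear map with respect to frames. The images of the elements of the first
frame are the rows, so that coordinate vectors are multiplied from the left. -/
def frameMatrix (T₁ : V₁ ≃ₗ[ℂ] (Fin r → ℂ)) (T₂ : V₂ ≃ₗ[ℂ] (Fin r → ℂ)) (Φ : V₁ →ₗ[ℂ] V₂) :
    Matrix (Fin r) (Fin r) ℂ :=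
  Matrix.of fun a b => T₂ (Φ (T₁.symm (Pi.single a 1))) b

theorem frameMatrix_apply (T₁ : V₁ ≃ₗ[ℂ] (Fin r → ℂ)) (T₂ : V₂ ≃ₗ[ℂ] (Fin r → ℂ))
    (Φ : V₁ →ₗ[ℂ] V₂) (a b : Fin r) :
    frameMatrix T₁ T₂ Φ a b = T₂ (Φ (T₁.symm (Pi.single a 1))) b := rfl

theorem vecMul_frameMatrix (T₁ : V₁ ≃ₗ[ℂ] (Fin r → ℂ)) (T₂ : V₂ ≃ₗ[ℂ] (Fin r → ℂ))
    (Φ : V₁ →ₗ[ℂ] V₂) (v : V₁) : Matrix.vecMul (T₁ v) (frameMatrix T₁ T₂ Φ) = T₂ (Φ v) := by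
  have h : v = ∑ a, T₁ v a • T₁.symm (Pi.single a 1) := by
    apply T₁.injective
    rw [map_sum]
    ext b
    simp [Finset.sum_apply, Pi.single_apply]
  conv_rhs => rw [h]
  rw [map_sum, map_sum]
  ext b
  simp [Matrix.vecMul, dotProduct, Finset.sum_apply, frameMatrix_apply]

theorem frameMatrix_eq_of (T₁ : V₁ ≃ₗ[ℂ] (Fin r → ℂ)) (T₂ : V₂ ≃ₗ[ℂ] (Fin r → ℂ))
    (Φ : V₁ →ₗ[ℂ] V₂) {A : Matrix (Fin r) (Fin r) ℂ}
    (h : ∀ v, T₂ (Φ v) = Matrix.vecMul (T₁ v) A) : frameMatrix T₁ T₂ Φ = A := by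
  ext a b
  rw [frameMatrix_apply, h, LinearEquiv.apply_symm_apply, Matrix.single_one_vecMul]
  rfl

theorem frameMatrix_mul (T₁ : V₁ ≃ₗ[ℂ] (Fin r → ℂ)) (T₂ : V₂ ≃ₗ[ℂ] (Fin r → ℂ))
    (T₃ : V₃ ≃ₗ[ℂ] (Fin r → ℂ)) (Φ : V₁ →ₗ[ℂ] V₂) (Ψ : V₂ →ₗ[ℂ] V₃) :
    frameMatrix T₁ T₂ Φ * frameMatrix T₂ T₃ Ψ = frameMatrix T₁ T₃ (Ψ ∘ₗ Φ) := by
  refine (frameMatrix_eq_of _ _ _ fun v => ?_).symm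
  rw [← Matrix.vecMul_vecMul, vecMul_frameMatrix, vecMul_frameMatrix]
  rfl

theorem frameMatrix_self (T₁ : V₁ ≃ₗ[ℂ] (Fin r → ℂ)) : frameMatrix T₁ T₁ LinearMap.id = 1 :=
  frameMatrix_eq_of _ _ _ fun v => by simp

theorem frameMatrix_equiv_mul (T₁ : V₁ ≃ₗ[ℂ] (Fin r → ℂ)) (T₂ : V₂ ≃ₗ[ℂ] (Fin r → ℂ))
    (Φ : V₁ ≃ₗ[ℂ] V₂) :
    frameMatrix T₁ T₂ Φ * frameMatrix T₂ T₁ (Φ.symm : V₂ →ₗ[ℂ] V₁) = 1 := by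
  rw [frameMatrix_mul]
  have : (Φ.symm : V₂ →ₗ[ℂ] V₁) ∘ₗ (Φ : V₁ →ₗ[ℂ] V₂) = LinearMap.id := by
    ext v
    simp
  rw [this, frameMatrix_self]

theorem det_frameMatrix_equiv (T₁ : V₁ ≃ₗ[ℂ] (Fin r → ℂ)) (T₂ : V₂ ≃ₗ[ℂ] (Fin r → ℂ))
    (Φ : V₁ ≃ₗ[ℂ] V₂) : (frameMatrix T₁ T₂ (Φ : V₁ →ₗ[ℂ] V₂)).det ≠ 0 := by
  have := congrArg Matrix.det (frameMatrix_equiv_mul T₁ T₂ Φ)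
  rw [Matrix.det_mul, Matrix.det_one] at this
  exact left_ne_zero_of_mul (this ▸ one_ne_zero)

theorem det_frameMatrix_id (T₁ T₂ : V₁ ≃ₗ[ℂ] (Fin r → ℂ)) :
    (frameMatrix T₁ T₂ LinearMap.id).det ≠ 0 :=
  det_frameMatrix_equiv T₁ T₂ (LinearEquiv.refl ℂ V₁)

theorem symm_single_eq_sum (T₁ T₂ : V₁ ≃ₗ[ℂ] (Fin r → ℂ)) (a : Fin r) :
    T₁.symm (Pi.single a 1) =
      ∑ b, frameMatrix T₁ T₂ LinearMap.id a b • T₂.symm (Pi.single b 1) := by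
  apply T₂.injective
  rw [map_sum]
  ext b
  simp [Finset.sum_apply, Pi.single_apply, frameMatrix_apply]

theorem inv_frameMatrix_id (T₁ T₂ : V₁ ≃ₗ[ℂ] (Fin r → ℂ)) :
    (frameMatrix T₁ T₂ LinearMap.id)⁻¹ = frameMatrix T₂ T₁ LinearMap.id :=
  Matrix.inv_eq_right_inv (frameMatrix_equiv_mul T₁ T₂ (LinearEquiv.refl ℂ V₁))

/-- Multiplication of row vectors by an invertible matrix. -/
def vecMulEquiv (A B : Matrix (Fin r) (Fin r) ℂ) (hAB : A * B = 1) (hBA : B * A = 1) :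
    (Fin r → ℂ) ≃ₗ[ℂ] (Fin r → ℂ) :=
  LinearEquiv.ofLinearMap (Matrix.vecMulLinear A) (Matrix.vecMulLinear B)
    (LinearMap.ext fun v => by
      change Matrix.vecMul (Matrix.vecMul v B) A = v
      rw [Matrix.vecMul_vecMul, hBA, Matrix.vecMul_one])
    (LinearMap.ext fun v => by
      change Matrix.vecMul (Matrix.vecMul v A) B = v
      rw [Matrix.vecMul_vecMul, hAB, Matrix.vecMul_one])

/-- An invertible matrix has a non-zero generalized diagonal. -/
theorem exists_perm_ne_zero {A : Matrix (Fin r) (Fin r) ℂ} (h : A.det ≠ 0) :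
    ∃ π : Equiv.Perm (Fin r), ∀ a, A a (π a) ≠ 0 := by
  by_contra! hcon
  refine h ?_
  rw [Matrix.det_apply]
  refine Finset.sum_eq_zero fun π _ => ?_
  obtain ⟨a, ha⟩ := hcon π.symm
  rw [Finset.prod_eq_zero (Finset.mem_univ (π.symm a)) (by simpa using ha), smul_zero]

/-- The inverse of an invertible matrix supported on a preorder is supported on the same preorder:
such matrices form a finite-dimensional algebra, on which multiplication is bijective as soon as it
is injective. -/
theorem inv_apply_ne_zero {R : Fin r → Fin r → Prop} (hrefl : ∀ a, R a a)
    (htrans : ∀ a b c, R a b → R b c → R a c) {A : Matrix (Fin r) (Fin r) ℂ} (hdet : A.det ≠ 0)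
    (hA : ∀ a b, A a b ≠ 0 → R a b) (a b : Fin r) (h : A⁻¹ a b ≠ 0) : R a b := by
  let S : Subalgebra ℂ (Matrix (Fin r) (Fin r) ℂ) :=
    { carrier := {B | ∀ a b, B a b ≠ 0 → R a b}
      mul_mem' := by
        intro B C hB hC a b hab
        rw [Matrix.mul_apply] at hab
        obtain ⟨c, -, hc⟩ := Finset.exists_ne_zero_of_sum_ne_zero hab
        exact htrans a c b (hB a c (left_ne_zero_of_mul hc)) (hC c b (right_ne_zero_of_mul hc))
      add_mem' := by
        intro B C hB hC a b hab
        by_cases hB0 : B a b = 0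
        · refine hC a b fun h0 => hab ?_
          rw [Matrix.add_apply, hB0, h0, add_zero]
        · exact hB a b hB0
      algebraMap_mem' := by
        intro c a b hab
        by_cases h : a = b
        · exact h ▸ hrefl a
        · exact absurd (by rw [Matrix.algebraMap_matrix_apply, if_neg h]) hab }
  let A' : S := ⟨A, hA⟩
  have hu : IsUnit A.det := hdet.isUnit
  have hinj : Function.Injective (LinearMap.mulLeft ℂ A') := by
    intro B C hBC
    have h1 : A * B.1 = A * C.1 := congrArg Subtype.val hBC
    have h2 := congrArg (A⁻¹ * ·) h1
    simp only [Matrix.nonsing_inv_mul_cancel_left _ _ hu] at h2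
    exact Subtype.ext h2
  obtain ⟨B, hB⟩ := LinearMap.injective_iff_surjective.1 hinj 1
  have hB' : A * B.1 = 1 := congrArg Subtype.val hB
  rw [Matrix.inv_eq_right_inv hB'] at h
  exact B.2 a b h

end FrameMatrix

/-! ### Transition matrices with monomial entries -/

section MonomialMatrix

variable {n r : ℕ} {F : Fan n}

open ToricVariety

/-- The matrix with entries `A_{ab} z^{w(a) - w'(b)}`. -/
def monomialMatrix (A : Matrix (Fin r) (Fin r) ℂ) (w w' : Fin r → MLat n) (x : ToricVariety F) :
    Matrix (Fin r) (Fin r) ℂ :=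
  Matrix.of fun a b => A a b * zval x (w a - w' b)

theorem monomialMatrix_apply (A : Matrix (Fin r) (Fin r) ℂ) (w w' : Fin r → MLat n)
    (x : ToricVariety F) (a b : Fin r) :
    monomialMatrix A w w' x a b = A a b * zval x (w a - w' b) := rfl

theorem monomialMatrix_one (w : Fin r → MLat n) {σ : F.Cone} {x : ToricVariety F}
    (hx : x ∈ chart σ) : monomialMatrix 1 w w x = 1 := by
  ext a b
  rw [monomialMatrix_apply]
  by_cases h : a = b
  · rw [h, sub_self, zval_zero hx, mul_one]
  · rw [Matrix.one_apply_ne h, zero_mul]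

/-- The matrix `A` has non-zero entries only where `z^{w(a) - w'(b)}` is regular on `U(σ)`. -/
def SupportedOn (σ : F.Cone) (A : Matrix (Fin r) (Fin r) ℂ) (w w' : Fin r → MLat n) : Prop :=
  ∀ a b, A a b ≠ 0 → w a - w' b ∈ dualMonoid σ.1

theorem SupportedOn.mono {σ τ : F.Cone} (h : τ.1 ≤ σ.1) {A : Matrix (Fin r) (Fin r) ℂ}
    {w w' : Fin r → MLat n} (hA : SupportedOn σ A w w') : SupportedOn τ A w w' :=
  fun a b hab => dualMonoid_anti h (hA a b hab)

theorem SupportedOn.inv {σ : F.Cone} {A : Matrix (Fin r) (Fin r) ℂ} {w : Fin r → MLat n}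
    (hA : SupportedOn σ A w w) (hdet : A.det ≠ 0) : SupportedOn σ A⁻¹ w w := by
  refine inv_apply_ne_zero (R := fun a b => w a - w b ∈ dualMonoid σ.1) (fun a => ?_)
    (fun a b c hab hbc => ?_) hdet hA
  · rw [sub_self]
    exact zero_mem _
  · rw [← sub_add_sub_cancel (w a) (w b) (w c)]
    exact add_mem hab hbc

theorem monomialMatrix_mul {σ : F.Cone} {x : ToricVariety F} (hx : x ∈ chart σ)
    {A B : Matrix (Fin r) (Fin r) ℂ} {w w' w'' : Fin r → MLat n} (hA : SupportedOn σ A w w')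
    (hB : SupportedOn σ B w' w'') :
    monomialMatrix A w w' x * monomialMatrix B w' w'' x = monomialMatrix (A * B) w w'' x := by
  ext a c
  rw [Matrix.mul_apply, monomialMatrix_apply, Matrix.mul_apply, Finset.sum_mul]
  refine Finset.sum_congr rfl fun b _ => ?_
  rw [monomialMatrix_apply, monomialMatrix_apply]
  by_cases h1 : A a b = 0
  · simp [h1]
  by_cases h2 : B b c = 0
  · simp [h2]
  have := zval_add hx (hA a b h1) (hB b c h2)
  rw [sub_add_sub_cancel] at this
  rw [this]
  ring

theorem monomialMatrix_smul {σ : F.Cone} {x : ToricVariety F} (hx : x ∈ chart σ) (t : Torus n)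
    {A : Matrix (Fin r) (Fin r) ℂ} {w w' : Fin r → MLat n} (hA : SupportedOn σ A w w') :
    Matrix.diagonal (fun a => chr t (w a)) * monomialMatrix A w w' (t • x) =
      monomialMatrix A w w' x * Matrix.diagonal fun b => chr t (w' b) := by
  ext a b
  rw [Matrix.diagonal_mul, Matrix.mul_diagonal, monomialMatrix_apply, monomialMatrix_apply]
  by_cases h : A a b = 0
  · simp [h]
  rw [zval_smul hx t (hA a b h), sub_eq_add_neg, chr_add, chr_neg]
  field_simp [chr_ne_zero t (w a), chr_ne_zero t (w' b)]

theorem isRegularMat_monomialMatrix {W : Set (ToricVariety F)} {σ : F.Cone} (hW : W ⊆ chart σ)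
    {A : Matrix (Fin r) (Fin r) ℂ} {w w' : Fin r → MLat n} (hA : SupportedOn σ A w w') :
    IsRegularMat W fun x => monomialMatrix A w w' x.1 := by
  intro a b
  by_cases h : A a b = 0
  · have : (fun x : W => monomialMatrix A w w' x.1 a b) = 0 := by
      ext x
      rw [monomialMatrix_apply, h, zero_mul]
      rfl
    rw [this]
    exact (regularSubalgebra W).zero_mem
  · exact (regularSubalgebra W).smul_mem (x := fun x => zval x.1 (w a - w' b))
      (isRegular_zval hW (hA a b h)) (A a b)

theorem monomialMatrix_unitPt {σ : F.Cone} {A : Matrix (Fin r) (Fin r) ℂ} {w w' : Fin r → MLat n}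
    (hA : SupportedOn σ A w w') :
    monomialMatrix A w w' (mk σ (Chart.unitPt σ.1)) = A := by
  ext a b
  rw [monomialMatrix_apply]
  by_cases h : A a b = 0
  · simp [h]
  · rw [zval_mk _ (hA a b h), Chart.unitPt_monomial (hA a b h), mul_one]

end MonomialMatrix

/-! ### The bundle glued from a cocycle of monomial matrices -/

section Gluing

variable {n r : ℕ} {F : Fan n}

open ToricVariety

/-- Constant matrices `g σ₁ σ₂` and weights `w σ` such that the matrices with entries
`g_{ab} z^{w(σ₁)(a) - w(σ₂)(b)}` are regular on `U(σ₁ ∩ σ₂)` and form a cocycle. -/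
structure IsMonomialCocycle (w : F.MaxCone → Fin r → MLat n)
    (g : F.MaxCone → F.MaxCone → Matrix (Fin r) (Fin r) ℂ) : Prop where
  self : ∀ σ, g σ σ = 1
  supp : ∀ σ₁ σ₂, SupportedOn (σ₁.1.inter σ₂.1) (g σ₁ σ₂) (w σ₁) (w σ₂)
  mul : ∀ σ₁ σ₂ σ₃, g σ₁ σ₂ * g σ₂ σ₃ = g σ₁ σ₃

namespace IsMonomialCocycle

variable {w : F.MaxCone → Fin r → MLat n}
  {g : F.MaxCone → F.MaxCone → Matrix (Fin r) (Fin r) ℂ} (hg : IsMonomialCocycle w g)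

/-- The transition matrix at a point. -/
def gl (_ : IsMonomialCocycle w g) (σ₁ σ₂ : F.MaxCone) (x : ToricVariety F) :
    Matrix (Fin r) (Fin r) ℂ := monomialMatrix (g σ₁ σ₂) (w σ₁) (w σ₂) x

theorem gl_self {σ : F.MaxCone} {x : ToricVariety F} (hx : x ∈ chart σ.1) : hg.gl σ σ x = 1 := by
  rw [gl, hg.self, monomialMatrix_one _ hx]

theorem gl_mul {σ₁ σ₂ σ₃ : F.MaxCone} {x : ToricVariety F} (h₁ : x ∈ chart σ₁.1)
    (h₂ : x ∈ chart σ₂.1) (h₃ : x ∈ chart σ₃.1) :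
    hg.gl σ₁ σ₂ x * hg.gl σ₂ σ₃ x = hg.gl σ₁ σ₃ x := by
  have h := mem_chart_inter (mem_chart_inter h₁ h₂) h₃
  rw [gl, gl, gl, ← hg.mul σ₁ σ₂ σ₃]
  refine monomialMatrix_mul h ((hg.supp σ₁ σ₂).mono (Fan.Cone.inter_le_left _ _))
    ((hg.supp σ₂ σ₃).mono ?_)
  exact le_inf ((Fan.Cone.inter_le_left _ _).trans (Fan.Cone.inter_le_right _ _))
    (Fan.Cone.inter_le_right _ _)

theorem gl_smul {σ₁ σ₂ : F.MaxCone} {x : ToricVariety F} (h₁ : x ∈ chart σ₁.1)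
    (h₂ : x ∈ chart σ₂.1) (t : Torus n) :
    Matrix.diagonal (fun a => chr t (w σ₁ a)) * hg.gl σ₁ σ₂ (t • x) =
      hg.gl σ₁ σ₂ x * Matrix.diagonal fun b => chr t (w σ₂ b) :=
  monomialMatrix_smul (mem_chart_inter h₁ h₂) t (hg.supp σ₁ σ₂)

variable (hF : F.IsComplete)

/-- A chosen `n`-dimensional cone whose chart contains a given point. -/
def chosen (hF : F.IsComplete) (x : ToricVariety F) : F.MaxCone :=
  Classical.choose (exists_mem_chart hF x)

theorem mem_chosen (x : ToricVariety F) : x ∈ chart (chosen hF x).1 :=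
  Classical.choose_spec (exists_mem_chart hF x)

/-- The frame over `U(σ)`; the fibre at `x` is identified with `ℂ^r` by the frame over the chosen
chart through `x`. -/
def gluedTriv (σ : F.MaxCone) (x : ToricVariety F) (hx : x ∈ chart σ.1) :
    (Fin r → ℂ) ≃ₗ[ℂ] (Fin r → ℂ) :=
  vecMulEquiv (hg.gl (chosen hF x) σ x) (hg.gl σ (chosen hF x) x)
    (by rw [hg.gl_mul (mem_chosen hF x) hx (mem_chosen hF x), hg.gl_self (mem_chosen hF x)])
    (by rw [hg.gl_mul hx (mem_chosen hF x) hx, hg.gl_self hx])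

theorem gluedTriv_apply (σ : F.MaxCone) (x : ToricVariety F) (hx : x ∈ chart σ.1)
    (v : Fin r → ℂ) : hg.gluedTriv hF σ x hx v = Matrix.vecMul v (hg.gl (chosen hF x) σ x) := rfl

theorem frameMatrix_gluedTriv (σ₁ σ₂ : F.MaxCone) (x : ToricVariety F) (h₁ : x ∈ chart σ₁.1)
    (h₂ : x ∈ chart σ₂.1) :
    frameMatrix (hg.gluedTriv hF σ₁ x h₁) (hg.gluedTriv hF σ₂ x h₂) LinearMap.id =
      hg.gl σ₁ σ₂ x :=
  frameMatrix_eq_of _ _ _ fun v => by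
    rw [gluedTriv_apply, gluedTriv_apply, Matrix.vecMul_vecMul,
      hg.gl_mul (mem_chosen hF x) h₁ h₂]
    rfl

/-- The action of the torus on the fibres of the glued bundle. -/
def gluedAct (t : Torus n) (x : ToricVariety F) : (Fin r → ℂ) →ₗ[ℂ] (Fin r → ℂ) :=
  Matrix.vecMulLinear (Matrix.diagonal (fun a => chr t (w (chosen hF x) a)) *
    hg.gl (chosen hF x) (chosen hF (t • x)) (t • x))

theorem gluedAct_apply (t : Torus n) (x : ToricVariety F) (v : Fin r → ℂ) :
    hg.gluedAct hF t x v = Matrix.vecMul v (Matrix.diagonal (fun a => chr t (w (chosen hF x) a)) *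
      hg.gl (chosen hF x) (chosen hF (t • x)) (t • x)) := rfl

theorem gluedTriv_act (σ : F.MaxCone) (t : Torus n) (x : ToricVariety F) (hx : x ∈ chart σ.1)
    (htx : t • x ∈ chart σ.1) (v : Fin r → ℂ) :
    hg.gluedTriv hF σ (t • x) htx (hg.gluedAct hF t x v) =
      Matrix.vecMul (hg.gluedTriv hF σ x hx v) (Matrix.diagonal fun a => chr t (w σ a)) := by
  rw [gluedTriv_apply, gluedAct_apply, gluedTriv_apply, Matrix.vecMul_vecMul,
    Matrix.vecMul_vecMul, Matrix.mul_assoc,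
    hg.gl_mul (smul_mem_chart t (mem_chosen hF x)) (mem_chosen hF (t • x)) htx,
    hg.gl_smul (mem_chosen hF x) hx]

theorem gluedAct_one (x : ToricVariety F) (v : Fin r → ℂ) : hg.gluedAct hF 1 x v = v := by
  rw [gluedAct_apply, one_smul, hg.gl_self (mem_chosen hF x)]
  simp [chr_one]

theorem gluedAct_mul (s t : Torus n) (x : ToricVariety F) (v : Fin r → ℂ) :
    hg.gluedAct hF (s * t) x v = hg.gluedAct hF s (t • x) (hg.gluedAct hF t x v) := by
  have hx := mem_chosen hF x
  have htx := mem_chosen hF (t • x)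
  have hstx := mem_chosen hF (s • t • x)
  rw [gluedAct_apply, gluedAct_apply, gluedAct_apply, Matrix.vecMul_vecMul, mul_smul]
  congr 1
  rw [Matrix.mul_assoc, ← Matrix.mul_assoc (hg.gl _ _ (t • x)),
    ← hg.gl_smul (smul_mem_chart t hx) htx, Matrix.mul_assoc,
    hg.gl_mul (smul_mem_chart s (smul_mem_chart t hx)) (smul_mem_chart s htx) hstx,
    ← Matrix.mul_assoc, Matrix.diagonal_mul_diagonal]
  congr 2
  ext a
  rw [chr_mul, mul_comm]

/-- The toric vector bundle obtained from a cocycle of monomial matrices. -/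
def gluedBundle : ToricVectorBundle F r where
  fiber _ := Fin r → ℂ
  ι := F.MaxCone
  base σ := chart σ.1
  isOpen_base σ := isOpen_chart σ.1
  cover x := exists_mem_chart hF x
  triv σ x hx := hg.gluedTriv hF σ x hx
  transition_regular σ₁ σ₂ a b := by
    have h := isRegularMat_monomialMatrix (W := chart σ₁.1 ∩ chart σ₂.1)
      (fun x hx => mem_chart_inter hx.1 hx.2) (hg.supp σ₁ σ₂) a b
    refine (congrArg (IsRegular _) (funext fun x => ?_)).mpr h
    exact congrFun (congrFun (hg.frameMatrix_gluedTriv hF σ₁ σ₂ x.1 x.2.1 x.2.2) a) b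
  act t x := hg.gluedAct hF t x
  act_one x v := Sigma.ext (one_smul _ x) (heq_of_eq (hg.gluedAct_one hF x v))
  act_mul s t x v := Sigma.ext (mul_smul s t x) (heq_of_eq (hg.gluedAct_mul hF s t x v))
  act_regular σ₁ σ₂ a b := by
    have h := isRegularProd_zval (F := F)
      (W := {p : Torus n × ToricVariety F | p.2 ∈ chart σ₁.1 ∧ p.1 • p.2 ∈ chart σ₂.1})
      (τ := σ₁.1.inter σ₂.1)
      (fun p hp => mem_chart_inter hp.1 (mem_chart_of_smul p.1 hp.2)) (g σ₁ σ₂ a b) (w σ₂ b)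
      (w σ₁ a - w σ₂ b) (hg.supp σ₁ σ₂ a b)
    refine (congrArg (IsRegularProd _) (funext fun p => ?_)).mpr h
    have h₂ := mem_chart_of_smul p.1.1 p.2.2
    have := congrFun (congrFun (hg.frameMatrix_gluedTriv hF σ₁ σ₂ p.1.2 p.2.1 h₂) a) b
    rw [frameMatrix_apply, LinearMap.id_apply] at this
    rw [hg.gluedTriv_act hF σ₂ p.1.1 p.1.2 h₂ p.2.2, Matrix.vecMul_diagonal, this, gl,
      monomialMatrix_apply]
    ring

/-- The tautological splitting of the glued bundle over the chart of an `n`-dimensional cone. -/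
def gluedSplitting (σ : F.MaxCone) : (hg.gluedBundle hF).EquivariantSplitting σ.1 where
  weight := w σ
  triv x hx := hg.gluedTriv hF σ x hx
  regular i a b := (hg.gluedBundle hF).transition_regular i σ a b
  equivariant t x hx htx v α := by
    refine (congrFun (hg.gluedTriv_act hF σ t x hx htx v) α).trans ?_
    rw [Matrix.vecMul_diagonal, mul_comm]
    rfl

end IsMonomialCocycle

end Gluing

/-! ### Equivariant splittings -/

section Splittings

variable {n r : ℕ} {F : Fan n}

open ToricVariety

namespace ToricVectorBundle

variable {E E' : ToricVectorBundle F r}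

namespace EquivariantSplitting

theorem triv_act {σ : F.Cone} (s : E.EquivariantSplitting σ) (t : Torus n) (x : ToricVariety F)
    (hx : x ∈ chart σ) (htx : t • x ∈ chart σ) (v : E.fiber x) :
    s.triv (t • x) htx (E.act t x v) =
      Matrix.vecMul (s.triv x hx v) (Matrix.diagonal fun a => chr t (s.weight a)) := by
  ext a
  rw [s.equivariant t x hx htx, Matrix.vecMul_diagonal, mul_comm]
  rfl

/-- A splitting over `U(σ)` restricts to `U(τ)` for every face `τ` of `σ`. -/
def restrict {σ τ : F.Cone} (h : τ.1 ≤ σ.1) (s : E.EquivariantSplitting σ) :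
    E.EquivariantSplitting τ where
  weight := s.weight
  triv x hx := s.triv x (chart_mono h hx)
  regular i a b := IsRegular.mono (W' := E.base i ∩ chart τ)
    (Set.inter_subset_inter_right _ (chart_mono h)) (s.regular i a b)
  equivariant t x hx htx := s.equivariant t x (chart_mono h hx) (chart_mono h htx)

/-- The matrix of an equivariant map with respect to equivariant frames is semi-invariant. -/
theorem frameMatrix_smul {σ σ' : F.Cone} (s : E.EquivariantSplitting σ)
    (s' : E'.EquivariantSplitting σ') (Φ : ∀ x, E.fiber x →ₗ[ℂ] E'.fiber x)
    (hΦ : ∀ (t : Torus n) x (v : E.fiber x), Φ (t • x) (E.act t x v) = E'.act t x (Φ x v))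
    (t : Torus n) (x : ToricVariety F) (hx : x ∈ chart σ) (hx' : x ∈ chart σ')
    (htx : t • x ∈ chart σ) (htx' : t • x ∈ chart σ') (a b : Fin r) :
    chr t (s.weight a) *
        frameMatrix (s.triv (t • x) htx) (s'.triv (t • x) htx') (Φ (t • x)) a b =
      frameMatrix (s.triv x hx) (s'.triv x hx') (Φ x) a b * chr t (s'.weight b) := by
  have h1 : E.act t x ((s.triv x hx).symm (Pi.single a 1)) =
      chr t (s.weight a) • (s.triv (t • x) htx).symm (Pi.single a 1) := by
    apply (s.triv (t • x) htx).injective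
    rw [s.triv_act t x hx htx, map_smul, LinearEquiv.apply_symm_apply,
      LinearEquiv.apply_symm_apply]
    ext c
    rw [Matrix.vecMul_diagonal, Pi.smul_apply, smul_eq_mul, mul_comm]
    by_cases h : c = a
    · rw [h]
    · rw [Pi.single_eq_of_ne h, mul_zero, mul_zero]
  have h2 := hΦ t x ((s.triv x hx).symm (Pi.single a 1))
  rw [h1, map_smul] at h2
  have h3 := congrArg (fun v => s'.triv (t • x) htx' v b) h2
  rw [map_smul, Pi.smul_apply, smul_eq_mul, s'.triv_act t x hx' htx', Matrix.vecMul_diagonal] at h3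
  exact h3

/-- The classes of the weights of a bundle modulo `τ^⊥` do not depend on the splitting: they are
the weights of the stabilizer of the distinguished point of `U(τ)` on the fibre there. -/
theorem exists_perm_weight {σ τ : F.Cone} (h : τ.1 ≤ σ.1) (s : E.EquivariantSplitting τ)
    (s' : E.EquivariantSplitting σ) :
    ∃ π : Equiv.Perm (Fin r), ∀ a, s.weight a - s'.weight (π a) ∈ perp τ.1 := by
  set x : ToricVariety F := ToricVariety.mk τ (Chart.distPt τ.1) with hxdef
  have hx : x ∈ chart τ := mk_mem_chart _ _
  have hx' : x ∈ chart σ := chart_mono h hx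
  obtain ⟨π, hπ⟩ := exists_perm_ne_zero (det_frameMatrix_id (s.triv x hx) (s'.triv x hx'))
  obtain ⟨S, hS⟩ := τ.exists_generators
  refine ⟨π, fun a => ?_⟩
  rw [hS]
  refine mem_perp_latticeCone.2 fun v hv => ?_
  -- `2` is not a root of unity, so the value of a character at it determines the exponent
  let two : ℂˣ := Units.mk0 2 two_ne_zero
  have hfix : oneParam v two • x = x := by
    rw [hxdef, smul_mk, Chart.oneParam_smul_distPt (hS ▸ latticePoint_mem hv)]
  have hcongr : ∀ y (_ : y = x) (hy : y ∈ chart τ) (hy' : y ∈ chart σ),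
      frameMatrix (s.triv y hy) (s'.triv y hy') LinearMap.id =
        frameMatrix (s.triv x hx) (s'.triv x hx') LinearMap.id := by
    rintro _ rfl _ _
    rfl
  have key := s.frameMatrix_smul s' (fun _ => LinearMap.id) (fun _ _ _ => rfl) (oneParam v two) x
    hx hx' (smul_mem_chart _ hx) (smul_mem_chart _ hx') a (π a)
  rw [hcongr _ hfix, mul_comm] at key
  have key := mul_left_cancel₀ (hπ a) key
  rw [chr_oneParam, chr_oneParam] at key
  change (2 : ℂ) ^ (s.weight a ⬝ᵥ v) = 2 ^ (s'.weight (π a) ⬝ᵥ v) at key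
  have key : (2 : ℝ) ^ (s.weight a ⬝ᵥ v) = 2 ^ (s'.weight (π a) ⬝ᵥ v) :=
    Complex.ofReal_injective (by push_cast; exact key)
  rw [sub_dotProduct, zpow_right_injective₀ (by norm_num) (by norm_num) key, sub_self]

theorem isRegularMat_frameMatrix {σ : F.Cone} (s : E.EquivariantSplitting σ)
    (s' : E'.EquivariantSplitting σ) (Φ : ∀ x, E.fiber x →ₗ[ℂ] E'.fiber x)
    (i : E.ι) (j : E'.ι)
    (hΦ : IsRegularMat (E.base i ∩ E'.base j) fun x =>
      frameMatrix (E.triv i x.1 x.2.1) (E'.triv j x.1 x.2.2) (Φ x.1)) :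
    IsRegularMat (E.base i ∩ E'.base j ∩ chart σ) fun x =>
      frameMatrix (s.triv x.1 x.2.2) (s'.triv x.1 x.2.2) (Φ x.1) := by
  have h1 : IsRegularMat (E.base i ∩ chart σ) fun x =>
      frameMatrix (E.triv i x.1 x.2.1) (s.triv x.1 x.2.2) LinearMap.id := s.regular i
  have h2 : IsRegularMat (E'.base j ∩ chart σ) fun x =>
      frameMatrix (E'.triv j x.1 x.2.1) (s'.triv x.1 x.2.2) LinearMap.id := s'.regular j
  have hi : E.base i ∩ E'.base j ∩ chart σ ⊆ E.base i ∩ chart σ := fun x hx => ⟨hx.1.1, hx.2⟩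
  have hj : E.base i ∩ E'.base j ∩ chart σ ⊆ E'.base j ∩ chart σ := fun x hx => ⟨hx.1.2, hx.2⟩
  have h := ((h1.inv fun x => det_frameMatrix_id _ _).mono hi).mul
    ((hΦ.mono Set.inter_subset_left).mul (h2.mono hj))
  refine (congrArg (IsRegularMat _) (funext fun x => ?_)).mpr h
  rw [inv_frameMatrix_id, frameMatrix_mul, frameMatrix_mul]
  rfl

theorem isRegularMat_of_frameMatrix {σ : F.Cone} (s : E.EquivariantSplitting σ)
    (s' : E'.EquivariantSplitting σ) (Φ : ∀ x, E.fiber x →ₗ[ℂ] E'.fiber x)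
    (hΦ : IsRegularMat (chart σ) fun x =>
      frameMatrix (s.triv x.1 x.2) (s'.triv x.1 x.2) (Φ x.1)) (i : E.ι) (j : E'.ι) :
    IsRegularMat (E.base i ∩ E'.base j ∩ chart σ) fun x =>
      frameMatrix (E.triv i x.1 x.2.1.1) (E'.triv j x.1 x.2.1.2) (Φ x.1) := by
  have h1 : IsRegularMat (E.base i ∩ chart σ) fun x =>
      frameMatrix (E.triv i x.1 x.2.1) (s.triv x.1 x.2.2) LinearMap.id := s.regular i
  have h2 : IsRegularMat (E'.base j ∩ chart σ) fun x =>
      frameMatrix (E'.triv j x.1 x.2.1) (s'.triv x.1 x.2.2) LinearMap.id := s'.regular j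
  have hi : E.base i ∩ E'.base j ∩ chart σ ⊆ E.base i ∩ chart σ := fun x hx => ⟨hx.1.1, hx.2⟩
  have hj : E.base i ∩ E'.base j ∩ chart σ ⊆ E'.base j ∩ chart σ := fun x hx => ⟨hx.1.2, hx.2⟩
  have h := (h1.mono hi).mul ((hΦ.mono Set.inter_subset_right).mul
    ((h2.inv fun x => det_frameMatrix_id _ _).mono hj))
  refine (congrArg (IsRegularMat _) (funext fun x => ?_)).mpr h
  rw [inv_frameMatrix_id, frameMatrix_mul, frameMatrix_mul]
  rfl

end EquivariantSplitting

end ToricVectorBundle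

/-- A semi-invariant regular function on `U(σ)` that does not vanish at the unit of the torus has
weight in `σ^∨`. Otherwise it would have a pole at the limit point of the one-parameter subgroup of
some `v ∈ σ ∩ N`. -/
theorem mem_dualMonoid_of_regular {σ : F.Cone} (f : ∀ x, x ∈ chart σ → ℂ)
    (hreg : ∀ x ∈ chart σ, ∃ W : Set (ToricVariety F), IsOpen W ∧ x ∈ W ∧
      IsRegular (W ∩ chart σ) fun y => f y.1 y.2.2)
    {w w' : MLat n}
    (hf : ∀ (t : Torus n) x (hx : x ∈ chart σ) (htx : t • x ∈ chart σ),
      chr t w * f (t • x) htx = f x hx * chr t w')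
    (h0 : f (ToricVariety.mk σ (Chart.unitPt σ.1)) (mk_mem_chart _ _) ≠ 0) :
    w - w' ∈ dualMonoid σ.1 := by
  obtain ⟨S, hS⟩ := σ.exists_generators
  suffices h : ∀ v ∈ S, 0 ≤ (w - w') ⬝ᵥ v by
    rw [hS]
    exact mem_dualMonoid_latticeCone.2 h
  intro v hv
  by_contra! hneg
  have hvσ : latticePoint v ∈ σ.1 := hS ▸ latticePoint_mem hv
  obtain ⟨k, hk⟩ := Int.eq_ofNat_of_zero_le (neg_nonneg.2 hneg.le)
  have hk0 : k ≠ 0 := by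
    rintro rfl
    simp only [Nat.cast_zero] at hk
    omega
  set u := f (ToricVariety.mk σ (Chart.unitPt σ.1)) (mk_mem_chart _ _) with hu
  let p : ℂ → Chart σ.1 := Chart.curvePt hvσ
  have hval : ∀ s : ℂ, s ≠ 0 → f (ToricVariety.mk σ (p s)) (mk_mem_chart _ _) * s ^ k = u := by
    intro s hs
    have e : p s = (oneParam v (Units.mk0 s hs))⁻¹ • Chart.unitPt σ.1 :=
      Chart.curvePt_eq_smul hvσ (Units.mk0 s hs)
    have h1 := hf (oneParam v (Units.mk0 s hs))⁻¹ (ToricVariety.mk σ (Chart.unitPt σ.1))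
      (mk_mem_chart _ _) (mk_mem_chart _ _)
    have h2 : f (ToricVariety.mk σ (p s)) (mk_mem_chart _ _) =
      f ((oneParam v (Units.mk0 s hs))⁻¹ • ToricVariety.mk σ (Chart.unitPt σ.1))
        (mk_mem_chart _ _) := by
      congr 1
      rw [e]
      rfl
    rw [← h2, chr_inv, chr_inv, chr_oneParam, chr_oneParam, Units.val_mk0, ← hu] at h1
    have h3 : s ^ k = s ^ (w' ⬝ᵥ v) * (s ^ (w ⬝ᵥ v))⁻¹ := by
      rw [← zpow_natCast, ← zpow_neg, ← zpow_add₀ hs]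
      congr 1
      rw [sub_dotProduct] at hk
      have : ((k : ℕ) : ℤ) = -(w ⬝ᵥ v - w' ⬝ᵥ v) := hk.symm
      rw [this]
      ring
    rw [h3, mul_comm (s ^ (w' ⬝ᵥ v)), ← mul_assoc, mul_comm _ (s ^ (w ⬝ᵥ v))⁻¹, h1, mul_assoc,
      inv_mul_cancel₀ (zpow_ne_zero _ hs), mul_one]
  obtain ⟨W, hWo, hW, hWreg⟩ := hreg (ToricVariety.mk σ (p 0)) (mk_mem_chart _ _)
  obtain ⟨d, hd, hdW⟩ := Chart.exists_eval_ne_zero (isOpen_iff.1 hWo σ) hW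
  obtain ⟨a, b, hb, hab⟩ := hWreg σ (p 0) ⟨hW, mk_mem_chart _ _⟩
  have cont : ∀ c : ChartRing σ.1, Continuous fun s => (p s).eval c :=
    Chart.continuous_eval_curvePt hvσ
  have hlim : Filter.Tendsto (fun s => u * (p s).eval b) (nhdsWithin 0 {0}ᶜ)
      (nhds (u * (p 0).eval b)) :=
    ((continuous_const.mul (cont b)).tendsto 0).mono_left nhdsWithin_le_nhds
  have hlim' : Filter.Tendsto (fun s => s ^ k * (p s).eval a) (nhdsWithin 0 {0}ᶜ)
      (nhds (0 ^ k * (p 0).eval a)) :=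
    (((continuous_pow k).mul (cont a)).tendsto 0).mono_left nhdsWithin_le_nhds
  have hev : (fun s => s ^ k * (p s).eval a) =ᶠ[nhdsWithin 0 {0}ᶜ] fun s => u * (p s).eval b := by
    have hd' : ∀ᶠ s in nhdsWithin (0 : ℂ) {0}ᶜ, (p s).eval d ≠ 0 :=
      (((cont d).tendsto 0).mono_left nhdsWithin_le_nhds).eventually_ne hd
    have hb' : ∀ᶠ s in nhdsWithin (0 : ℂ) {0}ᶜ, (p s).eval b ≠ 0 :=
      (((cont b).tendsto 0).mono_left nhdsWithin_le_nhds).eventually_ne hb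
    filter_upwards [hd', hb', self_mem_nhdsWithin] with s hsd hsb hs
    have h1 := hab (p s) ⟨hdW _ hsd, mk_mem_chart _ _⟩ hsb
    dsimp only at h1
    rw [← hval s hs, h1]
    field_simp
  have := tendsto_nhds_unique (hlim'.congr' hev) hlim
  rw [zero_pow hk0, zero_mul] at this
  exact mul_ne_zero h0 hb this.symm

end Splittings

/-! ### Isomorphisms of glued bundles -/

section GluedFrames

variable {n r : ℕ} {F : Fan n}

open ToricVariety

/-- Splittings of a bundle over the charts of the `n`-dimensional cones with prescribed weights
and transition matrices. -/
structure IsGluedFrames {E : ToricVectorBundle F r} (w : F.MaxCone → Fin r → MLat n)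
    (g : F.MaxCone → F.MaxCone → Matrix (Fin r) (Fin r) ℂ)
    (s : ∀ σ : F.MaxCone, E.EquivariantSplitting σ.1) : Prop where
  weight : ∀ σ, (s σ).weight = w σ
  frame : ∀ σ₁ σ₂ x (h₁ : x ∈ chart σ₁.1) (h₂ : x ∈ chart σ₂.1),
    frameMatrix ((s σ₁).triv x h₁) ((s σ₂).triv x h₂) LinearMap.id =
      monomialMatrix (g σ₁ σ₂) (w σ₁) (w σ₂) x

namespace MultiSection.Labelling

variable {A : MultiSection.{u} n} {ℓ : A.Labelling F r}
  {g : F.MaxCone → F.MaxCone → GL (Fin r) ℂ}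

theorem IsKaneyama.isMonomialCocycle (hg : ℓ.IsKaneyama g) :
    IsMonomialCocycle ℓ.m fun σ₁ σ₂ => (g σ₁ σ₂ : Matrix (Fin r) (Fin r) ℂ) where
  self σ := by rw [hg.g1]; rfl
  supp σ₁ σ₂ a b hab := (hg.g2 σ₁ σ₂ a b hab).2
  mul σ₁ σ₂ σ₃ := by rw [← hg.g3 σ₁ σ₂ σ₃]; rfl

theorem IsKaneyama.isGluedFrom_iff (hg : ℓ.IsKaneyama g) (E : ToricVectorBundle F r) :
    E.IsGluedFrom ℓ g ↔ ∃ s : ∀ σ : F.MaxCone, E.EquivariantSplitting σ.1,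
      IsGluedFrames ℓ.m (fun σ₁ σ₂ => (g σ₁ σ₂ : Matrix (Fin r) (Fin r) ℂ)) s := by
  have hmon : ∀ (σ₁ σ₂ : F.MaxCone) (p : Chart (σ₁.1.inter σ₂.1).1) (a b : Fin r),
      (g σ₁ σ₂ : Matrix (Fin r) (Fin r) ℂ) a b * p.monomial (ℓ.m σ₁ a - ℓ.m σ₂ b) =
        monomialMatrix (g σ₁ σ₂ : Matrix (Fin r) (Fin r) ℂ) (ℓ.m σ₁) (ℓ.m σ₂)
          (ToricVariety.mk _ p) a b := by
    intro σ₁ σ₂ p a b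
    rw [monomialMatrix_apply]
    by_cases h : (g σ₁ σ₂ : Matrix (Fin r) (Fin r) ℂ) a b = 0
    · rw [h, zero_mul, zero_mul]
    · rw [zval_mk p (hg.isMonomialCocycle.supp σ₁ σ₂ a b h)]
  constructor
  · rintro ⟨s, hw, hs⟩
    refine ⟨s, hw, fun σ₁ σ₂ x h₁ h₂ => ?_⟩
    obtain ⟨p, rfl⟩ := mem_chart_inter h₁ h₂
    ext a b
    have h := hs σ₁ σ₂ p _ rfl h₁ h₂ a
    rw [ToricVectorBundle.EquivariantSplitting.frame] at h
    rw [frameMatrix_apply, LinearMap.id_apply, h, map_sum, Finset.sum_apply]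
    simp only [hmon, map_smul, ToricVectorBundle.EquivariantSplitting.frame,
      LinearEquiv.apply_symm_apply, Pi.smul_apply, smul_eq_mul, Pi.single_apply, mul_ite, mul_one,
      mul_zero, Finset.sum_ite_eq, Finset.mem_univ, if_true]
  · rintro ⟨s, hs⟩
    refine ⟨s, hs.weight, ?_⟩
    rintro σ₁ σ₂ p _ rfl h₁ h₂ a
    simp only [hmon]
    rw [← hs.frame σ₁ σ₂ _ h₁ h₂]
    exact symm_single_eq_sum ((s σ₁).triv _ h₁) ((s σ₂).triv _ h₂) a

end MultiSection.Labelling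

theorem IsMonomialCocycle.exists_isGluedFrames (hF : F.IsComplete)
    {w : F.MaxCone → Fin r → MLat n} {g : F.MaxCone → F.MaxCone → Matrix (Fin r) (Fin r) ℂ}
    (hg : IsMonomialCocycle w g) :
    ∃ (E : ToricVectorBundle F r) (s : ∀ σ : F.MaxCone, E.EquivariantSplitting σ.1),
      IsGluedFrames w g s :=
  ⟨hg.gluedBundle hF, hg.gluedSplitting hF, fun _ => rfl,
    fun σ₁ σ₂ x h₁ h₂ => hg.frameMatrix_gluedTriv hF σ₁ σ₂ x h₁ h₂⟩

variable {w : F.MaxCone → Fin r → MLat n} {g g' : F.MaxCone → F.MaxCone → Matrix (Fin r) (Fin r) ℂ}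
  {E E' : ToricVectorBundle F r} {s : ∀ σ : F.MaxCone, E.EquivariantSplitting σ.1}
  {s' : ∀ σ : F.MaxCone, E'.EquivariantSplitting σ.1}

/-- Matrices intertwining two cocycles define an isomorphism of the glued bundles. -/
theorem iso_of_intertwining (hF : F.IsComplete) (hg : IsMonomialCocycle w g)
    (hg' : IsMonomialCocycle w g') (hs : IsGluedFrames w g s) (hs' : IsGluedFrames w g' s')
    {K : F.MaxCone → Matrix (Fin r) (Fin r) ℂ} (hdet : ∀ σ, (K σ).det ≠ 0)
    (hK : ∀ σ : F.MaxCone, SupportedOn σ.1 (K σ) (w σ) (w σ))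
    (hgK : ∀ σ₁ σ₂, g σ₁ σ₂ * K σ₂ = K σ₁ * g' σ₁ σ₂) : E.Iso E' := by
  let c : ToricVariety F → F.MaxCone := IsMonomialCocycle.chosen hF
  have hc : ∀ x, x ∈ chart (c x).1 := IsMonomialCocycle.mem_chosen hF
  have hKinv : ∀ σ : F.MaxCone, SupportedOn σ.1 (K σ)⁻¹ (w σ) (w σ) :=
    fun σ => (hK σ).inv (hdet σ)
  let M : F.MaxCone → ToricVariety F → Matrix (Fin r) (Fin r) ℂ :=
    fun σ x => monomialMatrix (K σ) (w σ) (w σ) x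
  let Φ : ∀ x, E.fiber x ≃ₗ[ℂ] E'.fiber x := fun x =>
    ((s (c x)).triv x (hc x)).trans ((vecMulEquiv (M (c x) x)
      (monomialMatrix (K (c x))⁻¹ (w (c x)) (w (c x)) x)
      (by rw [monomialMatrix_mul (hc x) (hK _) (hKinv _),
        Matrix.mul_nonsing_inv _ (hdet _).isUnit, monomialMatrix_one _ (hc x)])
      (by rw [monomialMatrix_mul (hc x) (hKinv _) (hK _),
        Matrix.nonsing_inv_mul _ (hdet _).isUnit, monomialMatrix_one _ (hc x)])).trans
      ((s' (c x)).triv x (hc x)).symm)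
  have hΦc : ∀ x, frameMatrix ((s (c x)).triv x (hc x)) ((s' (c x)).triv x (hc x)) (Φ x) =
      M (c x) x := fun x => frameMatrix_eq_of _ _ _ fun v => by
    simp only [Φ, LinearEquiv.coe_coe, LinearEquiv.trans_apply, LinearEquiv.apply_symm_apply]
    rfl
  -- in every chart the map is given by the intertwining matrix of that chart
  have hΦ : ∀ (σ : F.MaxCone) x (hx : x ∈ chart σ.1),
      frameMatrix ((s σ).triv x hx) ((s' σ).triv x hx) (Φ x) = M σ x := by
    intro σ x hx
    have hin := mem_chart_inter hx (hc x)
    have e : frameMatrix ((s σ).triv x hx) ((s' σ).triv x hx) (Φ x) =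
        frameMatrix ((s σ).triv x hx) ((s (c x)).triv x (hc x)) LinearMap.id *
          (frameMatrix ((s (c x)).triv x (hc x)) ((s' (c x)).triv x (hc x)) (Φ x) *
            frameMatrix ((s' (c x)).triv x (hc x)) ((s' σ).triv x hx) LinearMap.id) := by
      rw [frameMatrix_mul, frameMatrix_mul]
      rfl
    have hK' : SupportedOn (σ.1.inter (c x).1) (K (c x)) (w (c x)) (w (c x)) :=
      (hK _).mono (Fan.Cone.inter_le_right _ _)
    have hK'' : SupportedOn (σ.1.inter (c x).1) (K σ) (w σ) (w σ) :=
      (hK _).mono (Fan.Cone.inter_le_left _ _)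
    rw [e, hΦc, hs.frame, hs'.frame, ← mul_assoc, monomialMatrix_mul hin (hg.supp _ _) hK', hgK,
      ← monomialMatrix_mul hin hK'' (hg'.supp _ _), mul_assoc]
    have h1 := hg'.gl_mul hx (hc x) hx
    rw [hg'.gl_self hx] at h1
    change monomialMatrix (g' σ (c x)) (w σ) (w (c x)) x *
      monomialMatrix (g' (c x) σ) (w (c x)) (w σ) x = 1 at h1
    rw [h1, mul_one]
  refine ⟨Φ, fun i j a b => ?_, fun t x v => ?_⟩
  · refine isRegular_of_charts hF fun σ => ?_
    refine (s σ).isRegularMat_of_frameMatrix (s' σ) (fun x => (Φ x : E.fiber x →ₗ[ℂ] E'.fiber x))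
      ?_ i j a b
    refine (congrArg (IsRegularMat _) (funext fun x => hΦ σ x.1 x.2)).mpr ?_
    exact isRegularMat_monomialMatrix le_rfl (hK σ)
  · have hx := hc x
    have htx := smul_mem_chart t hx
    have e : ∀ y (hy : y ∈ chart (c x).1) (u : E.fiber y),
        (s' (c x)).triv y hy (Φ y u) = Matrix.vecMul ((s (c x)).triv y hy u) (M (c x) y) :=
      fun y hy u => by
        rw [← hΦ (c x) y hy, vecMul_frameMatrix]
        rfl
    apply ((s' (c x)).triv (t • x) htx).injective
    rw [e, (s (c x)).triv_act t x hx htx, (s' (c x)).triv_act t x hx htx, e, hs.weight, hs'.weight,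
      Matrix.vecMul_vecMul, Matrix.vecMul_vecMul, monomialMatrix_smul hx t (hK _)]

/-- An isomorphism of glued bundles is given by constant matrices at the unit of the torus, and
these intertwine the two cocycles. -/
theorem exists_intertwining (hg : IsMonomialCocycle w g)
    (hg' : IsMonomialCocycle w g') (hs : IsGluedFrames w g s) (hs' : IsGluedFrames w g' s')
    (h : E.Iso E') : ∃ K : F.MaxCone → Matrix (Fin r) (Fin r) ℂ, (∀ σ, (K σ).det ≠ 0) ∧
      (∀ σ : F.MaxCone, SupportedOn σ.1 (K σ) (w σ) (w σ)) ∧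
      ∀ σ₁ σ₂, g σ₁ σ₂ * K σ₂ = K σ₁ * g' σ₁ σ₂ := by
  obtain ⟨Φ, hreg, heq⟩ := h
  let k : ∀ (σ : F.MaxCone) x, x ∈ chart σ.1 → Matrix (Fin r) (Fin r) ℂ := fun σ x hx =>
    frameMatrix ((s σ).triv x hx) ((s' σ).triv x hx) (Φ x)
  refine ⟨fun σ => k σ (ToricVariety.mk σ.1 (Chart.unitPt σ.1.1)) (mk_mem_chart _ _),
    fun σ => det_frameMatrix_equiv _ _ _, fun σ a b hab => ?_, fun σ₁ σ₂ => ?_⟩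
  · refine mem_dualMonoid_of_regular (fun x hx => k σ x hx a b) (fun x hx => ?_)
      (fun t x hx htx => ?_) hab
    · obtain ⟨i, hi⟩ := E.cover x
      obtain ⟨j, hj⟩ := E'.cover x
      refine ⟨E.base i ∩ E'.base j, (E.isOpen_base i).inter (E'.isOpen_base j), ⟨hi, hj⟩, ?_⟩
      exact (s σ).isRegularMat_frameMatrix (s' σ) (fun x => (Φ x : E.fiber x →ₗ[ℂ] E'.fiber x)) i j
        (hreg i j) a b
    · have := (s σ).frameMatrix_smul (s' σ) (fun x => (Φ x : E.fiber x →ₗ[ℂ] E'.fiber x)) heq t x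
        hx hx htx htx a b
      rw [hs.weight, hs'.weight] at this
      exact this
  · set ρ := σ₁.1.inter σ₂.1 with hρ
    set x : ToricVariety F := ToricVariety.mk ρ (Chart.unitPt ρ.1) with hx
    have hle₁ : ρ.1 ≤ σ₁.1.1 := Fan.Cone.inter_le_left _ _
    have hle₂ : ρ.1 ≤ σ₂.1.1 := Fan.Cone.inter_le_right _ _
    have hxρ : x ∈ chart ρ := mk_mem_chart _ _
    have hx₁ : x ∈ chart σ₁.1 := chart_mono hle₁ hxρ
    have hx₂ : x ∈ chart σ₂.1 := chart_mono hle₂ hxρ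
    have hk : ∀ (σ : F.MaxCone) y (_ : y = x) (hy : y ∈ chart σ.1) (hxσ : x ∈ chart σ.1),
        k σ y hy = k σ x hxσ := by
      rintro σ _ rfl _ _
      rfl
    have e₁ : ToricVariety.mk σ₁.1 (Chart.unitPt σ₁.1.1) = x := by
      rw [hx, ← mk_incl hle₁, Chart.incl_unitPt]
    have e₂ : ToricVariety.mk σ₂.1 (Chart.unitPt σ₂.1.1) = x := by
      rw [hx, ← mk_incl hle₂, Chart.incl_unitPt]
    dsimp only
    rw [hk σ₁ _ e₁ _ hx₁, hk σ₂ _ e₂ _ hx₂]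
    have h1 := hs.frame σ₁ σ₂ x hx₁ hx₂
    have h2 := hs'.frame σ₁ σ₂ x hx₁ hx₂
    rw [← (h1.trans (monomialMatrix_unitPt (hg.supp σ₁ σ₂))),
      ← (h2.trans (monomialMatrix_unitPt (hg'.supp σ₁ σ₂)))]
    change frameMatrix _ _ _ * frameMatrix _ _ _ = frameMatrix _ _ _ * frameMatrix _ _ _
    rw [frameMatrix_mul, frameMatrix_mul]
    rfl

end GluedFrames

/-! ### Cones with pulled-back functions -/

section PulledBack

variable {n : ℕ} {X : Type u} {p : X → NR n} {K : Set X}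

theorem fg_pulledBack (p : X → NR n) (K : Set X) : (pulledBack p K).FG := by
  rw [← AddGroup.fg_iff_addSubgroup_fg]
  exact AddGroup.fg_range _

theorem continuous_of_mem_pulledBack [TopologicalSpace X] (hp : Continuous p) {u : K → ℝ}
    (hu : u ∈ pulledBack p K) : Continuous u := by
  obtain ⟨m, rfl⟩ := mem_pulledBack.1 hu
  exact (continuous_pairing m).comp (hp.comp continuous_subtype_val)

/-- The evaluation map of a cone with functions pulled back along an embedding into `N_ℝ` is an
embedding, since the coordinates of `N_ℝ` are among these functions. -/
theorem isEmbedding_evalMap [TopologicalSpace X] (hp : Continuous p) (C : ConeData X)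
    (hM : C.M K = pulledBack p K) (hK : Topology.IsEmbedding fun x : K => p x.1) :
    Topology.IsEmbedding (C.evalMap K) := by
  have hmem : ∀ m : MLat n, (fun x : K => pairing m (p x.1)) ∈ C.M K := fun m => by
    rw [hM]
    exact mem_pulledBack.2 ⟨m, rfl⟩
  let g : (C.M K → ℝ) → NR n := fun e i => e ⟨_, hmem (Pi.single i 1)⟩
  have hg : Continuous g := continuous_pi fun i => continuous_apply _
  have hcomp : (g ∘ C.evalMap K) = fun x : K => p x.1 := by
    ext x i
    change pairing (Pi.single i 1) (p x.1) = p x.1 i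
    rw [pairing_apply, Finset.sum_eq_single i]
    · simp
    · intro j _ hj
      rw [Pi.single_eq_of_ne hj, Int.cast_zero, zero_mul]
    · simp
  refine Topology.IsEmbedding.of_comp (continuous_pi fun u => ?_) hg (hcomp ▸ hK)
  exact continuous_of_mem_pulledBack hp (hM ▸ u.2)

/-- A cone with functions pulled back from a rational polyhedral cone onto which it is mapped is
itself rational polyhedral. -/
theorem exists_range_evalMap {F : Fan n} (C : ConeData X) (hM : C.M K = pulledBack p K)
    {σ : F.Cone} (hσ : p '' K = (σ.1 : Set (NR n))) :
    ∃ S : Finset (C.M K →+ ℤ), Set.range (C.evalMap K) =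
      {f | ∃ c : (C.M K →+ ℤ) → ℝ, (∀ s, 0 ≤ c s) ∧ f = fun u => ∑ s ∈ S, c s * (s u : ℝ)} := by
  classical
  obtain ⟨S, hS⟩ := σ.exists_generators
  have hex : ∀ y ∈ σ.1, ∃ z : K, p z.1 = y := fun y hy => by
    have : y ∈ p '' K := by rw [hσ]; exact hy
    obtain ⟨z, hz, h⟩ := this
    exact ⟨⟨z, hz⟩, h⟩
  have hrep : ∀ u : C.M K, ∃ m : MLat n, ∀ x : K, u.1 x = pairing m (p x.1) := fun u => by
    obtain ⟨u, hu⟩ := u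
    rw [hM] at hu
    obtain ⟨m, hm⟩ := mem_pulledBack.1 hu
    exact ⟨m, fun x => congrFun hm x⟩
  choose rep hrep using hrep
  have hz : ∀ v : S, ∃ z : K, p z.1 = latticePoint v.1 := fun v =>
    hex _ (hS ▸ latticePoint_mem v.2)
  choose z hz using hz
  have hval : ∀ (v : S) (u : C.M K), ((rep u ⬝ᵥ v.1 : ℤ) : ℝ) = u.1 (z v) := fun v u => by
    rw [hrep, hz, pairing_latticePoint]
  let h : S → (C.M K →+ ℤ) := fun v =>
    { toFun := fun u => rep u ⬝ᵥ v.1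
      map_zero' := by
        have : ((rep 0 ⬝ᵥ v.1 : ℤ) : ℝ) = 0 := hval v 0
        exact_mod_cast this
      map_add' := fun a b => by
        have := hval v (a + b)
        rw [show (a + b : C.M K).1 (z v) = a.1 (z v) + b.1 (z v) from rfl, ← hval, ← hval] at this
        exact_mod_cast this }
  have hh : ∀ v (u : C.M K), ((h v u : ℤ) : ℝ) = pairing (rep u) (latticePoint v.1) := fun v u =>
    (pairing_latticePoint _ _).symm
  refine ⟨Finset.univ.image h, Set.ext fun f => ⟨?_, ?_⟩⟩
  · rintro ⟨x, rfl⟩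
    have hx : p x.1 ∈ latticeCone S := by
      have : p x.1 ∈ p '' K := ⟨x.1, x.2, rfl⟩
      rwa [hσ, hS] at this
    obtain ⟨c, hc, hx⟩ := mem_latticeCone.1 hx
    refine ⟨fun s => ∑ v ∈ Finset.univ.filter fun v => h v = s, c v.1,
      fun s => Finset.sum_nonneg fun v _ => hc v.1, ?_⟩
    ext u
    change u.1 x = _
    rw [hrep, hx, pairing_sum_right, ← Finset.sum_coe_sort S]
    rw [← Finset.sum_fiberwise_of_maps_to (s := Finset.univ) (t := Finset.univ.image h) (g := h)
      fun v hv => Finset.mem_image_of_mem h hv]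
    refine Finset.sum_congr rfl fun s _ => ?_
    rw [Finset.sum_mul]
    refine Finset.sum_congr rfl fun v hv => ?_
    rw [← (Finset.mem_filter.1 hv).2, hh, pairing_smul_right]
  · rintro ⟨c, hc, rfl⟩
    have hv : ∀ s : Finset.univ.image h, ∃ v : S, h v = s.1 := fun s => by
      obtain ⟨v, -, hv⟩ := Finset.mem_image.1 s.2
      exact ⟨v, hv⟩
    choose v hv using hv
    obtain ⟨x, hx⟩ := hex (∑ s : Finset.univ.image h, c s.1 • latticePoint (v s).1) (by
      rw [hS]
      exact sum_mem fun s _ => PointedCone.smul_mem _ (hc _) (latticePoint_mem (v s).2))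
    refine ⟨x, ?_⟩
    ext u
    change u.1 x = _
    rw [hrep, hx, pairing_sum_right, ← Finset.sum_coe_sort (Finset.univ.image h)]
    refine Finset.sum_congr rfl fun s _ => ?_
    rw [pairing_smul_right, ← hh, hv]

end PulledBack

/-! ### The multi-section of a family of weights -/

section Poset

variable {n r : ℕ} {F : Fan n} {w : F.Cone → Fin r → MLat n}

theorem mk_eq_mk_of_sub_mem {σ : PointedCone ℝ (NR n)} {a b : MLat n} (h : a - b ∈ perp σ) :
    (QuotientAddGroup.mk a : MLat n ⧸ perp σ) = QuotientAddGroup.mk b := by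
  rw [QuotientAddGroup.eq]
  have := neg_mem h
  rwa [neg_sub, sub_eq_neg_add] at this

theorem sub_mem_of_mk_eq_mk {σ : PointedCone ℝ (NR n)} {a b : MLat n}
    (h : (QuotientAddGroup.mk a : MLat n ⧸ perp σ) = QuotientAddGroup.mk b) : a - b ∈ perp σ := by
  rw [QuotientAddGroup.eq] at h
  have := neg_mem h
  rwa [neg_add, neg_neg, ← sub_eq_add_neg] at this

namespace WeightPoset

theorem le_refl (c : WeightPoset w) : le c c :=
  ⟨_root_.le_refl _, Quotient.out c.1.2, Quotient.out_eq _, Quotient.out_eq _⟩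

/-- If `c ≤ d` then every representative of the weight of `d` represents that of `c`. -/
theorem mk_eq_of_le {c d : WeightPoset w} (h : le c d) {m : MLat n}
    (hm : QuotientAddGroup.mk m = d.1.2) : QuotientAddGroup.mk m = c.1.2 := by
  obtain ⟨hcd, m', hd, hc⟩ := h
  rw [← hc]
  exact mk_eq_mk_of_sub_mem (perp_anti hcd (sub_mem_of_mk_eq_mk (hm.trans hd.symm)))

theorem le_trans {c d e : WeightPoset w} (h : le c d) (h' : le d e) : le c e := by
  obtain ⟨hde, m, he, hd⟩ := h'
  exact ⟨h.1.trans hde, m, he, mk_eq_of_le h hd⟩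

theorem le_of_le_of_le {c d e : WeightPoset w} (hc : le c e) (hd : le d e)
    (hcd : c.1.1.1 ≤ d.1.1.1) : le c d :=
  ⟨hcd, Quotient.out e.1.2, mk_eq_of_le hd (Quotient.out_eq _),
    mk_eq_of_le hc (Quotient.out_eq _)⟩

theorem eq_of_le {c d : WeightPoset w} (h : le c d) (hcd : c.1.1 = d.1.1) : c = d := by
  obtain ⟨⟨σ, q⟩, hq⟩ := c
  obtain ⟨⟨τ, q'⟩, hq'⟩ := d
  dsimp only at hcd
  subst hcd
  obtain ⟨-, m, h₁, h₂⟩ := h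
  have h : q = q' := h₂.symm.trans h₁
  subst h
  rfl

theorem isClosed_iff {D : Set (WeightPoset w)} :
    IsClosed D ↔ ∀ c ∈ D, ∀ d, le d c → d ∈ D := by
  rw [← isOpen_compl_iff]
  change (∀ c ∈ Dᶜ, ∀ d, le c d → d ∈ Dᶜ) ↔ _
  exact ⟨fun h c hc d hdc => by_contra fun hd => h d hd c hdc hc,
    fun h c hc d hcd hd => hc (h d hd c hcd)⟩

instance : Finite (WeightPoset w) := by
  have : Function.Surjective fun a : F.Cone × Fin r =>
      (⟨⟨a.1, QuotientAddGroup.mk (w a.1 a.2)⟩, a.2, rfl⟩ : WeightPoset w) := by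
    rintro ⟨⟨σ, q⟩, α, hα⟩
    change QuotientAddGroup.mk (w σ α) = q at hα
    subst hα
    exact ⟨(σ, α), rfl⟩
  exact Finite.of_surjective _ this

end WeightPoset

namespace AssocSpace

/-- The point of `N_ℝ` below a point of `L_𝓔`. -/
def pos (p : AssocSpace w) : NR n := p.1.1

/-- The element of `Σ_𝓔` of a point of `L_𝓔`. -/
def cell (p : AssocSpace w) : WeightPoset w := p.1.2

theorem ext' {p q : AssocSpace w} (h : p.pos = q.pos) (h' : p.cell = q.cell) : p = q :=
  Subtype.ext (Prod.ext h h')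

theorem pos_mem_relInt (p : AssocSpace w) : p.pos ∈ relInt p.cell.1.1.1 :=
  Fan.mem_interior_iff.1 p.2

/-- The cone of `L_𝓔` given by an element of `Σ_𝓔`. -/
def cone (c : WeightPoset w) : Set (AssocSpace w) := {p | WeightPoset.le p.cell c}

theorem continuous_pos : Continuous (pos : AssocSpace w → NR n) :=
  continuous_fst.comp continuous_subtype_val

theorem continuous_cell : Continuous (cell : AssocSpace w → WeightPoset w) :=
  continuous_snd.comp continuous_subtype_val

theorem isClosed_cone (c : WeightPoset w) : IsClosed (cone c) :=
  (WeightPoset.isClosed_iff.2 fun _ hc _ hd => WeightPoset.le_trans hd hc :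
    IsClosed {d | WeightPoset.le d c}).preimage continuous_cell

theorem cell_eq_of_relInt {p : AssocSpace w} {c : WeightPoset w} (hp : p ∈ cone c)
    (h : p.pos ∈ relInt c.1.1.1) : p.cell = c :=
  WeightPoset.eq_of_le hp (Fan.Cone.eq_of_mem_relInt p.pos_mem_relInt h)

theorem pos_mem {p : AssocSpace w} {c : WeightPoset w} (hp : p ∈ cone c) : p.pos ∈ c.1.1.1 :=
  hp.1 p.pos_mem_relInt.1

/-- A point of a cone of `L_𝓔` is determined by its position. -/
theorem eq_of_pos_eq {p q : AssocSpace w} {c : WeightPoset w} (hp : p ∈ cone c) (hq : q ∈ cone c)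
    (h : p.pos = q.pos) : p = q := by
  have h1 : p.cell.1.1 = q.cell.1.1 :=
    Fan.Cone.eq_of_mem_relInt p.pos_mem_relInt (h ▸ q.pos_mem_relInt)
  exact ext' h (WeightPoset.eq_of_le (WeightPoset.le_of_le_of_le hp hq (h1 ▸ le_rfl)) h1)

theorem assoc_φ_eq {p : AssocSpace w} {m : MLat n} (hm : QuotientAddGroup.mk m = p.cell.1.2) :
    (assocMultiSection w).φ p = pairing m p.pos := by
  have h : Quotient.out p.cell.1.2 - m ∈ perp p.cell.1.1.1 :=
    sub_mem_of_mk_eq_mk ((Quotient.out_eq _).trans hm.symm)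
  have h1 := h _ p.pos_mem_relInt.1
  rw [pairing_sub_left, sub_eq_zero] at h1
  exact h1

end AssocSpace

end Poset

/-! ### The multi-section of the weights is dominated by `𝕃` -/

namespace MultiSection.Labelling

variable {n r : ℕ} {F : Fan n} {A : MultiSection.{u} n}

/-- The weights `w τ` are, as multi-sets of classes modulo `τ^⊥`, the restrictions to `τ` of the
slopes of `φ` over any `n`-dimensional cone containing `τ`. -/
def IsWeightSystem (ℓ : A.Labelling F r) (w : F.Cone → Fin r → MLat n) : Prop :=
  ∀ (τ : F.Cone) (σ : F.MaxCone), τ.1 ≤ σ.1.1 →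
    ∃ π : Equiv.Perm (Fin r), ∀ a, w τ a - ℓ.m σ (π a) ∈ perp τ.1

namespace IsWeightSystem

variable {ℓ : A.Labelling F r} {w : F.Cone → Fin r → MLat n} (hw : ℓ.IsWeightSystem w)
include hw

theorem card_eq {τ : F.Cone} {σ : F.MaxCone} (h : τ.1 ≤ σ.1.1) (q : MLat n ⧸ perp τ.1) :
    Nat.card {a // (QuotientAddGroup.mk (ℓ.m σ a) : MLat n ⧸ perp τ.1) = q} =
      Nat.card {a // (QuotientAddGroup.mk (w τ a) : MLat n ⧸ perp τ.1) = q} := by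
  obtain ⟨π, hπ⟩ := hw τ σ h
  refine (Nat.card_congr (π.subtypeEquiv fun a => ?_)).symm
  rw [mk_eq_mk_of_sub_mem (hπ a)]

theorem exists_iff {τ : F.Cone} {σ : F.MaxCone} (h : τ.1 ≤ σ.1.1) (q : MLat n ⧸ perp τ.1) :
    (∃ a, (QuotientAddGroup.mk (w τ a) : MLat n ⧸ perp τ.1) = q) ↔
      ∃ a, (QuotientAddGroup.mk (ℓ.m σ a) : MLat n ⧸ perp τ.1) = q := by
  obtain ⟨π, hπ⟩ := hw τ σ h
  constructor
  · rintro ⟨a, rfl⟩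
    exact ⟨π a, (mk_eq_mk_of_sub_mem (hπ a)).symm⟩
  · rintro ⟨a, rfl⟩
    refine ⟨π.symm a, ?_⟩
    have := mk_eq_mk_of_sub_mem (hπ (π.symm a))
    rwa [Equiv.apply_symm_apply] at this

variable (hF : F.IsComplete) (hA : A.IsTropicalLagrangian F r)
include hF hA

omit hw hF hA in
theorem mk_slope_eq (ℓ : A.Labelling F r) (hA : A.IsTropicalLagrangian F r) {σ : F.MaxCone}
    {a : Fin r} {z : A.L} (hz : z ∈ ℓ.lift σ a) :
    (QuotientAddGroup.mk (ℓ.m σ a) : MLat n ⧸ perp (hA.base z).1) =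
      QuotientAddGroup.mk (A.slope (hA.minCone z)) :=
  mk_eq_mk_of_sub_mem (hA.slope_sub_mem_perp (ℓ.mem σ a) (hA.minCone_mem z)
    (hA.minCone_subset (ℓ.mem σ a) hz) subset_rfl (hA.image_minCone z))

/-- The cone below a point of `L`, together with the class of the slope of `φ` at this point. -/
def cellOf (z : A.L) : WeightPoset w :=
  ⟨⟨hA.base z, QuotientAddGroup.mk (A.slope (hA.minCone z))⟩, by
    obtain ⟨σ, hσ⟩ := hF.exists_maxCone (hA.base z)
    obtain ⟨a, ha⟩ := hA.exists_mem_lift ℓ σ (hσ (hA.mem_relInt_base z).1)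
    exact (hw.exists_iff hσ _).2 ⟨a, mk_slope_eq ℓ hA ha⟩⟩

/-- The map `L → L_𝓔` that records the position of a point and the class of the slope of `φ`. -/
def toAssoc (z : A.L) : AssocSpace w :=
  ⟨(A.π z, cellOf hw hF hA z), Fan.mem_interior_iff.2 (hA.mem_relInt_base z)⟩

theorem cellOf_le {y z : A.L} (h : z ∈ hA.minCone y) :
    WeightPoset.le (cellOf hw hF hA z) (cellOf hw hF hA y) := by
  have hz : A.π z ∈ (hA.base y).1 := by
    have : A.π z ∈ A.π '' hA.minCone y := ⟨z, h, rfl⟩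
    rwa [hA.image_minCone] at this
  refine ⟨hA.base_le hz, A.slope (hA.minCone y), rfl, ?_⟩
  exact mk_eq_mk_of_sub_mem (hA.slope_sub_mem_perp (hA.minCone_mem y) (hA.minCone_mem z)
    (hA.minCone_subset (hA.minCone_mem y) h) subset_rfl (hA.image_minCone z))

theorem toAssoc_eq_iff {σ : F.MaxCone} {a : Fin r} {z : A.L} (hz : z ∈ ℓ.lift σ a)
    {p : AssocSpace w} (hp : A.π z = p.pos) :
    toAssoc hw hF hA z = p ↔
      (QuotientAddGroup.mk (ℓ.m σ a) : MLat n ⧸ perp p.cell.1.1.1) = p.cell.1.2 := by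
  have hmk := mk_slope_eq ℓ hA hz
  constructor
  · rintro rfl
    exact hmk
  · intro h
    have hb : hA.base z = p.cell.1.1 :=
      Fan.Cone.eq_of_mem_relInt (hA.mem_relInt_base z) (hp ▸ p.pos_mem_relInt)
    refine AssocSpace.ext' hp (WeightPoset.eq_of_le ⟨hb ▸ le_rfl, ℓ.m σ a, h, hmk⟩ hb)

theorem toAssoc_surjective : Function.Surjective (toAssoc hw hF hA) := by
  intro p
  obtain ⟨σ, hσ⟩ := hF.exists_maxCone p.cell.1.1
  obtain ⟨a, ha⟩ := (hw.exists_iff hσ p.cell.1.2).1 p.cell.2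
  have hx : p.pos ∈ σ.1.1 := hσ p.pos_mem_relInt.1
  exact ⟨ℓ.pt σ hx a, (toAssoc_eq_iff hw hF hA (ℓ.pt_mem σ hx a) (ℓ.π_pt σ hx a)).2 ha⟩

theorem exists_cellOf (c : WeightPoset w) : ∃ z, cellOf hw hF hA z = c := by
  obtain ⟨x, hx⟩ := c.1.1.relInt_nonempty
  obtain ⟨z, hz⟩ := toAssoc_surjective hw hF hA ⟨(x, c), Fan.mem_interior_iff.2 hx⟩
  exact ⟨z, congrArg AssocSpace.cell hz⟩

theorem continuous_toAssoc : Continuous (toAssoc hw hF hA) := by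
  have hc : Continuous (cellOf hw hF hA) := by
    refine continuous_iff_isClosed.2 fun D hD => ?_
    -- the preimage of a downward closed set is the union of the cones whose element lies in it
    have h : cellOf hw hF hA ⁻¹' D =
        ⋃ ρ ∈ {ρ | ρ ∈ A.complex.cones ∧ ∃ y, hA.minCone y = ρ ∧ cellOf hw hF hA y ∈ D}, ρ := by
      ext z
      simp only [Set.mem_preimage, Set.mem_iUnion, Set.mem_ofPred_eq, exists_prop]
      constructor
      · exact fun hz => ⟨hA.minCone z, ⟨hA.minCone_mem z, z, rfl, hz⟩, hA.mem_minCone z⟩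
      · rintro ⟨_, ⟨-, y, rfl, hy⟩, hz⟩
        exact WeightPoset.isClosed_iff.1 hD _ hy _ (cellOf_le hw hF hA hz)
    rw [h]
    exact (hA.isConeComplex.finite.subset fun _ h => h.1).isClosed_biUnion
      fun ρ h => hA.isConeComplex.closed ρ h.1
  exact (hA.continuous_π.prodMk hc).subtype_mk _

/-- The cone of `L_𝓔` given by `c` is the homeomorphic image of a cone of `L`. -/
theorem exists_cone (c : WeightPoset w) : ∃ y, cellOf hw hF hA y = c ∧
    Set.MapsTo (toAssoc hw hF hA) (hA.minCone y) (AssocSpace.cone c) ∧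
    ∀ x ∈ c.1.1.1, ∃ z ∈ hA.minCone y, A.π z = x := by
  obtain ⟨y, rfl⟩ := exists_cellOf hw hF hA c
  refine ⟨y, rfl, fun z hz => cellOf_le hw hF hA hz, fun x hx => ?_⟩
  have : x ∈ A.π '' hA.minCone y := by
    rw [hA.image_minCone]
    exact hx
  exact this

theorem image_cone (c : WeightPoset w) :
    AssocSpace.pos '' AssocSpace.cone c = (c.1.1.1 : Set (NR n)) := by
  obtain ⟨y, -, hmaps, hsurj⟩ := exists_cone hw hF hA c
  ext x
  constructor
  · rintro ⟨p, hp, rfl⟩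
    exact AssocSpace.pos_mem hp
  · intro hx
    obtain ⟨z, hz, rfl⟩ := hsurj x hx
    exact ⟨_, hmaps hz, rfl⟩

theorem isEmbedding_pos (c : WeightPoset w) :
    Topology.IsEmbedding fun p : AssocSpace.cone c => p.1.pos := by
  obtain ⟨y, -, hmaps, hsurj⟩ := exists_cone hw hF hA c
  let e : hA.minCone y → AssocSpace.cone c := hmaps.restrict
  have he : Continuous e := (continuous_toAssoc hw hF hA).restrict hmaps
  have hg : Continuous fun p : AssocSpace.cone c => p.1.pos :=
    AssocSpace.continuous_pos.comp continuous_subtype_val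
  have hemb : Topology.IsEmbedding e :=
    Topology.IsEmbedding.of_comp he hg
      (hA.isBranchedCovering.cone_homeo _ (hA.minCone_mem y))
  have hesurj : Function.Surjective e := fun p => by
    obtain ⟨z, hz, h⟩ := hsurj _ (AssocSpace.pos_mem p.2)
    exact ⟨⟨z, hz⟩, Subtype.ext (AssocSpace.eq_of_pos_eq (hmaps hz) p.2 h)⟩
  let E := hemb.toHomeomorphOfSurjective hesurj
  have hcomp : (fun p : AssocSpace.cone c => p.1.pos) =
      (fun z : hA.minCone y => A.π z.1) ∘ E.symm := by
    ext1 p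
    obtain ⟨z, rfl⟩ := E.surjective p
    rw [Function.comp_apply, E.symm_apply_apply]
    rfl
  rw [hcomp]
  exact (hA.isBranchedCovering.cone_homeo _ (hA.minCone_mem y)).comp E.symm.isEmbedding

omit hw hF hA in
theorem mem_interior_cone_iff {c : WeightPoset w} (h : AssocSpace.pos '' AssocSpace.cone c =
    (c.1.1.1 : Set (NR n))) {p : AssocSpace w} :
    p ∈ (assocMultiSection w).complex.interior (AssocSpace.cone c) ↔ p.cell = c := by
  have := (assocMultiSection w).complex.mem_interior_iff (p := AssocSpace.pos)
    (K := AssocSpace.cone c) (σ := c.1.1.1) rfl h (x := p)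
  refine this.trans ⟨?_, ?_⟩
  · exact fun h => AssocSpace.cell_eq_of_relInt h.1 h.2
  · rintro rfl
    exact ⟨WeightPoset.le_refl _, p.pos_mem_relInt⟩

theorem assoc_isConeComplex : (assocMultiSection w).complex.IsConeComplex where
  finite := Set.finite_range _
  closed := by
    rintro _ ⟨c, rfl⟩
    exact AssocSpace.isClosed_cone c
  continuous := by
    rintro _ ⟨c, rfl⟩ u hu
    exact continuous_of_mem_pulledBack AssocSpace.continuous_pos hu
  fg := by
    rintro _ ⟨c, rfl⟩
    exact fg_pulledBack (AssocSpace.pos (w := w)) (AssocSpace.cone c)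
  embedding := by
    rintro _ ⟨c, rfl⟩
    exact isEmbedding_evalMap (p := AssocSpace.pos) AssocSpace.continuous_pos
      (assocMultiSection w).complex rfl (isEmbedding_pos hw hF hA c)
  rational := by
    rintro _ ⟨c, rfl⟩
    exact exists_range_evalMap (p := AssocSpace.pos) (assocMultiSection w).complex rfl
      (image_cone hw hF hA c)
  face := by
    rintro _ ⟨c, rfl⟩ u hu hpos
    obtain ⟨m, rfl⟩ := mem_pulledBack.1 hu
    obtain ⟨y, hy, hmaps, hsurj⟩ := exists_cone hw hF hA c
    have hm : m ∈ dualMonoid c.1.1.1 := fun x hx => by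
      obtain ⟨z, hz, rfl⟩ := hsurj x hx
      exact hpos ⟨_, hmaps hz⟩
    let τ : F.Cone := ⟨zeroFace c.1.1.1 m, F.face_mem _ c.1.1.2 _ (zeroFace_isFaceOf hm)⟩
    have hτ : τ.1 ≤ c.1.1.1 := (zeroFace_isFaceOf hm).le
    -- the face is the cone of the cell of any point over the relative interior of `τ`
    obtain ⟨x, hx⟩ := τ.relInt_nonempty
    obtain ⟨z, hz, rfl⟩ := hsurj x (hτ hx.1)
    have hb : hA.base z = τ := Fan.Cone.eq_of_mem_relInt (hA.mem_relInt_base z) hx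
    have hd : WeightPoset.le (cellOf hw hF hA z) c := hmaps hz
    have hsub : AssocSpace.cone (cellOf hw hF hA z) ⊆ AssocSpace.cone c :=
      fun p hp => WeightPoset.le_trans hp hd
    refine ⟨_, ⟨cellOf hw hF hA z, rfl⟩, hsub, ?_, fun v => ⟨fun hv => ?_, ?_⟩⟩
    · ext p
      constructor
      · intro hp
        refine ⟨hsub hp, ?_⟩
        have : p.pos ∈ (hA.base z).1 := AssocSpace.pos_mem (c := cellOf hw hF hA z) hp
        rw [hb] at this
        exact (mem_zeroFace.1 this).2
      · rintro ⟨hp, hp0⟩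
        have hpτ : p.pos ∈ τ.1 := mem_zeroFace.2 ⟨AssocSpace.pos_mem hp, hp0⟩
        refine WeightPoset.le_of_le_of_le hp hd ?_
        change p.cell.1.1.1 ≤ (hA.base z).1
        rw [hb]
        exact Fan.Cone.le_of_mem_relInt p.pos_mem_relInt hpτ
    · obtain ⟨k, rfl⟩ := mem_pulledBack.1 hv
      exact ⟨_, mem_pulledBack.2 ⟨k, rfl⟩, rfl⟩
    · rintro ⟨v', hv', rfl⟩
      obtain ⟨k, rfl⟩ := mem_pulledBack.1 hv'
      exact mem_pulledBack.2 ⟨k, rfl⟩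
  partition := by
    intro p
    refine ⟨AssocSpace.cone (AssocSpace.cell p), ⟨⟨_, rfl⟩, ?_⟩, ?_⟩
    · exact (mem_interior_cone_iff (image_cone hw hF hA _)).2 rfl
    · rintro _ ⟨⟨c, rfl⟩, hp⟩
      rw [(mem_interior_cone_iff (image_cone hw hF hA c)).1 hp]
      rfl

omit hw hF hA in
theorem assoc_μ_pos (p : AssocSpace w) : 0 < (assocMultiSection w).μ p := by
  obtain ⟨a, ha⟩ := p.cell.2
  have : Nonempty {α : Fin r // (QuotientAddGroup.mk (w p.cell.1.1 α) :
    MLat n ⧸ perp p.cell.1.1.1) = p.cell.1.2} := ⟨⟨a, ha⟩⟩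
  exact Nat.card_pos (α := {α : Fin r // (QuotientAddGroup.mk (w p.cell.1.1 α) :
    MLat n ⧸ perp p.cell.1.1.1) = p.cell.1.2})

theorem assoc_isWeight : (assocMultiSection w).complex.IsWeight (assocMultiSection w).μ := by
  refine ⟨assoc_μ_pos, ?_⟩
  rintro _ ⟨c, rfl⟩ p hp q hq
  have hp := (mem_interior_cone_iff (image_cone hw hF hA c)).1 hp
  have hq := (mem_interior_cone_iff (image_cone hw hF hA c)).1 hq
  have key : ∀ p : AssocSpace w, (assocMultiSection w).μ p =
    Nat.card {α : Fin r // (QuotientAddGroup.mk (w p.cell.1.1 α) :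
      MLat n ⧸ perp p.cell.1.1.1) = p.cell.1.2} := fun _ => rfl
  refine (key p).trans (Eq.trans ?_ (key q).symm)
  rw [hp, hq]

theorem card_toAssoc_pt (σ : F.MaxCone) {x : NR n} (hx : x ∈ σ.1.1) {p : AssocSpace w}
    (hp : p.pos = x) : Nat.card {a // toAssoc hw hF hA (ℓ.pt σ hx a) = p} =
      (assocMultiSection w).μ p := by
  have hσ : p.cell.1.1.1 ≤ σ.1.1 := Fan.Cone.le_of_mem_relInt p.pos_mem_relInt (hp ▸ hx)
  refine (Nat.card_congr (Equiv.subtypeEquivRight fun a => ?_)).trans (hw.card_eq hσ p.cell.1.2)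
  exact toAssoc_eq_iff hw hF hA (ℓ.pt_mem σ hx a) ((ℓ.π_pt σ hx a).trans hp.symm)

theorem trace_pos_eq_card (σ : F.MaxCone) {x : NR n} (hx : x ∈ σ.1.1) (V : Set (AssocSpace w)) :
    trace (AssocSpace.pos (w := w)) V (assocMultiSection w).μ x =
      Nat.card {a // toAssoc hw hF hA (ℓ.pt σ hx a) ∈ V} := by
  refine (finsum_mem_eq_card (fun a => toAssoc hw hF hA (ℓ.pt σ hx a)) (AssocSpace.pos ⁻¹' {x} ∩ V)
    (assocMultiSection w).μ fun p hp => card_toAssoc_pt hw hF hA σ hx hp.1).trans ?_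
  exact Nat.card_congr (Equiv.subtypeEquivRight fun a =>
    ⟨fun h => h.2, fun h => ⟨ℓ.π_pt σ hx a, h⟩⟩)

theorem trace_toAssoc : trace (toAssoc hw hF hA) Set.univ A.μ = (assocMultiSection w).μ := by
  ext p
  obtain ⟨σ, hσ⟩ := hF.exists_maxCone p.cell.1.1
  have hx : p.pos ∈ σ.1.1 := hσ p.pos_mem_relInt.1
  rw [trace, Set.inter_univ]
  exact (finsum_mem_eq_card (fun a => ℓ.pt σ hx a) (toAssoc hw hF hA ⁻¹' {p}) A.μ
    fun z hz => hA.card_pt_eq ℓ σ hx (congrArg AssocSpace.pos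
      (show toAssoc hw hF hA z = p from hz) : A.π z = p.pos)).trans
    (card_toAssoc_pt hw hF hA σ hx rfl)

/-- The trace over a component of `L_𝓔` is the sum of the traces over the components of `L` that
are mapped into it, hence constant. -/
theorem assoc_trace_const (U : Set (NR n)) (hU : IsOpen U) (hUc : IsConnected U)
    (p : AssocSpace w) (hp : p.pos ∈ U) : ∃ c : ℕ, 0 < c ∧ ∀ x ∈ U,
      trace (AssocSpace.pos (w := w)) (connectedComponentIn (AssocSpace.pos ⁻¹' U) p)
        (assocMultiSection w).μ x = c := by
  set V := connectedComponentIn (AssocSpace.pos ⁻¹' U) p with hV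
  set f := toAssoc hw hF hA with hf
  let comp : A.L → Set A.L := fun z => connectedComponentIn (A.π ⁻¹' U) z
  have hcompV : ∀ z, A.π z ∈ U → f z ∈ V → ∀ z' ∈ comp z, f z' ∈ V := by
    intro z hz hzV z' hz'
    have h1 : IsPreconnected (f '' comp z) := isPreconnected_connectedComponentIn.image _
      (continuous_toAssoc hw hF hA).continuousOn
    have h2 : f '' comp z ⊆ AssocSpace.pos ⁻¹' U := by
      rintro _ ⟨t, ht, rfl⟩
      exact connectedComponentIn_subset (A.π ⁻¹' U) z ht
    have h3 := h1.subset_connectedComponentIn ⟨z, mem_connectedComponentIn hz, rfl⟩ h2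
    rw [hV, connectedComponentIn_eq hzV]
    exact h3 ⟨z', hz', rfl⟩
  let 𝒲 : Set (Set A.L) := {W | ∃ z, A.π z ∈ U ∧ f z ∈ V ∧ comp z = W}
  have htrace : ∀ x ∈ U, trace (AssocSpace.pos (w := w)) V (assocMultiSection w).μ x =
      ∑ᶠ W ∈ 𝒲, trace A.π W A.μ x := by
    intro x hxU
    obtain ⟨τ, hτ⟩ := hF.exists_cone x
    obtain ⟨σ, hσ⟩ := hF.exists_maxCone τ
    have hx : x ∈ σ.1.1 := hσ hτ.1
    have hptU : ∀ a, A.π (ℓ.pt σ hx a) ∈ U := fun a => by rwa [ℓ.π_pt]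
    rw [trace_pos_eq_card hw hF hA σ hx, finsum_mem_eq_card (fun a => comp (ℓ.pt σ hx a)) 𝒲]
    · refine Nat.card_congr (Equiv.subtypeEquivRight fun a => ⟨fun h => ⟨_, hptU a, h, rfl⟩, ?_⟩)
      rintro ⟨z, hz, hzV, hza⟩
      refine hcompV z hz hzV _ ?_
      rw [hza]
      exact mem_connectedComponentIn (hptU a)
    · rintro _ ⟨z, hz, hzV, rfl⟩
      rw [hA.trace_eq_card ℓ σ hx]
      refine Nat.card_congr (Equiv.subtypeEquivRight fun a => ⟨fun h => ?_, fun h => ?_⟩)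
      · rw [← h]
        exact mem_connectedComponentIn (hptU a)
      · exact (connectedComponentIn_eq h).symm
  have hconst : ∀ x ∈ U, ∀ y ∈ U, trace (AssocSpace.pos (w := w)) V (assocMultiSection w).μ x =
      trace (AssocSpace.pos (w := w)) V (assocMultiSection w).μ y := by
    intro x hx y hy
    rw [htrace x hx, htrace y hy]
    refine finsum_mem_congr rfl ?_
    rintro _ ⟨z, hz, -, rfl⟩
    obtain ⟨c, -, hc⟩ := hA.isBranchedCovering.trace_const U hU hUc z hz
    exact (hc x hx).trans (hc y hy).symm
  refine ⟨_, ?_, fun x hx => hconst x hx p.pos hp⟩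
  obtain ⟨τ, hτ⟩ := hF.exists_cone p.pos
  obtain ⟨σ, hσ⟩ := hF.exists_maxCone τ
  have hx : p.pos ∈ σ.1.1 := hσ hτ.1
  rw [trace_pos_eq_card hw hF hA σ hx]
  have h := card_toAssoc_pt hw hF hA σ hx (p := p) rfl
  have hpos := assoc_μ_pos p
  rw [← h] at hpos
  obtain ⟨⟨a, ha⟩⟩ := (Nat.card_pos_iff.1 hpos).1
  have : Nonempty {a // f (ℓ.pt σ hx a) ∈ V} :=
    ⟨⟨a, by rw [hf, ha]; exact mem_connectedComponentIn hp⟩⟩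
  exact Nat.card_pos

theorem assoc_isBranchedCovering : IsBranchedCovering F (assocMultiSection w).complex
    (assocMultiSection w).μ (assocMultiSection w).π where
  surjective := fun x => by
    obtain ⟨z, rfl⟩ := hA.isBranchedCovering.surjective x
    exact ⟨toAssoc hw hF hA z, rfl⟩
  morphism := by
    refine ⟨AssocSpace.continuous_pos, ?_⟩
    rintro _ ⟨c, rfl⟩
    refine ⟨c.1.1.1, ⟨_, c.1.1.2, rfl⟩, fun p hp => AssocSpace.pos_mem hp, fun u hu => ?_⟩
    obtain ⟨m, rfl⟩ := mem_pulledBack.1 hu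
    exact mem_pulledBack.2 ⟨m, rfl⟩
  cone_image := by
    rintro _ ⟨c, rfl⟩
    exact ⟨c.1.1.1, c.1.1.2, (image_cone hw hF hA c).symm⟩
  cone_homeo := by
    rintro _ ⟨c, rfl⟩
    exact isEmbedding_pos hw hF hA c
  cone_iso := fun _ _ => rfl
  trace_const := assoc_trace_const hw hF hA

theorem assoc_isTropicalLagrangian : (assocMultiSection w).IsTropicalLagrangian F r where
  isConeComplex := assoc_isConeComplex hw hF hA
  isWeight := assoc_isWeight hw hF hA
  isBranchedCovering := assoc_isBranchedCovering hw hF hA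
  rank x := by
    obtain ⟨τ, hτ⟩ := hF.exists_cone x
    obtain ⟨σ, hσ⟩ := hF.exists_maxCone τ
    refine (trace_pos_eq_card hw hF hA σ (hσ hτ.1) Set.univ).trans ?_
    simp
  isPL := by
    rintro _ ⟨c, rfl⟩
    refine mem_pulledBack.2 ⟨Quotient.out c.1.2, ?_⟩
    ext p
    exact AssocSpace.assoc_φ_eq (WeightPoset.mk_eq_of_le p.2 (Quotient.out_eq _))

theorem assoc_le : (assocMultiSection w).Le A := by
  refine ⟨toAssoc hw hF hA, toAssoc_surjective hw hF hA,
    ⟨continuous_toAssoc hw hF hA, fun σ' hσ' => ?_⟩, rfl, trace_toAssoc hw hF hA, ?_⟩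
  · obtain ⟨σ, hσ⟩ := hA.exists_image hσ'
    obtain ⟨x, hx⟩ := σ.relInt_nonempty
    have : x ∈ A.π '' σ' := by
      rw [hσ]
      exact hx.1
    obtain ⟨y, hy, rfl⟩ := this
    obtain rfl := hA.eq_minCone hσ' hσ hy hx
    refine ⟨_, ⟨cellOf hw hF hA y, rfl⟩, fun z hz => cellOf_le hw hF hA hz, fun u hu => ?_⟩
    obtain ⟨m, rfl⟩ := mem_pulledBack.1 hu
    rw [hA.isBranchedCovering.cone_iso _ hσ']
    exact mem_pulledBack.2 ⟨m, rfl⟩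
  · ext z
    refine (AssocSpace.assoc_φ_eq (p := toAssoc hw hF hA z) rfl).trans ?_
    exact (hA.φ_eq_slope (hA.minCone_mem z) (hA.mem_minCone z)).symm

end IsWeightSystem

end MultiSection.Labelling

end TropToric

end

theorem theorem4p3 {n r : ℕ} (F : Fan n) (hF : F.IsComplete)
    (𝕃 : MultiSection.{u} n) (h𝕃 : 𝕃.IsTropicalLagrangian F r) (ℓ : 𝕃.Labelling F r) :
    (∀ g : F.MaxCone → F.MaxCone → GL (Fin r) ℂ, ℓ.IsKaneyama g →
      (∃ E : ToricVectorBundle F r, E.IsGluedFrom ℓ g) ∧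
      ∀ E : ToricVectorBundle F r, E.IsGluedFrom ℓ g →
        (∀ σ : F.Cone, Nonempty (E.EquivariantSplitting σ)) ∧
        ∀ s : ∀ σ : F.Cone, E.EquivariantSplitting σ,
          (E.tropicalMultiSection s).IsTropicalLagrangian F r ∧
          (E.tropicalMultiSection s).Le 𝕃) ∧
    (∀ g g' : F.MaxCone → F.MaxCone → GL (Fin r) ℂ, ℓ.IsKaneyama g → ℓ.IsKaneyama g' →
      ∀ E E' : ToricVectorBundle F r, E.IsGluedFrom ℓ g → E'.IsGluedFrom ℓ g' →
        (ℓ.Equivalent g g' ↔ E.Iso E')) := by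
  refine ⟨fun g hg => ⟨?_, fun E hE => ?_⟩, fun g g' hg hg' E E' hE hE' => ?_⟩
  · obtain ⟨E, s, hs⟩ := hg.isMonomialCocycle.exists_isGluedFrames hF
    exact ⟨E, (hg.isGluedFrom_iff E).2 ⟨s, hs⟩⟩
  · obtain ⟨s₀, hs₀⟩ := (hg.isGluedFrom_iff E).1 hE
    refine ⟨fun σ => ?_, fun s => ?_⟩
    · obtain ⟨σ', h⟩ := hF.exists_maxCone σ
      exact ⟨(s₀ σ').restrict h⟩
    · have hw : ℓ.IsWeightSystem fun σ => (s σ).weight := fun τ σ h => by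
        have := (s τ).exists_perm_weight h (s₀ σ)
        rwa [hs₀.weight] at this
      exact ⟨hw.assoc_isTropicalLagrangian hF h𝕃, hw.assoc_le hF h𝕃⟩
  · obtain ⟨s, hs⟩ := (hg.isGluedFrom_iff E).1 hE
    obtain ⟨s', hs'⟩ := (hg'.isGluedFrom_iff E').1 hE'
    constructor
    · rintro ⟨h, hsupp, hcomm⟩
      have hdet : ∀ σ, (h σ : Matrix (Fin r) (Fin r) ℂ).det ≠ 0 := fun σ =>
        ((Matrix.isUnit_iff_isUnit_det _).1 (h σ).isUnit).ne_zero
      refine iso_of_intertwining hF hg.isMonomialCocycle hg'.isMonomialCocycle hs hs'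
        (K := fun σ => ((h σ)⁻¹ : GL (Fin r) ℂ)) (fun σ => ?_) (fun σ => ?_) fun σ₁ σ₂ => ?_
      · exact ((Matrix.isUnit_iff_isUnit_det _).1 ((h σ)⁻¹).isUnit).ne_zero
      · rw [Matrix.coe_units_inv]
        exact SupportedOn.inv (hsupp σ) (hdet σ)
      · have : g σ₁ σ₂ * (h σ₂)⁻¹ = (h σ₁)⁻¹ * g' σ₁ σ₂ := by
          rw [mul_inv_eq_iff_eq_mul, mul_assoc, ← hcomm, inv_mul_cancel_left]
        exact congrArg Units.val this
    · intro hiso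
      obtain ⟨K, hdet, hsupp, hK⟩ :=
        exists_intertwining hg.isMonomialCocycle hg'.isMonomialCocycle hs hs' hiso
      let k : F.MaxCone → GL (Fin r) ℂ := fun σ =>
        Matrix.GeneralLinearGroup.mkOfDetNeZero (K σ) (hdet σ)
      have hk : ∀ σ, (k σ : Matrix (Fin r) (Fin r) ℂ) = K σ := fun _ => rfl
      refine ⟨fun σ => (k σ)⁻¹, fun σ a b hab => ?_, fun σ₁ σ₂ => ?_⟩
      · rw [Matrix.coe_units_inv, hk] at hab
        exact SupportedOn.inv (hsupp σ) (hdet σ) a b hab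
      · have : g σ₁ σ₂ * k σ₂ = k σ₁ * g' σ₁ σ₂ := Units.ext (hK σ₁ σ₂)
        rw [inv_mul_eq_iff_eq_mul, ← mul_assoc, ← this, mul_inv_cancel_right]
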